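/- Conventions. A Waldhausen category is a category with two subcategories, of cofibrations and of weak equivalences, such that isomorphisms belong to both; weak equivalences satisfy two-out-of-three; there is a zero object and every $0\to A$ is a cofibration; every diagram $C\leftarrow A\to B$ in which $A\to B$ is a cofibration has a pushout, and $C\to B\cup_A C$ is a cofibration; and the gluing axiom holds (weak equivalences between two such diagrams induce a weak equivalence of pushouts). All Waldhausen categories are small. Let $\mathcal I=\{0\to 1\}$. An $n$-cube in $\mathcal D$ is a functor $I:\mathcal I^n\to\mathcal D$; its southern arrow is $\operatorname{colim}_{\bar\epsilon\neq(1,\dots,1)} I(\bar\epsilon)\to I(1,\dots,1)$ (if the colimit exists). A cube is good if its southern arrow exists and is a cofibration and all its faces are good. For $f_i:A_{i0}\to A_{i1}$ in $\mathcal C_i$ and $F:\mathcal C_1\times\dots\times\mathcal C_k\to\mathcal D$, let $[\bar f]_F$ be the $k$-cube $\bar\epsilon\mapsto F(A_{1\epsilon_1},\dots,A_{k\epsilon_k})$. The functor $F$ is $k$-exact (multiexact) if $F(A_1,\dots,A_k)$ is zero whenever some $A_i$ is zero; $F$ preserves pushouts along cofibrations in each variable separately; $F$ sends tuples of weak equivalences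 to weak equivalences; and $[\bar f]_F$ is good for all tuples $\bar f$ of cofibrations. (For $k=0$ these are the objects of $\mathcal D$.) Let $\mathbf{WaldCat}(\mathcal C_1,\dots,\mathcal C_k;\mathcal D)$ be the category of $k$-exact functors $\mathcal C_1\times\dots\times\mathcal C_k\to\mathcal D$ and all natural transformations. A transformation is a weak equivalence if it is one levelwise; $\alpha:F\to G$ is a cofibration if for all tuples $\bar f$ of cofibrations the $(k+1)$-cube $([\bar f]_F\Rightarrow[\bar f]_G)$ given by $\alpha$ is good. Theorem. Waldhausen categories and multiexact functors form a closed symmetric multicategory. Precisely: (1) Identity functors are $1$-exact. Multiexact functors are stable under permutation of the input variables and under composition: if $F$ is $\ell$-exact and $G_i$ is $k_i$-exact for $1\le i\le\ell$, then $F\circ(G_1\times\dots\times G_\ell)$ is $(\sum k_i)$-exact. With these operations the multiexact functors satisfy the axioms of a symmetric multicategory (right action of permutations, associativity, units, equivariance of composition in both arguments). (2) Each $\mathbf{WaldCat}(\mathcal C_1,\dots,\mathcal C_k;\mathcal D)$, with the above cofibrations and weak equivalences, is a Waldhausen category. (3) The evaluation functor $\mathrm{ev}:\mathcal C_1\times\dots\times\mathcal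 C_k\times\mathbf{WaldCat}(\mathcal C_1,\dots,\mathcal C_k;\mathcal D)\to\mathcal D$, $(A_1,\dots,A_k,F)\mapsto F(A_1,\dots,A_k)$, is $(k+1)$-exact. (4) For $\sigma\in\Sigma_k$ the functor $F\mapsto F\cdot\sigma$, from $\mathbf{WaldCat}(\mathcal C_1,\dots,\mathcal C_k;\mathcal D)$ to $\mathbf{WaldCat}(\mathcal C_{\sigma(1)},\dots,\mathcal C_{\sigma(k)};\mathcal D)$, is $1$-exact, and these functors form a right action. For all Waldhausen categories $\mathcal A_1,\dots,\mathcal A_\ell$ the assignment $\varphi(f)=\mathrm{ev}\circ(1_{\mathcal C_1},\dots,1_{\mathcal C_k},f)$ is a bijection from the $\ell$-exact functors $\mathcal A_1\times\dots\times\mathcal A_\ell\to\mathbf{WaldCat}(\mathcal C_1,\dots,\mathcal C_k;\mathcal D)$ to the $(k+\ell)$-exact functors $\mathcal C_1\times\dots\times\mathcal C_k\times\mathcal A_1\times\dots\times\mathcal A_\ell\to\mathcal D$. It is $\Sigma_k\times\Sigma_\ell$-equivariant: $\varphi(\sigma\circ(f\cdot\tau))=\varphi(f)\cdot(\sigma\times\tau)$,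 where $\sigma\circ{-}$ is postcomposition with $F\mapsto F\cdot\sigma$. (5) Composition is multiexact: the functor $(F,G_1,\dots,G_\ell)\mapsto F\circ(G_1\times\dots\times G_\ell)$, from $\mathbf{WaldCat}(\mathcal B_1,\dots,\mathcal B_\ell;\mathcal D)\times\prod_{i}\mathbf{WaldCat}(\mathcal A_{i1},\dots,\mathcal A_{ik_i};\mathcal B_i)$ to $\mathbf{WaldCat}(\mathcal A_{11},\dots,\mathcal A_{\ell k_\ell};\mathcal D)$, given on morphisms by horizontal composition, is $(\ell+1)$-exact. Here $k,\ell,k_i\ge 0$, and tuples may be indexed by arbitrary finite sets instead of $\{1,\dots,k\}$, with bijections of finite sets in place of permutations, disjoint unions in place of concatenations, and the canonical bijections between such index sets understood in the axioms. -/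

import Mathlib

open CategoryTheory CategoryTheory.Limits

universe u v w w₁

noncomputable section

namespace Waldhausen

/-! ### Waldhausen categories -/

/-- `cof` and `weq` (the morphisms of the two wide subcategories of cofibrations and of weak
equivalences) make the category `C` a Waldhausen category. -/
structure IsWaldhausen (C : Type u) [Category.{v} C] (cof weq : MorphismProperty C) : Prop where
  cof_multiplicative : cof.IsMultiplicative
  weq_multiplicative : weq.IsMultiplicative
  /-- Isomorphisms are cofibrations and weak equivalences. -/
  cof_of_isIso : ∀ {A B : C} (f : A ⟶ B), IsIso f → cof f
  weq_of_isIso : ∀ {A B : C} (f : A ⟶ B), IsIso f → weq f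
  /-- Two out of three for weak equivalences. -/
  two_out_of_three : weq.HasTwoOutOfThreeProperty
  /-- There is a zero object, and `0 ⟶ A` is a cofibration. -/
  hasZero : HasZeroObject C
  cof_from_zero : ∀ {Z A : C} (_ : IsZero Z) (f : Z ⟶ A), cof f
  /-- Pushouts along cofibrations exist, and cofibrations are stable under pushout. -/
  pushout : ∀ {A B C' : C} (f : A ⟶ B) (g : A ⟶ C'), cof f →
    ∃ (P : C) (h : B ⟶ P) (k : C' ⟶ P), IsPushout f g h k ∧ cof k
  /-- The gluing axiom. -/
  gluing : ∀ {A B C' P A₁ B₁ C₁ P₁ : C}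
    {f : A ⟶ B} {g : A ⟶ C'} {h : B ⟶ P} {k : C' ⟶ P}
    {f₁ : A₁ ⟶ B₁} {g₁ : A₁ ⟶ C₁} {h₁ : B₁ ⟶ P₁} {k₁ : C₁ ⟶ P₁}
    (a : A ⟶ A₁) (b : B ⟶ B₁) (c : C' ⟶ C₁) (p : P ⟶ P₁),
    IsPushout f g h k → IsPushout f₁ g₁ h₁ k₁ → cof f → cof f₁ →
    weq a → weq b → weq c →
    f ≫ b = a ≫ f₁ → g ≫ c = a ≫ g₁ → h ≫ p = b ≫ h₁ → k ≫ p = c ≫ k₁ →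
    weq p

/-- A (small) Waldhausen category. -/
structure WaldCat : Type (u + 1) where
  carrier : Type u
  [category : Category.{u} carrier]
  cof : MorphismProperty carrier
  weq : MorphismProperty carrier
  isWaldhausen : IsWaldhausen carrier cof weq

instance : CoeSort WaldCat.{u} (Type u) := ⟨WaldCat.carrier⟩

instance (C : WaldCat.{u}) : Category.{u} C := C.category

/-! ### Cubes -/

/-- The objects of the cube category `I^ι`: vectors of zeros and ones, ordered componentwise. -/
def Vertex (ι : Type) : Type := ι → Fin 2

instance (ι : Type) : PartialOrder (Vertex ι) := inferInstanceAs (PartialOrder (ι → Fin 2))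

/-- The functor `I^ι ⥤ I` reading the coordinate `i`. -/
def coord {ι : Type} (i : ι) : Vertex ι ⥤ Fin 2 :=
  Monotone.functor (f := fun x : Vertex ι => x i) (fun _ _ h => h i)

/-- The functor `I^(ι ⊕ κ) ⥤ I^ι` forgetting the coordinates in `κ`. -/
def forgetCoord (ι κ : Type) : Vertex (ι ⊕ κ) ⥤ Vertex ι :=
  Monotone.functor (X := Vertex (ι ⊕ κ)) (Y := Vertex ι) (f := fun x i => x (Sum.inl i))
    (fun _ _ h i => h (Sum.inl i))

/-- An `ι`-cube in `D`; for `ι` with `n` elements this is an `n`-cube. -/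
abbrev Cube (ι : Type) (D : Type u) [Category.{v} D] := Vertex ι ⥤ D

section cubes

variable {ι : Type} {D : Type u} [Category.{v} D]

/-- The (iterated) faces of a cube, the cube itself included, are its restrictions to the intervals
`{x | a ≤ x ≤ b}` for vertices `a ≤ b`: the coordinate `i` varies if `a i < b i` and is constant
otherwise. This is the face between `a` and `b` with its last vertex `b` removed. -/
def puncturedFace (X : Cube ι D) (a b : Vertex ι) : Set.Ico a b ⥤ D :=
  Monotone.functor (f := fun x : Set.Ico a b => (x : Vertex ι)) (fun _ _ h => h) ⋙ X

/-- The value of a cube at the vertex `b`, as a cocone under the punctured face. -/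
def terminalCocone (X : Cube ι D) (a b : Vertex ι) : Cocone (puncturedFace X a b) where
  pt := X.obj b
  ι :=
    { app := fun x => X.map (homOfLE x.2.2.le)
      naturality := fun x y f => by
        dsimp [puncturedFace]
        rw [← X.map_comp, Category.comp_id]
        rfl }

/-- The southern arrow of the face of `X` between `a` and `b` exists and belongs to `cof`. -/
def SouthernArrowMem (cof : MorphismProperty D) (X : Cube ι D) (a b : Vertex ι) : Prop :=
  ∃ (c : Cocone (puncturedFace X a b)) (hc : IsColimit c), cof (hc.desc (terminalCocone X a b))

/-- A cube is good if its southern arrow and those of all its iterated faces are cofibrations. -/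
def IsGood (cof : MorphismProperty D) (X : Cube ι D) : Prop :=
  ∀ a b : Vertex ι, a ≤ b → SouthernArrowMem cof X a b

/-- The cube `(X ⇒ Y)` of a natural transformation `α : X ⟶ Y` of `ι`-cubes: it has one more
coordinate, and restricts to `X` and to `Y` where that coordinate is `0` and `1`. -/
def arrowCube {X Y : Cube ι D} (α : X ⟶ Y) : Cube (ι ⊕ Unit) D :=
  Functor.prod' (coord (Sum.inr ())) (forgetCoord ι Unit) ⋙
    Functor.uncurry.obj (ComposableArrows.mk₁ α)

end cubes

/-- The product functor `I^ι ⥤ ∏ C i` of the arrows `f i : X i ⟶ Y i`. -/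
def boxCube {ι : Type} {C : ι → WaldCat.{u}} {X Y : ∀ i, C i} (f : X ⟶ Y) :
    Cube ι (∀ i, C i) :=
  Functor.pi' fun i => coord i ⋙ ComposableArrows.mk₁ (f i)

/-! ### Multiexact functors -/

section multiexact

variable {ι : Type} (C : ι → WaldCat.{u}) (D : WaldCat.{u})

/-- `F : ∏ C i ⥤ D` is multiexact (`k`-exact, if `ι` has `k` elements). -/
structure IsMultiexact (F : (∀ i, C i) ⥤ D) : Prop where
  /-- `F` is zero as soon as one variable is zero. -/
  zero : ∀ (X : ∀ i, C i) (i : ι), IsZero (X i) → IsZero (F.obj X)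
  /-- `F` preserves in each variable `i` the pushouts along cofibrations: the other variables
  are held constant, up to isomorphism. (A square all of whose arrows are isomorphisms is isomorphic
  to a constant one.) -/
  pushout : ∀ (i : ι) {A B A' P : ∀ i, C i} (f : A ⟶ B) (g : A ⟶ A') (h : B ⟶ P) (k : A' ⟶ P),
    (∀ j, IsPushout (f j) (g j) (h j) (k j)) →
    (C i).cof (f i) → (∀ j, j ≠ i → IsIso (f j) ∧ IsIso (g j)) →
    IsPushout (F.map f) (F.map g) (F.map h) (F.map k)
  /-- `F` preserves (componentwise) weak equivalences. -/
  weq : ∀ {X Y : ∀ i, C i} (f : X ⟶ Y), (∀ i, (C i).weq (f i)) → D.weq (F.map f)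
  /-- The cube `[f]_F` of a tuple `f` of cofibrations is good. -/
  cof : ∀ {X Y : ∀ i, C i} (f : X ⟶ Y), (∀ i, (C i).cof (f i)) → IsGood D.cof (boxCube f ⋙ F)

/-- The category of multiexact functors `∏ C i ⥤ D` and all natural transformations. -/
abbrev Multiexact : Type u :=
  ObjectProperty.FullSubcategory (C := (∀ i, C i) ⥤ D) (IsMultiexact C D)

variable {C D}

/-- Cofibrations of multiexact functors: the transformations `α : F ⟶ G` such that the cube
`([f]_F ⇒ [f]_G)` is good for all tuples `f` of cofibrations. -/
def homCof : MorphismProperty (Multiexact C D) := fun F G α =>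
  ∀ {X Y : ∀ i, C i} (f : X ⟶ Y), (∀ i, (C i).cof (f i)) →
    IsGood D.cof
      (arrowCube (X := boxCube f ⋙ F.obj) (Y := boxCube f ⋙ G.obj)
        (Functor.whiskerLeft (boxCube f) α.hom))

/-- Weak equivalences of multiexact functors are levelwise. -/
def homWeq : MorphismProperty (Multiexact C D) := fun _ _ α =>
  ∀ X : ∀ i, C i, D.weq (α.hom.app X)

end multiexact

/-! ### Symmetric multicategories

Tuples of objects are indexed by arbitrary finite sets `ι`; the `k`-morphisms with their
`Σ_k`-action are obtained for `ι = Fin k`. -/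

/-- The data of a symmetric multicategory: objects, multimorphisms, for every bijection `e` the
action `f ↦ f · e` permuting the input variables, units, and the composition law
`(f, (g i)) ↦ f ∘ (g i)`, whose inputs are the disjoint union of the inputs of the `g i`. -/
structure MulticategoryData where
  Obj : Type w
  Hom : ∀ {ι : Type} [Finite ι], (ι → Obj) → Obj → Type w₁
  act : ∀ {ι ι' : Type} [Finite ι] [Finite ι'] {A : ι → Obj} {B : Obj} (e : ι' ≃ ι),
    Hom A B → Hom (fun i => A (e i)) B
  one : ∀ A : Obj, Hom (fun _ : Unit => A) A
  comp : ∀ {ι : Type} [Finite ι] {J : ι → Type} [∀ i, Finite (J i)]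
    {A : (Σ i, J i) → Obj} {B : ι → Obj} {C : Obj},
    Hom B C → (∀ i, Hom (fun j => A ⟨i, j⟩) (B i)) → Hom A C

/-- `Σ _ : Unit, ι` is in bijection with `ι`. -/
def unitSigma (ι : Type) : (Σ _ : Unit, ι) ≃ ι where
  toFun p := p.2
  invFun i := ⟨(), i⟩
  left_inv _ := rfl
  right_inv _ := rfl

/-- `Σ _ : ι, Unit` is in bijection with `ι`. -/
def sigmaUnit (ι : Type) : (Σ _ : ι, Unit) ≃ ι where
  toFun p := p.1
  invFun i := ⟨i, ()⟩
  left_inv _ := rfl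
  right_inv _ := rfl

/-- The laws of a symmetric multicategory: the `act e` form a right action, units are neutral,
composition is associative, and it is equivariant in the outer and in the inner multimorphisms. -/
structure IsSymmetricMulticategory (M : MulticategoryData.{w, w₁}) : Prop where
  act_refl : ∀ {ι : Type} [Finite ι] {A : ι → M.Obj} {B : M.Obj} (f : M.Hom A B),
    M.act (Equiv.refl ι) f = f
  act_act : ∀ {ι ι' ι'' : Type} [Finite ι] [Finite ι'] [Finite ι''] {A : ι → M.Obj} {B : M.Obj}
    (e : ι' ≃ ι) (e' : ι'' ≃ ι') (f : M.Hom A B),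
    M.act e' (M.act e f) = M.act (e'.trans e) f
  one_comp : ∀ {ι : Type} [Finite ι] {A : ι → M.Obj} {B : M.Obj} (f : M.Hom A B),
    M.comp (A := fun p : (Σ _ : Unit, ι) => A p.2) (M.one B) (fun _ => f) = M.act (unitSigma ι) f
  comp_one : ∀ {ι : Type} [Finite ι] {A : ι → M.Obj} {B : M.Obj} (f : M.Hom A B),
    M.comp (A := fun p : (Σ _ : ι, Unit) => A p.1) f (fun i => M.one (A i)) =
      M.act (sigmaUnit ι) f
  assoc : ∀ {ι : Type} [Finite ι] {J : ι → Type} [∀ i, Finite (J i)]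
    {K : ∀ i, J i → Type} [∀ i j, Finite (K i j)]
    {A : (Σ i, Σ j, K i j) → M.Obj} {B : (Σ i, J i) → M.Obj} {C : ι → M.Obj} {D : M.Obj}
    (f : M.Hom C D) (g : ∀ i, M.Hom (fun j => B ⟨i, j⟩) (C i))
    (h : ∀ i j, M.Hom (fun k => A ⟨i, j, k⟩) (B ⟨i, j⟩)),
    M.comp (A := fun p : (Σ q : (Σ i, J i), K q.1 q.2) => A ⟨p.1.1, p.1.2, p.2⟩)
        (M.comp f g) (fun q => h q.1 q.2) =
      M.act (Equiv.sigmaAssoc K)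
        (M.comp f fun i =>
          M.comp (A := fun p : (Σ j, K i j) => A ⟨i, p⟩) (g i) (fun j => h i j))
  act_comp : ∀ {ι ι' : Type} [Finite ι] [Finite ι'] {J : ι → Type} [∀ i, Finite (J i)]
    {A : (Σ i, J i) → M.Obj} {B : ι → M.Obj} {C : M.Obj} (e : ι' ≃ ι)
    (f : M.Hom B C) (g : ∀ i, M.Hom (fun j => A ⟨i, j⟩) (B i)),
    M.comp (A := fun p : (Σ i', J (e i')) => A ⟨e p.1, p.2⟩) (M.act e f) (fun i' => g (e i')) =
      M.act (Equiv.sigmaCongrLeft e) (M.comp f g)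
  comp_act : ∀ {ι : Type} [Finite ι] {J J' : ι → Type} [∀ i, Finite (J i)] [∀ i, Finite (J' i)]
    {A : (Σ i, J i) → M.Obj} {B : ι → M.Obj} {C : M.Obj} (e : ∀ i, J' i ≃ J i)
    (f : M.Hom B C) (g : ∀ i, M.Hom (fun j => A ⟨i, j⟩) (B i)),
    M.comp (A := fun p : (Σ i, J' i) => A ⟨p.1, e p.1 p.2⟩) f (fun i => M.act (e i) (g i)) =
      M.act (Equiv.sigmaCongrRight e) (M.comp f g)

namespace MulticategoryData

variable (M : MulticategoryData.{w, w₁})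

/-- The composite `u ∘ f` of a multimorphism `f` with a `1`-morphism `u`, its inputs being indexed
like those of `f`. -/
def postcomp {ι : Type} [Finite ι] {A : ι → M.Obj} {B B' : M.Obj}
    (u : M.Hom (fun _ : Unit => B) B') (f : M.Hom A B) : M.Hom A B' :=
  M.act (A := fun p : (Σ _ : Unit, ι) => A p.2) (unitSigma ι).symm
    (M.comp (A := fun p : (Σ _ : Unit, ι) => A p.2) u (fun _ => f))

end MulticategoryData

/-- The data of internal homs: objects `hom A B`, evaluation morphisms `A, hom A B ⟶ B`, and the
action `hom A B ⟶ hom (A ∘ e) B` of the bijections `e`. -/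
structure HomData (M : MulticategoryData.{w, w₁}) where
  hom : ∀ {ι : Type} [Finite ι], (ι → M.Obj) → M.Obj → M.Obj
  ev : ∀ {ι : Type} [Finite ι] (A : ι → M.Obj) (B : M.Obj),
    M.Hom (Sum.elim A (fun _ : Unit => hom A B)) B
  homAct : ∀ {ι ι' : Type} [Finite ι] [Finite ι'] (A : ι → M.Obj) (B : M.Obj) (e : ι' ≃ ι),
    M.Hom (fun _ : Unit => hom A B) (hom (fun i => A (e i)) B)

/-- The inputs of `ev ∘ (1, …, 1, f)`: one input for each `1`, and the inputs of `f`. -/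
def EvInputs (ι κ : Type) : ι ⊕ Unit → Type
  | Sum.inl _ => Unit
  | Sum.inr _ => κ

instance (ι κ : Type) [Finite κ] : ∀ s : ι ⊕ Unit, Finite (EvInputs ι κ s)
  | Sum.inl _ => inferInstanceAs (Finite Unit)
  | Sum.inr _ => inferInstanceAs (Finite κ)

/-- The inputs of `ev ∘ (1, …, 1, f)` are in bijection with `ι ⊕ κ`. -/
def evInputsEquiv (ι κ : Type) : (Σ s, EvInputs ι κ s) ≃ ι ⊕ κ where
  toFun
    | ⟨Sum.inl i, _⟩ => Sum.inl i
    | ⟨Sum.inr _, k⟩ => Sum.inr k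
  invFun
    | Sum.inl i => ⟨Sum.inl i, ()⟩
    | Sum.inr k => ⟨Sum.inr (), k⟩
  left_inv := by rintro ⟨_ | _, _⟩ <;> rfl
  right_inv := by rintro (_ | _) <;> rfl

/-- The composite `ev ∘ (1, …, 1, f)`, where `X` is the concatenation of the tuple `X ∘ inl` of
arguments of `ev` and of the tuple `X ∘ inr` of inputs of `f`. -/
def HomData.evComp {M : MulticategoryData.{w, w₁}} (H : HomData M) {ι κ : Type} [Finite ι]
    [Finite κ] (X : ι ⊕ κ → M.Obj) (B : M.Obj)
    (f : M.Hom (fun k => X (Sum.inr k)) (H.hom (fun i => X (Sum.inl i)) B)) :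
    M.Hom (fun p => X (evInputsEquiv ι κ p)) B :=
  M.comp (A := fun p => X (evInputsEquiv ι κ p)) (H.ev (fun i => X (Sum.inl i)) B) fun s =>
    match s with
    | Sum.inl i => M.one (X (Sum.inl i))
    | Sum.inr _ => f

/-- The internal homs `H` make the symmetric multicategory `M` closed. -/
structure IsClosedMulticategory (M : MulticategoryData.{w, w₁}) (H : HomData M) : Prop where
  symmetric : IsSymmetricMulticategory M
  /-- `homAct` is a right action. -/
  homAct_refl : ∀ {ι : Type} [Finite ι] (A : ι → M.Obj) (B : M.Obj),
    H.homAct A B (Equiv.refl ι) = M.one (H.hom A B)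
  homAct_homAct : ∀ {ι ι' ι'' : Type} [Finite ι] [Finite ι'] [Finite ι''] (A : ι → M.Obj)
    (B : M.Obj) (e : ι' ≃ ι) (e' : ι'' ≃ ι'),
    M.postcomp (H.homAct (fun i => A (e i)) B e') (H.homAct A B e) = H.homAct A B (e'.trans e)
  /-- Sending `f` to `ev ∘ (1, …, 1, f)` (with its inputs indexed by `ι ⊕ κ`) is a bijection `φ`,
  which is equivariant: `φ (e ∘ (f · t)) = (φ f) · (e × t)`. -/
  closed : ∃ φ : ∀ {ι κ : Type} [Finite ι] [Finite κ] (X : ι ⊕ κ → M.Obj) (B : M.Obj),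
      M.Hom (fun k => X (Sum.inr k)) (H.hom (fun i => X (Sum.inl i)) B) ≃ M.Hom X B,
    (∀ {ι κ : Type} [Finite ι] [Finite κ] (X : ι ⊕ κ → M.Obj) (B : M.Obj)
      (f : M.Hom (fun k => X (Sum.inr k)) (H.hom (fun i => X (Sum.inl i)) B)),
      M.act (evInputsEquiv ι κ) (φ X B f) = H.evComp X B f) ∧
    ∀ {ι ι' κ κ' : Type} [Finite ι] [Finite ι'] [Finite κ] [Finite κ'] (X : ι ⊕ κ → M.Obj)
      (B : M.Obj) (e : ι' ≃ ι) (t : κ' ≃ κ)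
      (f : M.Hom (fun k => X (Sum.inr k)) (H.hom (fun i => X (Sum.inl i)) B)),
      φ (fun s => X (Equiv.sumCongr e t s)) B
          (M.postcomp (H.homAct (fun i => X (Sum.inl i)) B e) (M.act t f)) =
        M.act (Equiv.sumCongr e t) (φ X B f)

/-! ### The multicategory of Waldhausen categories -/

/-- The identity of `C`, as a functor of one variable. -/
def idFunctor (C : WaldCat.{u}) : (∀ _ : Unit, C) ⥤ C :=
  Pi.eval (fun _ : Unit => C.carrier) ()

/-- The isomorphism of categories `∏ C (e j) ⥤ ∏ C i` sending the tuple `(X (e j))` to `(X i)`. -/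
def permute {ι ι' : Type} (C : ι → WaldCat.{u}) (e : ι' ≃ ι) :
    (∀ j, C (e j)) ⥤ (∀ i, C i) :=
  (Pi.equivalenceOfEquiv (fun i => (C i).carrier) e).functor

/-- `permute C e` inverts the reindexing functor `(X i) ↦ (X (e j))`. -/
theorem comap_permute {ι ι' : Type} (C : ι → WaldCat.{u}) (e : ι' ≃ ι) :
    Pi.comap (fun i => (C i).carrier) e ⋙ permute C e = 𝟭 _ := by
  refine Functor.pi_ext _ _ fun i => ?_
  have key : ∀ (i' : ι) (h : i' = i),
      Pi.eval (fun i => (C i).carrier) i' ⋙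
        (Pi.eqToEquivalence (fun i => (C i).carrier) h).functor =
      Pi.eval (fun i => (C i).carrier) i := by
    rintro _ rfl; rfl
  exact key (e (e.symm i)) (by simp)

/-- The functor `F` with permuted input variables. -/
def actFunctor {ι ι' : Type} {C : ι → WaldCat.{u}} {D : WaldCat.{u}} (e : ι' ≃ ι)
    (F : (∀ i, C i) ⥤ D) : (∀ j, C (e j)) ⥤ D :=
  permute C e ⋙ F

/-- The composite `F ∘ (∏ G i)`. -/
def compFunctor {ι : Type} {J : ι → Type} {A : (Σ i, J i) → WaldCat.{u}} {B : ι → WaldCat.{u}}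
    {D : WaldCat.{u}} (F : (∀ i, B i) ⥤ D) (G : ∀ i, (∀ j, A ⟨i, j⟩) ⥤ B i) :
    (∀ p, A p) ⥤ D :=
  Functor.pi' (fun i => Pi.comap (fun p => (A p).carrier) (Sigma.mk i) ⋙ G i) ⋙ F

/-- Identity functors are multiexact, and multiexact functors are stable under permutation of the
input variables and under composition. -/
structure MultiexactStable : Prop where
  id : ∀ C : WaldCat.{u}, IsMultiexact (fun _ : Unit => C) C (idFunctor C)
  act : ∀ {ι ι' : Type} [Finite ι] [Finite ι'] {C : ι → WaldCat.{u}} {D : WaldCat.{u}}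
    (e : ι' ≃ ι) (F : (∀ i, C i) ⥤ D), IsMultiexact C D F →
    IsMultiexact (fun j => C (e j)) D (actFunctor e F)
  comp : ∀ {ι : Type} [Finite ι] {J : ι → Type} [∀ i, Finite (J i)]
    {A : (Σ i, J i) → WaldCat.{u}} {B : ι → WaldCat.{u}} {D : WaldCat.{u}}
    (F : (∀ i, B i) ⥤ D) (G : ∀ i, (∀ j, A ⟨i, j⟩) ⥤ B i), IsMultiexact B D F →
    (∀ i, IsMultiexact (fun j => A ⟨i, j⟩) (B i) (G i)) →
    IsMultiexact A D (compFunctor F G)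

/-- Waldhausen categories and multiexact functors. -/
def waldMulti (h : MultiexactStable.{u}) : MulticategoryData.{u + 1, u} where
  Obj := WaldCat.{u}
  Hom C D := Multiexact C D
  act e F := ⟨actFunctor e F.obj, h.act e F.obj F.property⟩
  one C := ⟨idFunctor C, h.id C⟩
  comp F G := ⟨compFunctor F.obj (fun i => (G i).obj),
    h.comp F.obj (fun i => (G i).obj) F.property (fun i => (G i).property)⟩

/-- The internal hom `WaldCat(C; D)`, given that it is a Waldhausen category. -/
def internalHom {ι : Type} (C : ι → WaldCat.{u}) (D : WaldCat.{u})
    (hW : IsWaldhausen (Multiexact C D) homCof homWeq) : WaldCat.{u} where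
  carrier := Multiexact C D
  cof := homCof
  weq := homWeq
  isWaldhausen := hW

theorem map_comp_app {A : Type*} [Category* A] {B : Type*} [Category* B] {F G H : A ⥤ B}
    (α : F ⟶ G) (β : G ⟶ H) {X Y Z : A} (a : X ⟶ Y) (b : Y ⟶ Z) :
    F.map (a ≫ b) ≫ (α ≫ β).app Z = (F.map a ≫ α.app Y) ≫ G.map b ≫ β.app Z := by
  simp

/-- Evaluation `(X, F) ↦ F (X)`. -/
def evFunctor {ι : Type} (C : ι → WaldCat.{u}) (D : WaldCat.{u})
    (hW : IsWaldhausen (Multiexact C D) homCof homWeq) :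
    (∀ s : ι ⊕ Unit, (Sum.elim C (fun _ => internalHom C D hW) s : WaldCat.{u})) ⥤ D where
  obj X :=
    let F : Multiexact C D := X (Sum.inr ())
    let X' : ∀ i, C i := fun i => X (Sum.inl i)
    F.obj.obj X'
  map {X Y} f :=
    let F : Multiexact C D := X (Sum.inr ())
    let G : Multiexact C D := Y (Sum.inr ())
    let α : F ⟶ G := f (Sum.inr ())
    let X' : ∀ i, C i := fun i => X (Sum.inl i)
    let Y' : ∀ i, C i := fun i => Y (Sum.inl i)
    let a : X' ⟶ Y' := fun i => f (Sum.inl i)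
    F.obj.map a ≫ α.hom.app Y'
  map_id X :=
    let F : Multiexact C D := X (Sum.inr ())
    let X' : ∀ i, C i := fun i => X (Sum.inl i)
    (congrArg₂ (· ≫ ·) (F.obj.map_id X') rfl).trans (Category.comp_id _)
  map_comp {X Y Z} f g :=
    let F : Multiexact C D := X (Sum.inr ())
    let G : Multiexact C D := Y (Sum.inr ())
    let H : Multiexact C D := Z (Sum.inr ())
    let α : F ⟶ G := f (Sum.inr ())
    let β : G ⟶ H := g (Sum.inr ())
    let X' : ∀ i, C i := fun i => X (Sum.inl i)
    let Y' : ∀ i, C i := fun i => Y (Sum.inl i)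
    let Z' : ∀ i, C i := fun i => Z (Sum.inl i)
    let a : X' ⟶ Y' := fun i => f (Sum.inl i)
    let b : Y' ⟶ Z' := fun i => g (Sum.inl i)
    map_comp_app α.hom β.hom a b

/-- The functor `F ↦ F · e` on categories of multiexact functors. -/
def homActFunctor (h : MultiexactStable.{u}) {ι ι' : Type} [Finite ι] [Finite ι']
    (C : ι → WaldCat.{u}) (D : WaldCat.{u}) (e : ι' ≃ ι) :
    (∀ _ : Unit, Multiexact C D) ⥤ Multiexact (fun j => C (e j)) D where
  obj F := ⟨actFunctor e (F ()).obj, h.act e _ (F ()).property⟩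
  map α := ObjectProperty.homMk (Functor.whiskerLeft (permute C e) (α ()).hom)

/-- The composition functor `(F, (G i)) ↦ F ∘ (∏ G i)` on categories of multiexact functors. On
morphisms it is the horizontal composition of natural transformations. -/
def compositionFunctor (h : MultiexactStable.{u})
    (hW : ∀ {ι : Type} [Finite ι] (C : ι → WaldCat.{u}) (D : WaldCat.{u}),
      IsWaldhausen (Multiexact C D) homCof homWeq)
    {ι : Type} [Finite ι] {J : ι → Type} [∀ i, Finite (J i)]
    (A : (Σ i, J i) → WaldCat.{u}) (B : ι → WaldCat.{u}) (D : WaldCat.{u}) :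
    (∀ s : Unit ⊕ ι, (Sum.elim (fun _ => internalHom B D (hW B D))
      (fun i => internalHom (fun j => A ⟨i, j⟩) (B i) (hW _ _)) s : WaldCat.{u})) ⥤
      internalHom A D (hW A D) where
  obj X :=
    let F : Multiexact B D := X (Sum.inl ())
    let G : ∀ i, Multiexact (fun j => A ⟨i, j⟩) (B i) := fun i => X (Sum.inr i)
    (⟨compFunctor F.obj (fun i => (G i).obj),
      h.comp F.obj (fun i => (G i).obj) F.property (fun i => (G i).property)⟩ : Multiexact A D)
  map {X Y} f :=
    let F : Multiexact B D := X (Sum.inl ())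
    let F' : Multiexact B D := Y (Sum.inl ())
    let G : ∀ i, Multiexact (fun j => A ⟨i, j⟩) (B i) := fun i => X (Sum.inr i)
    let G' : ∀ i, Multiexact (fun j => A ⟨i, j⟩) (B i) := fun i => Y (Sum.inr i)
    let α : F ⟶ F' := f (Sum.inl ())
    let β : ∀ i, G i ⟶ G' i := fun i => f (Sum.inr i)
    ObjectProperty.homMk
      (NatTrans.pi' (fun i => Functor.whiskerLeft
        (Pi.comap (fun p => (A p).carrier) (Sigma.mk i)) (β i).hom) ◫ α.hom)
  map_id X := by
    let F : Multiexact B D := X (Sum.inl ())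
    refine ObjectProperty.hom_ext _ (NatTrans.ext (funext fun T => ?_))
    exact (congrArg₂ (· ≫ ·) rfl (F.obj.map_id _)).trans (Category.comp_id _)
  map_comp {X Y Z} f g := by
    let F : Multiexact B D := X (Sum.inl ())
    let F' : Multiexact B D := Y (Sum.inl ())
    let F'' : Multiexact B D := Z (Sum.inl ())
    let G : ∀ i, Multiexact (fun j => A ⟨i, j⟩) (B i) := fun i => X (Sum.inr i)
    let G' : ∀ i, Multiexact (fun j => A ⟨i, j⟩) (B i) := fun i => Y (Sum.inr i)
    let G'' : ∀ i, Multiexact (fun j => A ⟨i, j⟩) (B i) := fun i => Z (Sum.inr i)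
    let α : F ⟶ F' := f (Sum.inl ())
    let α' : F' ⟶ F'' := g (Sum.inl ())
    let β : ∀ i, G i ⟶ G' i := fun i => f (Sum.inr i)
    let β' : ∀ i, G' i ⟶ G'' i := fun i => g (Sum.inr i)
    let P : ∀ i, Multiexact (fun j => A ⟨i, j⟩) (B i) → ((∀ p, A p) ⥤ B i) := fun i K =>
      Pi.comap (fun p => (A p).carrier) (Sigma.mk i) ⋙ K.obj
    let γ : Functor.pi' (fun i => P i (G i)) ⟶ Functor.pi' (fun i => P i (G' i)) :=
      NatTrans.pi' (fun i => Functor.whiskerLeft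
        (Pi.comap (fun p => (A p).carrier) (Sigma.mk i)) (β i).hom)
    let γ' : Functor.pi' (fun i => P i (G' i)) ⟶ Functor.pi' (fun i => P i (G'' i)) :=
      NatTrans.pi' (fun i => Functor.whiskerLeft
        (Pi.comap (fun p => (A p).carrier) (Sigma.mk i)) (β' i).hom)
    refine ObjectProperty.hom_ext _ ?_
    change (γ ≫ γ') ◫ (α.hom ≫ α'.hom) = (γ ◫ α.hom) ≫ (γ' ◫ α'.hom)
    exact NatTrans.exchange γ γ' α.hom α'.hom

/-- The internal homs of `waldMulti h`. -/
def waldHom (h : MultiexactStable.{u})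
    (hW : ∀ {ι : Type} [Finite ι] (C : ι → WaldCat.{u}) (D : WaldCat.{u}),
      IsWaldhausen (Multiexact C D) homCof homWeq)
    (hev : ∀ {ι : Type} [Finite ι] (C : ι → WaldCat.{u}) (D : WaldCat.{u}),
      IsMultiexact _ D (evFunctor C D (hW C D)))
    (hact : ∀ {ι ι' : Type} [Finite ι] [Finite ι'] (C : ι → WaldCat.{u}) (D : WaldCat.{u})
      (e : ι' ≃ ι),
      IsMultiexact (fun _ : Unit => internalHom C D (hW C D)) (internalHom (fun j => C (e j)) D (hW _ D))
        (homActFunctor h C D e)) :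
    HomData (waldMulti h) where
  hom C D := internalHom C D (hW C D)
  ev C D := ⟨evFunctor C D (hW C D), hev C D⟩
  homAct C D e := ⟨homActFunctor h C D e, hact C D e⟩

end Waldhausen

end

open Waldhausen

/-! Good cubes are Reedy cofibrant diagrams. For a diagram `X` on a finite partial order, the
latching map at `b` goes from the colimit of `X` over the elements strictly below `b` to the value
at `b`. A cube is good exactly when, after restriction to each principal up-set `{x | a ≤ x}`, all
latching maps exist and are cofibrations (`isGood_iff`). This condition, `Good`, makes sense on
every partial order, so cylinders, products and cubes of cubes are treated alike.

Two tools carry the argument. First, adjoining a maximal element `b` to an index set replaces the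
colimit by its pushout along the latching map at `b` (`IsColim.insert`, `IsColim.isPushout`). By
induction, colimits of Reedy cofibrant diagrams exist, inclusions of lower sets induce cofibrations
between them (`Reedy.cof_desc`), and functors preserving zero objects and pushouts along
cofibrations preserve them (`PreservesCof.isColim`). Second, left Kan extension along an
order-preserving map `m` preserves Reedy cofibrancy (`IsKan.reedy`): the latching object at `b` and
the value at `b` are colimits over `{m x < b}` and `{m x ≤ b}`, and the first set is a lower subset
of the second. Most goodness statements follow by recognising a diagram as a Kan extension of a good
one.

A transformation of diagrams is a diagram on the cylinder, and it is a cofibration if that diagram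
is good. Under composition and cobase change the new latching maps are built from pushouts of old
ones (`CofTrans.comp`, `CofTrans.of_isPushout`). Together with the levelwise computation of zero
objects and pushouts this gives the Waldhausen structure on multiexact functors.

Stability under composition rests on `IsMultiexact.good_prod`: if the `X i` are good diagrams with
latching maps `s i`, the latching map of `F (X 1, …, X k)` is the southern arrow of the cube
`[s]_F`, hence a cofibration. This needs that `F` preserves Reedy colimits in all variables jointly
(`IsMultiexact.isColim_prod`).

For closedness, the cube of evaluation at a tuple and a cofibration is the cylinder of that
cofibration. Conversely, a functor `K` into multiexact functors is multiexact as soon as its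
uncurried form is (`isMultiexact_of_uncurryHom`): the southern arrows of `[g]_K`, tested on a box of
cofibrations, are Kan extensions of parts of the good cube of the uncurried functor
(`cofTrans_of_good_joinCube`). The action on internal homs and the composition functor are then
multiexact because their uncurried forms are evaluation with permuted variables and `ev ∘ (ev, …,
ev, 1)`.

The laws are strict equalities of functors. Permuting variables involves transports along equalities
of indices, but its inverse, plain reindexing, does not; `eq_actFunctor` moves each law to the
transport-free side. -/

noncomputable section

namespace Waldhausen

/-! ### Colimits over subsets of a partial order, and latching maps -/

section colim

variable {P : Type*} [PartialOrder P] {D : Type*} [Category* D]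

/-- The family `c` is a colimit cocone of the restriction of `X` to `S`. -/
structure IsColim (X : P ⥤ D) (S : P → Prop) (E : D) (c : ∀ p, S p → (X.obj p ⟶ E)) : Prop where
  w : ∀ p q (hp : S p) (hq : S q) (h : p ≤ q), X.map (homOfLE h) ≫ c q hq = c p hp
  exists_desc : ∀ (T : D) (d : ∀ p, S p → (X.obj p ⟶ T)),
    (∀ p q (hp : S p) (hq : S q) (h : p ≤ q), X.map (homOfLE h) ≫ d q hq = d p hp) →
    ∃ t : E ⟶ T, ∀ p hp, c p hp ≫ t = d p hp
  hom_ext : ∀ (T : D) (t t' : E ⟶ T), (∀ p hp, c p hp ≫ t = c p hp ≫ t') → t = t'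

/-- The southern arrow of `X` at `b`, relative to `T`, exists and belongs to `cof`. -/
def CofAt (cof : MorphismProperty D) (X : P ⥤ D) (T : P → Prop) (b : P) : Prop :=
  ∃ (E : D) (c : ∀ p, T p ∧ p < b → (X.obj p ⟶ E)), IsColim X (fun p => T p ∧ p < b) E c ∧
    ∃ s : E ⟶ X.obj b, (∀ p hp, c p hp ≫ s = X.map (homOfLE hp.2.le)) ∧ cof s

/-- Reedy cofibrancy of the restriction of `X` to `T`. -/
def Reedy (cof : MorphismProperty D) (X : P ⥤ D) (T : P → Prop) : Prop :=
  ∀ b, T b → CofAt cof X T b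

/-- Goodness for diagrams on any partial order. -/
def Good (cof : MorphismProperty D) (X : P ⥤ D) : Prop :=
  ∀ a, Reedy cof X (a ≤ ·)

variable {X : P ⥤ D} {S T : P → Prop} {E E' : D}

theorem map_homOfLE_self (X : P ⥤ D) {p : P} (h : p ≤ p) : X.map (homOfLE h) = 𝟙 _ := X.map_id p

theorem map_homOfLE_comp (X : P ⥤ D) {p q r : P} (h : p ≤ q) (h' : q ≤ r) :
    X.map (homOfLE h) ≫ X.map (homOfLE h') = X.map (homOfLE (h.trans h')) :=
  (X.map_comp _ _).symm

theorem map_homOfLE_comp_assoc (X : P ⥤ D) {p q r : P} (h : p ≤ q) (h' : q ≤ r) {Z : D}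
    (f : X.obj r ⟶ Z) :
    X.map (homOfLE h) ≫ X.map (homOfLE h') ≫ f = X.map (homOfLE (h.trans h')) ≫ f := by
  rw [← Category.assoc, map_homOfLE_comp]

theorem IsColim.iso {c : ∀ p, S p → (X.obj p ⟶ E)} {c' : ∀ p, S p → (X.obj p ⟶ E')}
    (h : IsColim X S E c) (h' : IsColim X S E' c') :
    ∃ e : E ≅ E', ∀ p hp, c p hp ≫ e.hom = c' p hp := by
  obtain ⟨t, ht⟩ := h.exists_desc E' c' h'.w
  obtain ⟨t', ht'⟩ := h'.exists_desc E c h.w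
  exact ⟨⟨t, t', h.hom_ext _ _ _ fun p hp => by rw [← Category.assoc, ht, ht', Category.comp_id],
    h'.hom_ext _ _ _ fun p hp => by rw [← Category.assoc, ht', ht, Category.comp_id]⟩, ht⟩

theorem IsColim.of_iso {c : ∀ p, S p → (X.obj p ⟶ E)} (h : IsColim X S E c) (e : E ≅ E') :
    IsColim X S E' (fun p hp => c p hp ≫ e.hom) where
  w p q hp hq hpq := by rw [← Category.assoc, h.w p q hp hq hpq]
  exists_desc T d hd := by
    obtain ⟨t, ht⟩ := h.exists_desc T d hd
    exact ⟨e.inv ≫ t, fun p hp => by simp [ht]⟩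
  hom_ext T t t' ht := by
    rw [← cancel_epi e.hom]
    exact h.hom_ext _ _ _ fun p hp => by simpa using ht p hp

/-- A set with a top element has the obvious colimit. -/
theorem isColim_of_top {b : P} (hb : T b) (hT : ∀ p, T p → p ≤ b) :
    IsColim X T (X.obj b) (fun p hp => X.map (homOfLE (hT p hp))) where
  w p q hp hq h := by rw [← X.map_comp]; rfl
  exists_desc Z d hd := ⟨d b hb, fun p hp => hd p b hp hb (hT p hp)⟩
  hom_ext Z t t' ht := by
    have := ht b hb
    rwa [map_homOfLE_self, Category.id_comp, Category.id_comp] at this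

theorem isColim_empty {Z : D} (hZ : IsZero Z) (hT : ∀ p, ¬ T p) (c : ∀ p, T p → (X.obj p ⟶ Z)) :
    IsColim X T Z c where
  w p _ hp _ _ := (hT p hp).elim
  exists_desc Z' _ _ := ⟨hZ.to_ Z', fun p hp => (hT p hp).elim⟩
  hom_ext _ _ _ _ := hZ.eq_of_src _ _

/-- Colimits only depend on a cofinal subset. -/
theorem IsColim.of_cofinal (hST : ∀ p, S p → T p) (hcof : ∀ x, T x → ∃ y, S y ∧ x ≤ y)
    {c : ∀ p, T p → (X.obj p ⟶ E)}
    (hc : ∀ p q (hp : T p) (hq : T q) (h : p ≤ q), X.map (homOfLE h) ≫ c q hq = c p hp)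
    (h : IsColim X S E (fun p hp => c p (hST p hp))) : IsColim X T E c where
  w := hc
  exists_desc Z d hd := by
    obtain ⟨t, ht⟩ := h.exists_desc Z (fun p hp => d p (hST p hp))
      (fun p q hp hq hpq => hd p q _ _ hpq)
    refine ⟨t, fun p hp => ?_⟩
    obtain ⟨y, hy, hpy⟩ := hcof p hp
    rw [← hc p y hp (hST y hy) hpy, Category.assoc, ht y hy, hd p y hp _ hpy]
  hom_ext Z t t' ht := h.hom_ext _ _ _ fun p hp => ht p (hST p hp)

theorem IsColim.congr_set (hST : ∀ p, S p ↔ T p) {c : ∀ p, S p → (X.obj p ⟶ E)}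
    (h : IsColim X S E c) : IsColim X T E (fun p hp => c p ((hST p).2 hp)) := by
  obtain rfl : S = T := funext fun p => propext (hST p)
  exact h

theorem CofAt.congr {cof : MorphismProperty D} {b : P}
    (hST : ∀ p, p < b → (S p ↔ T p)) (h : CofAt cof X S b) : CofAt cof X T b := by
  obtain ⟨E, c, hc, s, hs, hs'⟩ := h
  have e : ∀ p, (S p ∧ p < b) ↔ (T p ∧ p < b) := fun p => and_congr_left (hST p)
  exact ⟨E, fun p hp => c p ((e p).2 hp), hc.congr_set e, s, fun p hp => hs p _, hs'⟩

/-- Allows a cocone to be prescribed separately at `b` and away from `b` while hiding the case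
distinction and its cast. -/
theorem exists_family_insert {b : P} (hb : T b) (f : X.obj b ⟶ E)
    (c : ∀ p, T p ∧ p ≠ b → (X.obj p ⟶ E)) :
    ∃ c' : ∀ p, T p → (X.obj p ⟶ E), c' b hb = f ∧ ∀ p hp, c' p hp.1 = c p hp := by
  classical
  refine ⟨fun p hp => if h : p = b then eqToHom (by rw [h]) ≫ f else c p ⟨hp, h⟩, by simp,
    fun p hp => ?_⟩
  have : p ≠ b := hp.2
  simp [this]

section insert

variable {b : P} (hb : T b) (hmax : ∀ x, T x → b ≤ x → x = b)
  {A E' E : D} {cA : ∀ p, T p ∧ p < b → (X.obj p ⟶ A)} (hA : IsColim X (fun p => T p ∧ p < b) A cA)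
  {s : A ⟶ X.obj b} (hs : ∀ p hp, cA p hp ≫ s = X.map (homOfLE hp.2.le))
  {c' : ∀ p, T p ∧ p ≠ b → (X.obj p ⟶ E')} (h' : IsColim X (fun p => T p ∧ p ≠ b) E' c')
  {g : A ⟶ E'} (hg : ∀ p (hp : T p ∧ p < b), cA p hp ≫ g = c' p ⟨hp.1, hp.2.ne⟩)
  {c : ∀ p, T p → (X.obj p ⟶ E)} {k : E' ⟶ E} (hk : ∀ p hp, c p hp.1 = c' p hp ≫ k)

-- Since `b` is maximal in `T`, a cocone on `T` is a cocone on `T` without `b` together with a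
-- morphism out of `X.obj b`, and the two need only agree on the elements strictly below `b`, that
-- is, on the latching object `A`.
include hmax hA hs h' hg hk in
theorem IsColim.insert (h : IsPushout s g (c b hb) k) : IsColim X T E c where
  w p q hp hq hpq := by
    by_cases hqb : q = b
    · subst hqb
      by_cases hpb : p = q
      · subst hpb; rw [map_homOfLE_self, Category.id_comp]
      · have hlt : p < q := lt_of_le_of_ne hpq hpb
        have e1 := hs p ⟨hp, hlt⟩
        have e2 := hg p ⟨hp, hlt⟩
        have e3 := hk p ⟨hp, hpb⟩
        have e4 := h.w
        rw [e3, ← e2, Category.assoc, ← e4, ← Category.assoc, e1]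
    · have hpb : p ≠ b := fun hpb => hqb (hmax q hq (hpb ▸ hpq))
      rw [hk p ⟨hp, hpb⟩, hk q ⟨hq, hqb⟩, ← Category.assoc, h'.w p q ⟨hp, hpb⟩ ⟨hq, hqb⟩ hpq]
  exists_desc Z d hd := by
    obtain ⟨t, ht⟩ := h'.exists_desc Z (fun p hp => d p hp.1) (fun p q hp hq => hd p q hp.1 hq.1)
    have e : s ≫ d b hb = g ≫ t := hA.hom_ext _ _ _ fun p hp => by
      rw [← Category.assoc, hs, ← Category.assoc, hg, ht, hd]
    refine ⟨h.desc (d b hb) t e, fun p hp => ?_⟩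
    by_cases hpb : p = b
    · subst hpb; exact h.inl_desc _ _ _
    · rw [hk p ⟨hp, hpb⟩, Category.assoc, h.inr_desc, ht]
  hom_ext Z t t' htt := by
    refine h.hom_ext (htt b hb) (h'.hom_ext _ _ _ fun p hp => ?_)
    rw [← Category.assoc, ← Category.assoc, ← hk]
    exact htt p hp.1

-- The converse of `IsColim.insert`: it decomposes a colimit that is already given, as is needed to
-- show that a functor preserves it.
include hmax hA hs h' hg hk in
theorem IsColim.isPushout (h : IsColim X T E c) : IsPushout s g (c b hb) k := by
  have w : s ≫ c b hb = g ≫ k := hA.hom_ext _ _ _ fun p hp => by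
    rw [← Category.assoc, hs, ← Category.assoc, hg, ← hk, h.w]
  have key : ∀ {Z : D} (y : X.obj b ⟶ Z) (z : E' ⟶ Z), s ≫ y = g ≫ z →
      ∃ t : E ⟶ Z, c b hb ≫ t = y ∧ k ≫ t = z := by
    intro Z y z hyz
    obtain ⟨d, hd1, hd2⟩ := exists_family_insert hb y (fun p hp => c' p hp ≫ z)
    obtain ⟨t, ht⟩ := h.exists_desc Z d (by
      intro p q hp hq hpq
      by_cases hqb : q = b
      · subst hqb
        by_cases hpb : p = q
        · subst hpb; rw [map_homOfLE_self, Category.id_comp]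
        · have hlt : p < q := lt_of_le_of_ne hpq hpb
          rw [hd1, hd2 p ⟨hp, hpb⟩, ← hg p ⟨hp, hlt⟩, Category.assoc, ← hyz, ← Category.assoc,
            hs]
      · have hpb : p ≠ b := fun hpb => hqb (hmax q hq (hpb ▸ hpq))
        rw [hd2 p ⟨hp, hpb⟩, hd2 q ⟨hq, hqb⟩, ← Category.assoc, h'.w p q ⟨hp, hpb⟩ ⟨hq, hqb⟩ hpq])
    refine ⟨t, by rw [ht, hd1], h'.hom_ext _ _ _ fun p hp => ?_⟩
    rw [← Category.assoc, ← hk, ht, hd2]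
  refine ⟨⟨w⟩, ⟨PushoutCocone.IsColimit.mk _ (fun r => (key r.inl r.inr r.condition).choose)
    (fun r => (key r.inl r.inr r.condition).choose_spec.1)
    (fun r => (key r.inl r.inr r.condition).choose_spec.2) fun r m h1 h2 => ?_⟩⟩
  obtain ⟨e1, e2⟩ := (key r.inl r.inr r.condition).choose_spec
  refine h.hom_ext _ _ _ fun p hp => ?_
  by_cases hpb : p = b
  · subst hpb; rw [e1]; exact h1
  · rw [hk p ⟨hp, hpb⟩, Category.assoc, Category.assoc, e2, h2]

end insert

end colim

theorem remove_lt {P : Type*} {T : P → Prop} {b : P} (hb : T b) : (fun p => T p ∧ p ≠ b) < T :=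
  ⟨fun _ h => h.1, fun h => (h b hb).2 rfl⟩

/-! ### Colimits of Reedy cofibrant diagrams -/

section waldhausen

variable {P : Type*} [PartialOrder P] {D : Type u} [Category.{v} D] {cof weq : MorphismProperty D}

theorem IsWaldhausen.cof_comp (hD : IsWaldhausen D cof weq) {A B C : D} {f : A ⟶ B} {g : B ⟶ C}
    (hf : cof f) (hg : cof g) : cof (f ≫ g) :=
  haveI := hD.cof_multiplicative
  cof.comp_mem f g hf hg

theorem IsWaldhausen.weq_comp (hD : IsWaldhausen D cof weq) {A B C : D} {f : A ⟶ B} {g : B ⟶ C}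
    (hf : weq f) (hg : weq g) : weq (f ≫ g) :=
  haveI := hD.weq_multiplicative
  weq.comp_mem f g hf hg

/-- The axiom provides only one pushout with this property; any other differs from it by an
isomorphism, which is a cofibration. -/
theorem IsWaldhausen.cof_inr (hD : IsWaldhausen D cof weq) {A B C Q : D} {f : A ⟶ B} {g : A ⟶ C}
    {h : B ⟶ Q} {k : C ⟶ Q} (sq : IsPushout f g h k) (hf : cof f) : cof k := by
  obtain ⟨Q', h', k', sq', hk'⟩ := hD.pushout f g hf
  have : k = k' ≫ (sq'.isoIsPushout _ _ sq).hom := by simp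
  rw [this]
  exact hD.cof_comp hk' (hD.cof_of_isIso _ inferInstance)

variable {X : P ⥤ D} {S T : P → Prop} {E E' : D}

/-- A maximal element of `T` outside `S` is maximal in all of `T`, because `S` is a lower set in
`T`. -/
theorem exists_maximal_mem [Finite P] (S T : P → Prop)
    (hS : ∀ x, T x → ∀ y, S y → x ≤ y → S x) (hne : ¬ ∀ x, T x → S x) :
    ∃ b, T b ∧ ¬ S b ∧ ∀ x, T x → b ≤ x → x = b := by
  push Not at hne
  obtain ⟨x, hxT, hxS⟩ := hne
  obtain ⟨b, hb⟩ := (Set.toFinite {x | T x ∧ ¬ S x}).exists_maximal ⟨x, hxT, hxS⟩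
  refine ⟨b, hb.1.1, hb.1.2, fun x hx hbx => ?_⟩
  by_cases hxS : S x
  · exact absurd (hS b hb.1.1 x hxS hbx) hb.1.2
  · exact le_antisymm (hb.2 ⟨hx, hxS⟩ hbx) hbx

theorem below_lt {b : P} (hb : T b) : (fun p => T p ∧ p < b) < T :=
  ⟨fun _ h => h.1, fun h => lt_irrefl b (h b hb).2⟩

/-- Colimits along relative Reedy cofibrations exist, and are cofibrations. -/
theorem exists_isColim_of_subset [Finite P] (hD : IsWaldhausen D cof weq) (hST : ∀ p, S p → T p)
    (hS : ∀ x, T x → ∀ y, S y → x ≤ y → S x) (hcof : ∀ b, T b → ¬ S b → CofAt cof X T b)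
    {c : ∀ p, S p → (X.obj p ⟶ E)} (h : IsColim X S E c) :
    ∃ (E' : D) (c' : ∀ p, T p → (X.obj p ⟶ E')), IsColim X T E' c' ∧
      ∃ t : E ⟶ E', (∀ p hp, c p hp ≫ t = c' p (hST p hp)) ∧ cof t := by
  induction T using WellFoundedLT.induction with
  | ind T ih =>
  by_cases hTS : ∀ x, T x → S x
  · obtain rfl : S = T := funext fun p => propext ⟨hST p, hTS p⟩
    exact ⟨E, c, h, 𝟙 _, fun p hp => Category.comp_id _, hD.cof_of_isIso _ inferInstance⟩
  obtain ⟨b, hb, hbS, hmax⟩ := exists_maximal_mem S T hS hTS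
  have hsub : ∀ x, S x → T x ∧ x ≠ b := fun x hx => ⟨hST x hx, fun hxb => hbS (hxb ▸ hx)⟩
  -- As `b` is maximal in `T`, it lies below no other element, so removing it leaves the remaining
  -- latching maps unchanged.
  obtain ⟨E₁, c₁, h₁, t₁, ht₁, hct₁⟩ := ih (fun p => T p ∧ p ≠ b) (remove_lt hb) hsub
    (fun x hx y hy => hS x hx.1 y hy)
    (fun x hx hxS => (hcof x hx.1 hxS).congr (fun y hy =>
      ⟨fun h => ⟨h, fun hyb => hx.2 (hmax x hx.1 (hyb ▸ hy.le))⟩, fun h => h.1⟩))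
  obtain ⟨A, cA, hA, s, hs, hcs⟩ := hcof b hb hbS
  obtain ⟨g, hg⟩ := hA.exists_desc E₁ (fun p hp => c₁ p ⟨hp.1, hp.2.ne⟩)
    (fun p q hp hq => h₁.w _ _ _ _)
  obtain ⟨Q, hh, k, sq, hk⟩ := hD.pushout s g hcs
  obtain ⟨c', hc'1, hc'2⟩ := exists_family_insert hb hh (fun p hp => c₁ p hp ≫ k)
  refine ⟨Q, c', IsColim.insert hb hmax hA hs h₁ hg hc'2 (hc'1 ▸ sq), t₁ ≫ k, fun p hp => ?_,
    hD.cof_comp hct₁ hk⟩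
  rw [← Category.assoc, ht₁, hc'2 p (hsub p hp)]

theorem Reedy.exists_isColim [Finite P] (hD : IsWaldhausen D cof weq) (h : Reedy cof X T) :
    ∃ (E : D) (c : ∀ p, T p → (X.obj p ⟶ E)), IsColim X T E c := by
  obtain ⟨Z, hZ⟩ := hD.hasZero.zero
  obtain ⟨E', c', h', -⟩ := exists_isColim_of_subset (S := fun _ => False) hD
    (fun _ hx => hx.elim) (fun _ _ _ hy => hy.elim) (fun b hb _ => h b hb)
    (isColim_empty (X := X) hZ (fun _ hx => hx) (fun p hp => hp.elim))
  exact ⟨E', c', h'⟩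

/-- A lower set contains everything of `T` below each of its elements, so it has the same latching
objects. -/
theorem Reedy.subset (h : Reedy cof X T) (hST : ∀ p, S p → T p)
    (hS : ∀ x, T x → ∀ y, S y → x ≤ y → S x) : Reedy cof X S := fun b hb =>
  (h b (hST b hb)).congr fun x hx => ⟨fun h => hS x h b hb hx.le, hST x⟩

/-- The map of colimits of an inclusion of lower sets is a cofibration. -/
theorem Reedy.cof_desc [Finite P] (hD : IsWaldhausen D cof weq) (h : Reedy cof X T)
    (hST : ∀ p, S p → T p) (hS : ∀ x, T x → ∀ y, S y → x ≤ y → S x)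
    {c : ∀ p, S p → (X.obj p ⟶ E)} (hc : IsColim X S E c)
    {c' : ∀ p, T p → (X.obj p ⟶ E')} (hc' : IsColim X T E' c')
    {t : E ⟶ E'} (ht : ∀ p hp, c p hp ≫ t = c' p (hST p hp)) : cof t := by
  obtain ⟨E₁, c₁, h₁, t₁, ht₁, hcof⟩ := exists_isColim_of_subset hD hST hS (fun b hb _ => h b hb) hc
  obtain ⟨e, he⟩ := h₁.iso hc'
  have : t = t₁ ≫ e.hom := hc.hom_ext _ _ _ fun p hp => by
    rw [ht, ← Category.assoc, ht₁, he]
  rw [this]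
  exact hD.cof_comp hcof (hD.cof_of_isIso _ inferInstance)

/-- The singleton of `a` is a lower set in the interval from `a` to `b`. Both have a greatest
element, so the map of their colimits is the structure map of `X`. -/
theorem Good.cof_map [Finite P] (hD : IsWaldhausen D cof weq) (h : Good cof X) {a b : P}
    (hab : a ≤ b) : cof (X.map (homOfLE hab)) := by
  refine Reedy.cof_desc hD (S := fun x => x = a) (T := fun x => a ≤ x ∧ x ≤ b)
    ((h a).subset (fun x hx => hx.1) (fun x hx y hy hxy => ⟨hx, hxy.trans hy.2⟩))
    (by rintro x rfl; exact ⟨le_rfl, hab⟩) (by rintro x hx y rfl hxy; exact le_antisymm hxy hx.1)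
    (isColim_of_top (T := fun x => x = a) (b := a) rfl (fun p hp => le_of_eq hp))
    (isColim_of_top (b := b) (T := fun x => a ≤ x ∧ x ≤ b) ⟨hab, le_rfl⟩ fun p hp => hp.2) ?_
  intro p hp
  rw [map_homOfLE_comp]

/-- A functor that preserves zero objects and pushouts along cofibrations. -/
structure PreservesCof {B : Type*} [Category* B] (cof : MorphismProperty D) (Φ : D ⥤ B) : Prop where
  zero : ∀ Z, IsZero Z → IsZero (Φ.obj Z)
  pushout : ∀ {A A₁ A₂ A₃ : D} (f : A ⟶ A₁) (g : A ⟶ A₂) (h : A₁ ⟶ A₃) (k : A₂ ⟶ A₃),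
    IsPushout f g h k → cof f → IsPushout (Φ.map f) (Φ.map g) (Φ.map h) (Φ.map k)

/-- The colimit is assembled from a zero object by pushouts along latching maps, one maximal element
at a time, and `Φ` preserves every stage. -/
theorem PreservesCof.isColim {B : Type*} [Category* B] [Finite P] {Φ : D ⥤ B}
    (hΦ : PreservesCof cof Φ) (hD : IsWaldhausen D cof weq) (hT : Reedy cof X T)
    {c : ∀ p, T p → (X.obj p ⟶ E)} (hc : IsColim X T E c) :
    IsColim (X ⋙ Φ) T (Φ.obj E) (fun p hp => Φ.map (c p hp)) := by
  induction T using WellFoundedLT.induction generalizing E with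
  | ind T ih =>
  by_cases hT0 : ∀ x, ¬ T x
  · refine isColim_empty (hΦ.zero E ?_) hT0 _
    obtain ⟨Z, hZ⟩ := hD.hasZero.zero
    obtain ⟨e, -⟩ := (isColim_empty (X := X) hZ hT0 (fun p hp => (hT0 p hp).elim)).iso hc
    exact hZ.of_iso e.symm
  obtain ⟨b, hb, -, hmax⟩ := exists_maximal_mem (fun _ => False) T (fun _ _ _ hy => hy.elim) hT0
  have hR1 := hT.subset (S := fun p => T p ∧ p ≠ b) (fun p hp => hp.1) (fun x hx y hy hxy =>
    ⟨hx, fun hxb => hy.2 (hmax y hy.1 (hxb ▸ hxy))⟩)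
  have hR2 := hT.subset (S := fun p => T p ∧ p < b) (fun p hp => hp.1) (fun x hx y hy hxy =>
    ⟨hx, lt_of_le_of_lt hxy hy.2⟩)
  obtain ⟨E₁, c₁, h₁⟩ := hR1.exists_isColim hD
  obtain ⟨A, cA, hA, s, hs, hcs⟩ := hT b hb
  obtain ⟨g, hg⟩ := hA.exists_desc E₁ (fun p hp => c₁ p ⟨hp.1, hp.2.ne⟩)
    (fun p q hp hq => h₁.w _ _ _ _)
  obtain ⟨k, hk⟩ := h₁.exists_desc E (fun p hp => c p hp.1) (fun p q hp hq => hc.w _ _ _ _)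
  have sq := IsColim.isPushout hb hmax hA hs h₁ hg (fun p hp => (hk p hp).symm) hc
  refine IsColim.insert (X := X ⋙ Φ) (s := Φ.map s) (g := Φ.map g) (k := Φ.map k) hb hmax
    (ih _ (below_lt hb) hR2 hA) ?_ (ih _ (remove_lt hb) hR1 h₁) ?_ ?_ (hΦ.pushout _ _ _ _ sq hcs)
  · intro p hp; rw [← Φ.map_comp, hs]; rfl
  · intro p hp; rw [← Φ.map_comp, hg]
  · intro p hp; rw [← Φ.map_comp, hk]

end waldhausen

/-! ### Left Kan extensions between partial orders -/

section kan

variable {P Q : Type*} [PartialOrder P] [PartialOrder Q] {D : Type u} [Category.{v} D]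
  {Y : P ⥤ D} {W : Q ⥤ D} {m : P → Q} {T : P → Prop} {U : Q → Prop}

/-- `W` is the left Kan extension along `m` of the restriction of `Y` to `T`, at the elements
of `U`. -/
structure IsKan (Y : P ⥤ D) (W : Q ⥤ D) (m : P → Q) (T : P → Prop) (U : Q → Prop)
    (η : ∀ p, T p → (Y.obj p ⟶ W.obj (m p))) : Prop where
  mono : ∀ x y, T x → T y → x ≤ y → m x ≤ m y
  mem : ∀ x, T x → U (m x)
  nat : ∀ p q (hp : T p) (hq : T q) (h : p ≤ q),
    Y.map (homOfLE h) ≫ η q hq = η p hp ≫ W.map (homOfLE (mono p q hp hq h))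
  colim : ∀ q, U q → IsColim Y (fun x => T x ∧ m x ≤ q) (W.obj q)
    (fun p hp => η p hp.1 ≫ W.map (homOfLE hp.2))

variable {η : ∀ p, T p → (Y.obj p ⟶ W.obj (m p))} {E : D}

/-- A colimit of colimits: each value of `W` is a colimit of `Y` over `{m x ≤ q}`, and these sets
exhaust `T` as `q` runs through `U`. -/
theorem IsKan.isColim (h : IsKan Y W m T U η) {c : ∀ q, U q → (W.obj q ⟶ E)}
    (hc : IsColim W U E c) : IsColim Y T E (fun p hp => η p hp ≫ c (m p) (h.mem p hp)) where
  w p q hp hq hpq := by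
    rw [← Category.assoc, h.nat _ _ _ _ hpq, Category.assoc, hc.w]
  exists_desc Z d hd := by
    choose t ht using fun q (hq : U q) => (h.colim q hq).exists_desc Z (fun p hp => d p hp.1)
      (fun p q hp hq => hd p q _ _)
    obtain ⟨t', ht'⟩ := hc.exists_desc Z t (fun q q' hq hq' hqq => by
      refine (h.colim q hq).hom_ext _ _ _ fun p hp => ?_
      rw [ht q hq p hp, ← ht q' hq' p ⟨hp.1, hp.2.trans hqq⟩, Category.assoc, Category.assoc,
        map_homOfLE_comp_assoc])
    refine ⟨t', fun p hp => ?_⟩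
    have := ht (m p) (h.mem p hp) p ⟨hp, le_rfl⟩
    rw [map_homOfLE_self, Category.comp_id] at this
    rw [Category.assoc, ht', this]
  hom_ext Z t t' htt := by
    refine hc.hom_ext _ _ _ fun q hq => (h.colim q hq).hom_ext _ _ _ fun p hp => ?_
    have := htt p hp.1
    rw [← hc.w _ _ (h.mem p hp.1) hq hp.2] at this
    simpa using this

/-- The converse direction: a colimit known for `Y` is also one for the extension `W`. -/
theorem IsKan.exists_isColim (h : IsKan Y W m T U η) {c : ∀ p, T p → (Y.obj p ⟶ E)}
    (hc : IsColim Y T E c) : ∃ c' : ∀ q, U q → (W.obj q ⟶ E), IsColim W U E c' ∧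
      ∀ p hp, η p hp ≫ c' (m p) (h.mem p hp) = c p hp := by
  choose c' hc' using fun q (hq : U q) => (h.colim q hq).exists_desc E (fun p hp => c p hp.1)
    (fun p q hp hq => hc.w p q _ _)
  have key : ∀ p hp, η p hp ≫ c' (m p) (h.mem p hp) = c p hp := fun p hp => by
    have := hc' (m p) (h.mem p hp) p ⟨hp, le_rfl⟩
    rwa [map_homOfLE_self, Category.comp_id] at this
  refine ⟨c', ⟨?_, ?_, ?_⟩, key⟩
  · intro q q' hq hq' hqq
    refine (h.colim q hq).hom_ext _ _ _ fun p hp => ?_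
    rw [hc' q hq p hp, ← hc' q' hq' p ⟨hp.1, hp.2.trans hqq⟩, Category.assoc, Category.assoc,
        map_homOfLE_comp_assoc]
  · intro Z d hd
    obtain ⟨t, ht⟩ := hc.exists_desc Z (fun p hp => η p hp ≫ d (m p) (h.mem p hp))
      (fun p q hp hq hpq => by
        rw [← Category.assoc, h.nat _ _ _ _ hpq, Category.assoc, hd])
    refine ⟨t, fun q hq => (h.colim q hq).hom_ext _ _ _ fun p hp => ?_⟩
    rw [← Category.assoc, hc' q hq p hp, ht, Category.assoc, hd]
  · intro Z t t' htt
    refine hc.hom_ext _ _ _ fun p hp => ?_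
    rw [← key, Category.assoc, Category.assoc, htt]

/-- For `q` in the lower set `V`, the condition `m x ≤ q` already forces `m x` into `V`, so the
pointwise formula is unaffected. -/
theorem IsKan.restrict (h : IsKan Y W m T U η) (V : Q → Prop) (hV : ∀ q, V q → U q)
    (hl : ∀ x, U x → ∀ y, V y → x ≤ y → V x) :
    IsKan Y W m (fun x => T x ∧ V (m x)) V (fun p hp => η p hp.1) where
  mono x y hx hy := h.mono x y hx.1 hy.1
  mem _ hx := hx.2
  nat p q hp hq := h.nat p q hp.1 hq.1
  colim q hq := (h.colim q (hV q hq)).congr_set fun x =>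
    ⟨fun hx => ⟨⟨hx.1, hl _ (h.mem x hx.1) q hq hx.2⟩, hx.2⟩, fun hx => ⟨hx.1.1, hx.2⟩⟩

/-- Left Kan extensions of Reedy cofibrant diagrams are Reedy cofibrant. -/
theorem IsKan.reedy {cof weq : MorphismProperty D} [Finite P] (hD : IsWaldhausen D cof weq)
    (h : IsKan Y W m T U η) (hY : Reedy cof Y T) : Reedy cof W U := by
  intro b hb
  -- The latching object of `W` at `b` is computed on `P`, as the colimit of `Y` over `{m x < b}`.
  have h1 := h.restrict (fun x => U x ∧ x < b) (fun x hx => hx.1)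
    (fun x hx y hy hxy => ⟨hx, hxy.trans_lt hy.2⟩)
  have hlow : ∀ x, T x → ∀ y, (T y ∧ U (m y) ∧ m y < b) → x ≤ y → T x ∧ U (m x) ∧ m x < b :=
    fun x hx y hy hxy => ⟨hx, h.mem x hx, (h.mono x y hx hy.1 hxy).trans_lt hy.2.2⟩
  obtain ⟨E, c, hc⟩ := (hY.subset (fun x hx => hx.1) hlow).exists_isColim hD
  obtain ⟨c', hc', hcc⟩ := h1.exists_isColim hc
  obtain ⟨s, hs⟩ := hc'.exists_desc (W.obj b) (fun q hq => W.map (homOfLE hq.2.le))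
    (fun p q hp hq hpq => map_homOfLE_comp _ _ _)
  refine ⟨E, c', hc', s, hs, ?_⟩
  -- The value of `W` at `b` is the colimit over `{m x ≤ b}`, which contains the previous index set
  -- as a lower set.
  refine Reedy.cof_desc hD (hY.subset (S := fun x => T x ∧ m x ≤ b) (fun x hx => hx.1)
    (fun x hx y hy hxy => ⟨hx, (h.mono x y hx hy.1 hxy).trans hy.2⟩))
    (fun x hx => ⟨hx.1, hx.2.2.le⟩) (fun x hx y hy hxy => hlow x hx.1 y hy hxy) hc (h.colim b hb) ?_
  intro p hp
  rw [← hcc, Category.assoc, hs]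

end kan

/-! ### Transport of goodness, and comparison with cubes -/

section transfer

variable {P Q : Type*} [PartialOrder P] [PartialOrder Q] {D : Type u} [Category.{v} D]
  {Y : P ⥤ D} {W : Q ⥤ D} {m : P → Q} {T : P → Prop} {U : Q → Prop}
  {η : ∀ p, T p → (Y.obj p ⟶ W.obj (m p))}

/-- A colimit over a set with a top element, up to isomorphism. -/
theorem isColim_of_top_iso {E : D} {b : P} (hb : T b) (hT : ∀ p, T p → p ≤ b)
    {c : ∀ p, T p → (Y.obj p ⟶ E)}
    (hc : ∀ p q (hp : T p) (hq : T q) (h : p ≤ q), Y.map (homOfLE h) ≫ c q hq = c p hp)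
    (hiso : IsIso (c b hb)) : IsColim Y T E c := by
  have h := (isColim_of_top (X := Y) hb hT).of_iso (asIso (c b hb))
  have e : (fun p hp => Y.map (homOfLE (hT p hp)) ≫ (asIso (c b hb)).hom) = c := by
    funext p hp
    exact hc p b hp hb _
  rwa [e] at h

/-- If each set `{m x ≤ q}` has a greatest element `r`, the colimit defining the extension is the
value of `Y` at `r`. Most Kan extensions below have this form. -/
theorem IsKan.of_top (mono : ∀ x y, T x → T y → x ≤ y → m x ≤ m y) (mem : ∀ x, T x → U (m x))
    (nat : ∀ p q (hp : T p) (hq : T q) (h : p ≤ q),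
      Y.map (homOfLE h) ≫ η q hq = η p hp ≫ W.map (homOfLE (mono p q hp hq h)))
    (top : ∀ q, U q → ∃ (r : P) (hr : T r) (hq : m r ≤ q), (∀ x, T x → m x ≤ q → x ≤ r) ∧
      IsIso (η r hr ≫ W.map (homOfLE hq))) : IsKan Y W m T U η where
  mono := mono
  mem := mem
  nat := nat
  colim q hq := by
    obtain ⟨r, hr, hrq, hmax, hiso⟩ := top q hq
    refine isColim_of_top_iso (b := r) ⟨hr, hrq⟩ (fun p hp => hmax p hp.1 hp.2) ?_ hiso
    intro p p' hp hp' hpp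
    rw [← Category.assoc, nat p p' hp.1 hp'.1 hpp, Category.assoc, map_homOfLE_comp]

theorem Good.of_orderIso {cof weq : MorphismProperty D} [Finite P] (hD : IsWaldhausen D cof weq)
    (φ : P ≃o Q) (η : ∀ p, Y.obj p ≅ W.obj (φ p))
    (nat : ∀ p q (h : p ≤ q),
      Y.map (homOfLE h) ≫ (η q).hom = (η p).hom ≫ W.map (homOfLE (φ.monotone h)))
    (h : Good cof Y) : Good cof W := by
  intro a
  refine IsKan.reedy (Y := Y) (m := φ) (T := fun p => φ.symm a ≤ p) (η := fun p _ => (η p).hom) hD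
    ?_ (h (φ.symm a))
  refine IsKan.of_top (fun x y _ _ h => φ.monotone h) (fun x hx => ?_)
    (fun p q _ _ h => nat p q h) fun q hq => ⟨φ.symm q, ?_, ?_, ?_, ?_⟩
  · rw [← φ.apply_symm_apply a]; exact φ.monotone hx
  · exact φ.symm.monotone hq
  · rw [φ.apply_symm_apply]
  · intro x _ hx
    rw [← φ.symm_apply_apply x]; exact φ.symm.monotone hx
  -- The values of `W` at `φ (φ.symm q)` and at `q` are identified by the structure maps for the two
  -- inequalities rather than by a cast.
  · have : IsIso (W.map (homOfLE (show φ (φ.symm q) ≤ q by rw [φ.apply_symm_apply]))) :=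
      ⟨W.map (homOfLE (by rw [φ.apply_symm_apply])), by
        rw [map_homOfLE_comp, map_homOfLE_self], by rw [map_homOfLE_comp, map_homOfLE_self]⟩
    infer_instance

theorem good_iff_of_orderIso {cof weq : MorphismProperty D} [Finite P]
    (hD : IsWaldhausen D cof weq) (φ : P ≃o Q) (η : ∀ p, Y.obj p ≅ W.obj (φ p))
    (nat : ∀ p q (h : p ≤ q),
      Y.map (homOfLE h) ≫ (η q).hom = (η p).hom ≫ W.map (homOfLE (φ.monotone h))) :
    Good cof Y ↔ Good cof W := by
  refine ⟨Good.of_orderIso hD φ η nat, ?_⟩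
  have : Finite Q := Finite.of_equiv P φ.toEquiv
  have hle : ∀ q, q ≤ φ (φ.symm q) := fun q => by rw [φ.apply_symm_apply]
  have hle' : ∀ q, φ (φ.symm q) ≤ q := fun q => by rw [φ.apply_symm_apply]
  let ε : ∀ q, W.obj q ≅ W.obj (φ (φ.symm q)) := fun q =>
    ⟨W.map (homOfLE (hle q)), W.map (homOfLE (hle' q)), by
        rw [map_homOfLE_comp, map_homOfLE_self], by rw [map_homOfLE_comp, map_homOfLE_self]⟩
  refine Good.of_orderIso hD φ.symm (fun q => ε q ≪≫ (η (φ.symm q)).symm) ?_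
  intro p q h
  have e := nat _ _ (φ.symm.monotone h)
  have e' : Y.map (homOfLE (φ.symm.monotone h)) =
      ((η _).hom ≫ W.map (homOfLE (φ.monotone (φ.symm.monotone h)))) ≫ (η _).inv := by
    rw [← e, Category.assoc, Iso.hom_inv_id, Category.comp_id]
  rw [e']
  simp only [Iso.trans_hom, Iso.symm_hom, Category.assoc, Iso.inv_hom_id_assoc, ε,
    map_homOfLE_comp_assoc]

theorem good_iff_of_iso {cof weq : MorphismProperty D} [Finite P] {Y W : P ⥤ D}
    (hD : IsWaldhausen D cof weq) (e : Y ≅ W) : Good cof Y ↔ Good cof W :=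
  good_iff_of_orderIso hD (OrderIso.refl P) e.app fun _ _ h => e.hom.naturality (homOfLE h)

theorem southernArrowMem_iff {ι : Type} {cof : MorphismProperty D} (X : Cube ι D) (a b : Vertex ι) :
    SouthernArrowMem cof X a b ↔ CofAt cof X (a ≤ ·) b := by
  constructor
  · rintro ⟨c, hc, h⟩
    refine ⟨c.pt, fun p hp => c.ι.app ⟨p, hp⟩, ⟨?_, ?_, ?_⟩, _, ?_, h⟩
    · intro p q hp hq hpq
      exact c.w (j := ⟨q, hq⟩) (j' := ⟨p, hp⟩) (homOfLE hpq)
    · intro T d hd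
      let s : Cocone (puncturedFace X a b) :=
        { pt := T
          ι := { app := fun p => d p.1 p.2
                 naturality := fun p q f => by
                   refine (hd p.1 q.1 p.2 q.2 (leOfHom f)).trans ?_
                   exact (Category.comp_id _).symm } }
      exact ⟨hc.desc s, fun p hp => hc.fac s ⟨p, hp⟩⟩
    · intro T t t' htt
      exact hc.hom_ext fun p => htt p.1 p.2
    · intro p hp
      exact hc.fac _ _
  · rintro ⟨E, c, hc, s, hs, hcof⟩
    let c' : Cocone (puncturedFace X a b) :=
      { pt := E
        ι := { app := fun p => c p.1 p.2
               naturality := fun p q f => by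
                 refine (hc.w p.1 q.1 p.2 q.2 (leOfHom f)).trans ?_
                 exact (Category.comp_id _).symm } }
    have hex : ∀ r : Cocone (puncturedFace X a b), ∃ t : E ⟶ r.pt,
        ∀ p hp, c p hp ≫ t = r.ι.app ⟨p, hp⟩ := fun r =>
      hc.exists_desc r.pt (fun p hp => r.ι.app ⟨p, hp⟩)
        (fun p q hp hq hpq => r.w (j := ⟨q, hq⟩) (j' := ⟨p, hp⟩) (homOfLE hpq))
    let hc' : IsColimit c' :=
      { desc := fun r => (hex r).choose
        fac := fun r p => (hex r).choose_spec p.1 p.2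
        uniq := fun r t ht => hc.hom_ext _ _ _ fun p hp =>
          (ht ⟨p, hp⟩).trans ((hex r).choose_spec p hp).symm }
    refine ⟨c', hc', ?_⟩
    have : hc'.desc (terminalCocone X a b) = s := hc'.hom_ext fun p =>
      (hc'.fac _ p).trans (hs p.1 p.2).symm
    rwa [this]

/-- The faces with first vertex `a` are the intervals from `a` to `b`, so their southern arrows are
the latching maps of the restriction to the elements above `a`. -/
theorem isGood_iff {ι : Type} {cof : MorphismProperty D} (X : Cube ι D) :
    IsGood cof X ↔ Good cof X :=
  forall₂_congr fun a b => imp_congr_right fun _ => southernArrowMem_iff X a b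

end transfer

/-! ### The cylinder on a partial order -/

/-- The cylinder on a partial order `P`, that is, the product of `{0 < 1}` and `P`. -/
inductive Cyl (P : Type*) : Type _
  | lo : P → Cyl P
  | hi : P → Cyl P

namespace Cyl

variable {P : Type*} [PartialOrder P]

/-- The order of the cylinder. -/
protected def le : Cyl P → Cyl P → Prop
  | lo x, lo y => x ≤ y
  | lo x, hi y => x ≤ y
  | hi _, lo _ => False
  | hi x, hi y => x ≤ y

instance : PartialOrder (Cyl P) where
  le := Cyl.le
  le_refl := by rintro (x | x) <;> exact le_refl x
  le_trans := by
    rintro (x | x) (y | y) (z | z) h h'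
    all_goals first | exact h.elim | exact h'.elim | exact le_trans (α := P) h h'
  le_antisymm := by
    rintro (x | x) (y | y) h h'
    all_goals first | exact h.elim | exact h'.elim | exact congrArg _ (le_antisymm (α := P) h h')

@[simp] theorem lo_le_lo {x y : P} : lo x ≤ lo y ↔ x ≤ y := Iff.rfl
@[simp] theorem lo_le_hi {x y : P} : lo x ≤ hi y ↔ x ≤ y := Iff.rfl
@[simp] theorem hi_le_hi {x y : P} : hi x ≤ hi y ↔ x ≤ y := Iff.rfl
@[simp] theorem hi_le_lo {x y : P} : ¬ hi x ≤ lo y := fun h => h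
@[simp] theorem hi_lt_hi {x y : P} : hi x < hi y ↔ x < y := by simp [lt_iff_le_not_ge]
@[simp] theorem lo_lt_hi {x y : P} : lo x < hi y ↔ x ≤ y := by simp [lt_iff_le_not_ge]

instance [Finite P] : Finite (Cyl P) :=
  Finite.of_surjective (fun s : P ⊕ P => Sum.elim lo hi s) (by
    rintro (x | x)
    · exact ⟨Sum.inl x, rfl⟩
    · exact ⟨Sum.inr x, rfl⟩)

/-- The projection of the cylinder. -/
def proj : Cyl P → P
  | lo x => x
  | hi x => x

theorem le_hi_proj (q : Cyl P) : q ≤ hi (proj q) := by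
  rcases q with x | x <;> exact le_refl x

theorem proj_mono {q q' : Cyl P} (h : q ≤ q') : proj q ≤ proj q' := by
  rcases q with x | x <;> rcases q' with y | y
  all_goals first | exact h.elim | exact h

end Cyl

open Cyl

/-! ### Cofibrations of diagrams -/

section cyl

variable {P : Type*} [PartialOrder P] {D : Type u} [Category.{v} D] {X Y Z : P ⥤ D}

/-- The objects of the diagram on the cylinder given by `X` and `Y`. -/
def cylObj (X Y : P ⥤ D) : Cyl P → D
  | lo x => X.obj x
  | hi x => Y.obj x

/-- The morphisms of the diagram on the cylinder given by `α : X ⟶ Y`. -/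
def cylMap (α : X ⟶ Y) : ∀ q q' : Cyl P, q ≤ q' → (cylObj X Y q ⟶ cylObj X Y q')
  | lo _, lo _, h => X.map (homOfLE (lo_le_lo.1 h))
  | lo x, hi _, h => α.app x ≫ Y.map (homOfLE (lo_le_hi.1 h))
  | hi _, hi _, h => Y.map (homOfLE (hi_le_hi.1 h))
  | hi _, lo _, h => (hi_le_lo h).elim

/-- The diagram on the cylinder given by `α : X ⟶ Y`. -/
def cyl (α : X ⟶ Y) : Cyl P ⥤ D where
  obj := cylObj X Y
  map {q q'} f := cylMap α q q' (leOfHom f)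
  map_id q := by
    rcases q with x | x
    · exact X.map_id x
    · exact Y.map_id x
  map_comp {q q' q''} f g := by
    have hf := leOfHom f
    have hg := leOfHom g
    rcases q with x | x <;> rcases q' with y | y <;> rcases q'' with z | z
    all_goals first
      | exact hf.elim
      | exact hg.elim
      | skip
    · exact (map_homOfLE_comp X _ _).symm
    · change _ = X.map _ ≫ α.app y ≫ Y.map _
      rw [← Category.assoc, α.naturality, Category.assoc, map_homOfLE_comp]; rfl
    · change _ = (α.app x ≫ Y.map _) ≫ Y.map _
      rw [Category.assoc, map_homOfLE_comp]; rfl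
    · exact (map_homOfLE_comp Y _ _).symm

/-- Cofibrations of diagrams. -/
def CofTrans (cof : MorphismProperty D) (α : X ⟶ Y) : Prop := Good cof (cyl α)

variable {cof weq : MorphismProperty D} {α : X ⟶ Y}

/-- The part above `hi a` is the Kan extension of the part above `lo a` along the retraction `q ↦ hi
(proj q)`: the elements sent below `hi x` have the greatest element `hi x`. So goodness of a
cylinder need only be checked on up-sets starting in the bottom copy. -/
theorem reedy_hi [Finite P] (hD : IsWaldhausen D cof weq) {a : P}
    (h : Reedy cof (cyl α) (lo a ≤ ·)) : Reedy cof (cyl α) (hi a ≤ ·) := by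
  refine IsKan.reedy (Y := cyl α) (m := fun q => hi (proj q)) (T := (lo a ≤ ·))
    (η := fun q _ => (cyl α).map (homOfLE (le_hi_proj q))) hD
    (IsKan.of_top (fun x y _ _ hxy => hi_le_hi.2 (proj_mono hxy)) ?_ ?_ ?_) h
  · rintro (x | x) hx <;> exact hx
  · intro p q hp hq hpq
    rw [map_homOfLE_comp, map_homOfLE_comp]
  · rintro (x | x) hx
    · exact hx.elim
    · refine ⟨hi x, hx, le_rfl, ?_, ?_⟩
      · rintro (y | y) _ hy <;> exact hy
      · change IsIso ((cyl α).map (homOfLE (le_refl (hi x))) ≫ (cyl α).map (homOfLE (le_refl (hi x))))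
        rw [map_homOfLE_self]
        infer_instance

theorem CofTrans.of_reedy [Finite P] (hD : IsWaldhausen D cof weq)
    (h : ∀ a, Reedy cof (cyl α) (lo a ≤ ·)) : CofTrans cof α := by
  rintro (a | a)
  · exact h a
  · exact reedy_hi hD (h a)

/-- The part of the cylinder above `hi a` is a copy of the part of `Y` above `a`. -/
theorem CofTrans.target [Finite P] (hD : IsWaldhausen D cof weq) (h : CofTrans cof α) :
    Good cof Y := by
  intro a
  refine IsKan.reedy (Y := cyl α) (m := proj) (T := (hi a ≤ ·))
    (η := fun q hq => match q, hq with
      | lo x, hx => (hi_le_lo hx).elim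
      | hi x, hx => 𝟙 (Y.obj x)) hD (IsKan.of_top ?_ ?_ ?_ ?_) (h (hi a))
  · exact fun x y _ _ hxy => proj_mono hxy
  · rintro (x | x) hx
    · exact hx.elim
    · exact hx
  · rintro (p | p) (q | q) hp hq hpq
    · exact hp.elim
    · exact hp.elim
    · exact hq.elim
    · exact (Category.comp_id _).trans (Category.id_comp _).symm
  · intro x hx
    refine ⟨hi x, hx, le_rfl, ?_, ?_⟩
    · rintro (y | y) h1 hy
      · exact hy
      · exact hy
    · change IsIso (𝟙 _ ≫ Y.map (homOfLE (le_refl x)))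
      rw [map_homOfLE_self]; infer_instance

/-- The bottom copy is a lower set of the cylinder, so the latching maps of `X` are among those of
the cylinder. -/
theorem CofTrans.source [Finite P] (hD : IsWaldhausen D cof weq) (h : CofTrans cof α) :
    Good cof X := by
  intro a
  have h' : Reedy cof (cyl α) (fun q => ∃ x, a ≤ x ∧ q = lo x) :=
    (h (lo a)).subset (by rintro _ ⟨x, hx, rfl⟩; exact hx) (by
      rintro (y | y) hy _ ⟨x, hx, rfl⟩ hyx
      · exact ⟨y, hy, rfl⟩
      · exact hyx.elim)
  refine IsKan.reedy (Y := cyl α) (m := proj) (T := fun q => ∃ x, a ≤ x ∧ q = lo x)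
    (η := fun q hq => match q, hq with
      | lo x, hx => 𝟙 (X.obj x)
      | hi x, hx => False.elim (by obtain ⟨y, -, hy⟩ := hx; cases hy))
      hD (IsKan.of_top ?_ ?_ ?_ ?_) h'
  · exact fun x y _ _ hxy => proj_mono hxy
  · rintro _ ⟨x, hx, rfl⟩; exact hx
  · rintro _ _ ⟨x, hx, rfl⟩ ⟨y, hy, rfl⟩ hpq
    exact (Category.comp_id _).trans (Category.id_comp _).symm
  · intro x hx
    refine ⟨lo x, ⟨x, hx, rfl⟩, le_rfl, ?_, ?_⟩
    · rintro _ ⟨y, hy, rfl⟩ hyx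
      exact hyx
    · change IsIso (𝟙 _ ≫ X.map (homOfLE (le_refl x)))
      rw [map_homOfLE_self]; infer_instance

/-- The faces of `cyl α` contained in `X`. -/
theorem reedy_lo [Finite P] (hD : IsWaldhausen D cof weq) (α : X ⟶ Y) {a : P}
    (h : Reedy cof X (a ≤ ·)) : Reedy cof (cyl α) (fun q => ∃ x, a ≤ x ∧ q = lo x) := by
  refine IsKan.reedy (Y := X) (m := lo) (T := (a ≤ ·)) (η := fun p _ => 𝟙 (X.obj p))
    hD (IsKan.of_top ?_ ?_ ?_ ?_) h
  · exact fun x y _ _ hxy => hxy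
  · exact fun x hx => ⟨x, hx, rfl⟩
  · exact fun p q hp hq hpq => (Category.comp_id _).trans (Category.id_comp _).symm
  · rintro _ ⟨x, hx, rfl⟩
    refine ⟨x, hx, le_rfl, fun _ _ h => h, ?_⟩
    rw [map_homOfLE_self]
    change IsIso (𝟙 _ ≫ 𝟙 (X.obj x))
    infer_instance

/-- A colimit of the face of `cyl α` between `lo a` and `hi b`, with its last vertex removed, in
terms of the value of `X` at `b` and the values of `Y` below `b`. -/
structure IsMixedColim (α : X ⟶ Y) (a b : P) {E : D} (u : X.obj b ⟶ E)
    (v : ∀ x, a ≤ x → x < b → (Y.obj x ⟶ E)) : Prop where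
  w_hi : ∀ x x' (hx : a ≤ x) (hx' : x' < b) (h : x ≤ x'),
    Y.map (homOfLE h) ≫ v x' (hx.trans h) hx' = v x hx (h.trans_lt hx')
  w_lo : ∀ x hx (hxb : x < b), X.map (homOfLE hxb.le) ≫ u = α.app x ≫ v x hx hxb
  exists_desc : ∀ {T : D} (y : X.obj b ⟶ T) (z : ∀ x, a ≤ x → x < b → (Y.obj x ⟶ T)),
    (∀ x x' (hx : a ≤ x) (hx' : x' < b) (h : x ≤ x'),
      Y.map (homOfLE h) ≫ z x' (hx.trans h) hx' = z x hx (h.trans_lt hx')) →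
    (∀ x hx (hxb : x < b), X.map (homOfLE hxb.le) ≫ y = α.app x ≫ z x hx hxb) →
    ∃ t : E ⟶ T, u ≫ t = y ∧ ∀ x hx hxb, v x hx hxb ≫ t = z x hx hxb
  hom_ext : ∀ {T : D} {t t' : E ⟶ T}, u ≫ t = u ≫ t' →
    (∀ x hx hxb, v x hx hxb ≫ t = v x hx hxb ≫ t') → t = t'

/-- The southern arrow of the face of `cyl α` between `lo a` and `hi b`. -/
def MixedCofAt (cof : MorphismProperty D) (α : X ⟶ Y) (a b : P) : Prop :=
  ∃ (E : D) (u : X.obj b ⟶ E) (v : ∀ x, a ≤ x → x < b → (Y.obj x ⟶ E)),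
    IsMixedColim α a b u v ∧ ∃ s : E ⟶ Y.obj b, cof s ∧ u ≫ s = α.app b ∧
      ∀ x hx hxb, v x hx hxb ≫ s = Y.map (homOfLE hxb.le)

/-- The families of morphisms out of the face between `lo a` and `hi b`. -/
def mixedCocone (α : X ⟶ Y) (a b : P) {E : D} (u : X.obj b ⟶ E)
    (v : ∀ x, a ≤ x → x < b → (Y.obj x ⟶ E)) :
    ∀ q, lo a ≤ q ∧ q < hi b → ((cyl α).obj q ⟶ E)
  | lo _, h => X.map (homOfLE (lo_lt_hi.1 h.2)) ≫ u
  | hi x, h => v x (lo_le_hi.1 h.1) (hi_lt_hi.1 h.2)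

theorem mixedCocone_w {a b : P} {T : D} {y : X.obj b ⟶ T}
    {z : ∀ x, a ≤ x → x < b → (Y.obj x ⟶ T)}
    (hz : ∀ x x' (hx : a ≤ x) (hx' : x' < b) (h : x ≤ x'),
      Y.map (homOfLE h) ≫ z x' (hx.trans h) hx' = z x hx (h.trans_lt hx'))
    (hyz : ∀ x hx (hxb : x < b), X.map (homOfLE hxb.le) ≫ y = α.app x ≫ z x hx hxb) :
    ∀ p q hp hq (h : p ≤ q),
      (cyl α).map (homOfLE h) ≫ mixedCocone α a b y z q hq = mixedCocone α a b y z p hp := by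
  rintro (p | p) (q | q) hp hq hpq
  · exact map_homOfLE_comp_assoc X _ _ _
  · have hap : a ≤ p := lo_le_lo.1 hp.1
    have hpq' : p ≤ q := lo_le_hi.1 hpq
    have hqb : q < b := hi_lt_hi.1 hq.2
    change (α.app p ≫ Y.map (homOfLE hpq')) ≫ z q (hap.trans hpq') hqb =
      X.map (homOfLE (hpq'.trans hqb.le)) ≫ y
    rw [Category.assoc, hz p q hap hqb hpq', ← hyz]
  · exact hpq.elim
  · exact hz p q hp.1 _ hpq

/-- Among the bottom vertices of this face `lo b` is the greatest, so the single morphism `u` out of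
`X.obj b` determines all bottom components of a cocone. -/
theorem IsMixedColim.isColim {a b : P} (hab : a ≤ b) {E : D} {u : X.obj b ⟶ E}
    {v : ∀ x, a ≤ x → x < b → (Y.obj x ⟶ E)} (h : IsMixedColim α a b u v) :
    IsColim (cyl α) (fun q => lo a ≤ q ∧ q < hi b) E (mixedCocone α a b u v) where
  w := mixedCocone_w h.w_hi h.w_lo
  exists_desc T d hd := by
    obtain ⟨t, ht, ht'⟩ := h.exists_desc (d (lo b) ⟨hab, lo_lt_hi.2 le_rfl⟩)
      (fun x hx hxb => d (hi x) ⟨hx, hi_lt_hi.2 hxb⟩)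
      (fun x x' hx hx' hxx => hd (hi x) (hi x') _ _ hxx)
      (fun x hx hxb => by
        have h1 := hd (lo x) (lo b) ⟨hx, lo_lt_hi.2 hxb.le⟩ ⟨hab, lo_lt_hi.2 le_rfl⟩ hxb.le
        have h2 := hd (lo x) (hi x) ⟨hx, lo_lt_hi.2 hxb.le⟩ ⟨hx, hi_lt_hi.2 hxb⟩ (le_refl x)
        refine h1.trans (h2.symm.trans ?_)
        refine congrArg (· ≫ d (hi x) ⟨hx, hi_lt_hi.2 hxb⟩) ?_
        change α.app x ≫ Y.map (homOfLE (le_refl x)) = α.app x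
        rw [map_homOfLE_self, Category.comp_id])
    refine ⟨t, ?_⟩
    rintro (x | x) hx
    · refine Eq.trans ?_ (hd (lo x) (lo b) hx ⟨hab, lo_lt_hi.2 le_rfl⟩ (lo_lt_hi.1 hx.2))
      rw [← ht]
      exact Category.assoc _ _ _
    · exact ht' x _ _
  hom_ext T t t' htt := by
    refine h.hom_ext ?_ fun x hx hxb => htt (hi x) ⟨hx, hi_lt_hi.2 hxb⟩
    have := htt (lo b) ⟨hab, lo_lt_hi.2 le_rfl⟩
    change (X.map (homOfLE (le_refl b)) ≫ u) ≫ t = (X.map (homOfLE (le_refl b)) ≫ u) ≫ t' at this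
    rwa [map_homOfLE_self, Category.id_comp] at this

theorem IsColim.exists_isMixedColim {a b : P} (hab : a ≤ b) {E : D}
    {c : ∀ q, lo a ≤ q ∧ q < hi b → ((cyl α).obj q ⟶ E)}
    (h : IsColim (cyl α) (fun q => lo a ≤ q ∧ q < hi b) E c) :
    ∃ (u : X.obj b ⟶ E) (v : ∀ x, a ≤ x → x < b → (Y.obj x ⟶ E)),
      IsMixedColim α a b u v ∧ c = mixedCocone α a b u v := by
  have hbm : lo a ≤ lo b ∧ lo b < hi b := ⟨hab, lo_lt_hi.2 le_rfl⟩
  have key : ∃ (u : X.obj b ⟶ E) (v : ∀ x, a ≤ x → x < b → (Y.obj x ⟶ E)),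
      c = mixedCocone α a b u v := by
    refine ⟨c (lo b) hbm, fun x hx hxb => c (hi x) ⟨hx, hi_lt_hi.2 hxb⟩, ?_⟩
    funext q hq
    rcases q with x | x
    · exact (h.w (lo x) (lo b) hq hbm (lo_lt_hi.1 hq.2)).symm
    · rfl
  obtain ⟨u, v, rfl⟩ := key
  refine ⟨u, v, ⟨?_, ?_, ?_, ?_⟩, rfl⟩
  · intro x x' hx hx' hxx
    exact h.w (hi x) (hi x') ⟨hx, hi_lt_hi.2 (hxx.trans_lt hx')⟩
      ⟨hx.trans hxx, hi_lt_hi.2 hx'⟩ hxx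
  · intro x hx hxb
    have h2 := h.w (lo x) (hi x) ⟨hx, lo_lt_hi.2 hxb.le⟩ ⟨hx, hi_lt_hi.2 hxb⟩ (le_refl x)
    refine h2.symm.trans (congrArg (· ≫ v x hx hxb) ?_)
    change α.app x ≫ Y.map (homOfLE (le_refl x)) = α.app x
    rw [map_homOfLE_self, Category.comp_id]
  · intro T y z hz hyz
    obtain ⟨t, ht⟩ := h.exists_desc T (mixedCocone α a b y z) (mixedCocone_w hz hyz)
    refine ⟨t, ?_, fun x hx hxb => ht (hi x) ⟨hx, hi_lt_hi.2 hxb⟩⟩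
    have := ht (lo b) hbm
    change (X.map (homOfLE (le_refl b)) ≫ u) ≫ t = X.map (homOfLE (le_refl b)) ≫ y at this
    rwa [map_homOfLE_self, Category.id_comp, Category.id_comp] at this
  · intro T t t' h1 h2
    refine h.hom_ext _ _ _ ?_
    rintro (x | x) hx
    · change (X.map (homOfLE (lo_lt_hi.1 hx.2)) ≫ u) ≫ t = (X.map (homOfLE _) ≫ u) ≫ t'
      rw [Category.assoc, Category.assoc, h1]
    · exact h2 x hx.1 (hi_lt_hi.1 hx.2)

theorem mixedCofAt_iff {a b : P} (hab : a ≤ b) :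
    MixedCofAt cof α a b ↔ CofAt cof (cyl α) (lo a ≤ ·) (hi b) := by
  have hbm : lo a ≤ lo b ∧ lo b < hi b := ⟨hab, lo_lt_hi.2 le_rfl⟩
  constructor
  · rintro ⟨E, u, v, h, s, hs, h1, h2⟩
    refine ⟨E, _, h.isColim hab, s, ?_, hs⟩
    rintro (x | x) hx
    · change (X.map (homOfLE (lo_lt_hi.1 hx.2)) ≫ u) ≫ s = α.app x ≫ Y.map (homOfLE _)
      rw [Category.assoc, h1, α.naturality]
    · exact h2 x hx.1 _
  · rintro ⟨E, c, hc, s, hs, hcof⟩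
    obtain ⟨u, v, h, rfl⟩ := hc.exists_isMixedColim hab
    refine ⟨E, u, v, h, s, hcof, ?_, fun x hx hxb => hs (hi x) ⟨hx, hi_lt_hi.2 hxb⟩⟩
    have := hs (lo b) hbm
    change (X.map (homOfLE (le_refl b)) ≫ u) ≫ s = α.app b ≫ Y.map (homOfLE (le_refl b)) at this
    rwa [map_homOfLE_self, map_homOfLE_self, Category.id_comp, Category.comp_id] at this

/-- The southern arrows of the faces of `cyl α` that lie neither in `X` nor in `Y` may be treated
by induction. -/
theorem CofTrans.of_mixed [Finite P] (hD : IsWaldhausen D cof weq) (hX : Good cof X)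
    (h : ∀ a b, a ≤ b → ∀ (E : D) (u : X.obj b ⟶ E) (v : ∀ x, a ≤ x → x < b → (Y.obj x ⟶ E)),
      IsMixedColim α a b u v → MixedCofAt cof α a b) :
    CofTrans cof α := by
  refine CofTrans.of_reedy hD fun a => ?_
  have hlo : ∀ b, a ≤ b → CofAt cof (cyl α) (lo a ≤ ·) (lo b) := fun b hb =>
    (reedy_lo hD α (hX a) (lo b) ⟨b, hb, rfl⟩).congr (by
      rintro (x | x) hx
      · exact ⟨by rintro ⟨y, hy, h⟩; cases h; exact hy, fun h => ⟨x, h, rfl⟩⟩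
      · exact (hi_le_lo hx.le).elim)
  have hhi : ∀ b, a ≤ b → CofAt cof (cyl α) (lo a ≤ ·) (hi b) := by
    intro b
    induction b using WellFoundedLT.induction with
    | ind b ih =>
    intro hb
    -- The latching object exists because its vertices are bottom vertices, handled by goodness of
    -- `X`, or vertices `hi x` with `x < b`, handled by induction.
    obtain ⟨E, c, hc⟩ := Reedy.exists_isColim (X := cyl α)
      (T := fun q => lo a ≤ q ∧ q < hi b) hD (by
        rintro (x | x) hx
        · exact (hlo x hx.1).congr fun y hy =>
            ⟨fun h => ⟨h, hy.trans hx.2⟩, fun h => h.1⟩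
        · exact (ih x (hi_lt_hi.1 hx.2) hx.1).congr fun y hy =>
            ⟨fun h => ⟨h, hy.trans hx.2⟩, fun h => h.1⟩)
    obtain ⟨u, v, huv, -⟩ := hc.exists_isMixedColim hb
    exact (mixedCofAt_iff hb).1 (h a b hb E u v huv)
  rintro (x | x) hx
  · exact hlo x hx
  · exact hhi x hx

theorem CofTrans.mixedCofAt (h : CofTrans cof α) {a b : P} (hab : a ≤ b) : MixedCofAt cof α a b :=
  (mixedCofAt_iff hab).2 (h (lo a) (hi b) hab)

/-- Squares with the universal property of a pushout. -/
theorem isPushout_of_exists {A B C E : D} {f : A ⟶ B} {g : A ⟶ C} {h : B ⟶ E} {k : C ⟶ E}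
    (w : f ≫ h = g ≫ k)
    (hex : ∀ {T : D} (y : B ⟶ T) (z : C ⟶ T), f ≫ y = g ≫ z → ∃ t, h ≫ t = y ∧ k ≫ t = z)
    (hext : ∀ {T : D} (t t' : E ⟶ T), h ≫ t = h ≫ t' → k ≫ t = k ≫ t' → t = t') :
    IsPushout f g h k := by
  refine ⟨⟨w⟩, ⟨PushoutCocone.IsColimit.mk _ (fun r => (hex r.inl r.inr r.condition).choose)
    (fun r => (hex r.inl r.inr r.condition).choose_spec.1)
    (fun r => (hex r.inl r.inr r.condition).choose_spec.2) fun r m h1 h2 => ?_⟩⟩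
  obtain ⟨e1, e2⟩ := (hex r.inl r.inr r.condition).choose_spec
  exact hext _ _ (h1.trans e1.symm) (h2.trans e2.symm)

/-- Let `E`, `F` and `S` be the latching objects of `α`, `β` and `α ≫ β` at `b`. Then `F` is the
pushout of the latching map `E ⟶ Y.obj b` along `E ⟶ S`, so the latching map of the composite is a
cofibration `S ⟶ F` followed by the latching map of `β`. -/
theorem CofTrans.comp [Finite P] (hD : IsWaldhausen D cof weq) {β : Y ⟶ Z} (hα : CofTrans cof α)
    (hβ : CofTrans cof β) : CofTrans cof (α ≫ β) := by
  refine CofTrans.of_mixed hD (hα.source hD) fun a b hab S uS vS hS => ?_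
  obtain ⟨E, uE, vE, hE, s, hs, hs1, hs2⟩ := hα.mixedCofAt hab
  obtain ⟨F, uF, vF, hF, s', hs', hs1', hs2'⟩ := hβ.mixedCofAt hab
  have wS := hS.w_lo
  simp only [NatTrans.comp_app, Category.assoc] at wS
  obtain ⟨g, hg1, hg2⟩ := hE.exists_desc uS (fun x hx hxb => β.app x ≫ vS x hx hxb)
    (fun x x' hx hx' h => by
      rw [← hS.w_hi x x' hx hx' h, ← Category.assoc, β.naturality, Category.assoc])
    wS
  obtain ⟨k, hk1, hk2⟩ := hS.exists_desc (α.app b ≫ uF) vF hF.w_hi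
    (fun x hx hxb => by
      rw [← Category.assoc, α.naturality, Category.assoc, hF.w_lo x hx hxb,
        NatTrans.comp_app, Category.assoc])
  have sq : IsPushout s g uF k := by
    refine isPushout_of_exists (hE.hom_ext ?_ fun x hx hxb => ?_) (fun y z hyz => ?_)
      fun t t' h1 h2 => hF.hom_ext h1 fun x hx hxb => ?_
    · rw [← Category.assoc, hs1, ← Category.assoc, hg1, hk1]
    · rw [← Category.assoc, hs2, ← Category.assoc, hg2, Category.assoc, hk2,
        hF.w_lo x hx hxb]
    · obtain ⟨t, ht1, ht2⟩ := hF.exists_desc y (fun x hx hxb => vS x hx hxb ≫ z)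
        (fun x x' hx hx' h => by rw [← hS.w_hi x x' hx hx' h, Category.assoc])
        (fun x hx hxb => by
          rw [← hs2 x hx hxb, Category.assoc, hyz, ← Category.assoc, hg2, Category.assoc])
      refine ⟨t, ht1, hS.hom_ext ?_ fun x hx hxb => ?_⟩
      · rw [← Category.assoc, hk1, Category.assoc, ht1, ← hs1, Category.assoc, hyz,
          ← Category.assoc, hg1]
      · rw [← Category.assoc, hk2, ht2]
    · rw [← hk2 x hx hxb, Category.assoc, Category.assoc, h2]
  refine ⟨S, uS, vS, hS, k ≫ s', hD.cof_comp (hD.cof_inr sq hs) hs', ?_, fun x hx hxb => ?_⟩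
  · rw [← Category.assoc, hk1, Category.assoc, hs1', NatTrans.comp_app]
  · rw [← Category.assoc, hk2, hs2']

/-- The latching map of `k` is a pushout of the latching map of `α`: gluing `Y.obj b` to the
latching object of `k` along that of `α` gives the value of `Q` at `b`. -/
theorem CofTrans.of_isPushout [Finite P] (hD : IsWaldhausen D cof weq) {Q : P ⥤ D} {γ : X ⟶ Z}
    {h : Y ⟶ Q} {k : Z ⟶ Q} (sq : ∀ p, IsPushout (α.app p) (γ.app p) (h.app p) (k.app p))
    (hα : CofTrans cof α) (hZ : Good cof Z) : CofTrans cof k := by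
  refine CofTrans.of_mixed hD hZ fun a b hab S uS vS hS => ?_
  obtain ⟨E, uE, vE, hE, s, hs, hs1, hs2⟩ := hα.mixedCofAt hab
  obtain ⟨g, hg1, hg2⟩ := hE.exists_desc (γ.app b ≫ uS) (fun x hx hxb => h.app x ≫ vS x hx hxb)
    (fun x x' hx hx' hxx => by
      rw [← hS.w_hi x x' hx hx' hxx, ← Category.assoc, h.naturality, Category.assoc])
    (fun x hx hxb => by
      rw [← Category.assoc, γ.naturality, Category.assoc, hS.w_lo x hx hxb,
        ← Category.assoc, ← Category.assoc, (sq x).w])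
  obtain ⟨s', hs1', hs2'⟩ := hS.exists_desc (k.app b) (fun x hx hxb => Q.map (homOfLE hxb.le))
    (fun x x' hx hx' h => map_homOfLE_comp _ _ _)
    (fun x hx hxb => k.naturality _)
  have sq' : IsPushout s g (h.app b) s' := by
    refine isPushout_of_exists (hE.hom_ext ?_ fun x hx hxb => ?_) (fun y z hyz => ?_)
      fun t t' h1 h2 => (sq b).hom_ext h1 ?_
    · rw [← Category.assoc, hs1, ← Category.assoc, hg1, Category.assoc, hs1', (sq b).w]
    · rw [← Category.assoc, hs2, ← Category.assoc, hg2, Category.assoc, hs2', h.naturality]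
    · have e : α.app b ≫ y = γ.app b ≫ uS ≫ z := by
        rw [← hs1, Category.assoc, hyz, ← Category.assoc, hg1, Category.assoc]
      refine ⟨(sq b).desc y _ e, (sq b).inl_desc _ _ _, hS.hom_ext ?_ fun x hx hxb => ?_⟩
      · rw [← Category.assoc, hs1', (sq b).inr_desc]
      · rw [← Category.assoc, hs2']
        refine (sq x).hom_ext ?_ ?_
        · rw [← Category.assoc, ← h.naturality, Category.assoc, (sq b).inl_desc, ← hs2 x hx hxb,
            Category.assoc, hyz, ← Category.assoc, hg2, Category.assoc]
        · rw [← Category.assoc, ← k.naturality, Category.assoc, (sq b).inr_desc,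
            ← Category.assoc, hS.w_lo x hx hxb, Category.assoc]
    · rw [← hs1', Category.assoc, Category.assoc, h2]
  exact ⟨S, uS, vS, hS, s', hD.cof_inr sq' hs, hs1', hs2'⟩

/-- The cylinder is the Kan extension of `X` along the inclusion `lo`; at `hi x` the greatest
element of the index set is `x`. -/
theorem CofTrans.of_isIso [Finite P] (hD : IsWaldhausen D cof weq) (hα : ∀ p, IsIso (α.app p))
    (hX : Good cof X) : CofTrans cof α := by
  refine CofTrans.of_reedy hD fun a => ?_
  refine IsKan.reedy (Y := X) (m := lo) (T := (a ≤ ·)) (η := fun p _ => 𝟙 (X.obj p))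
    hD (IsKan.of_top ?_ ?_ ?_ ?_) (hX a)
  · exact fun x y _ _ hxy => hxy
  · exact fun x hx => hx
  · exact fun p q hp hq hpq => (Category.comp_id _).trans (Category.id_comp _).symm
  · rintro (x | x) hx
    · refine ⟨x, hx, le_rfl, fun _ _ h => h, ?_⟩
      rw [map_homOfLE_self]
      change IsIso (𝟙 _ ≫ 𝟙 (X.obj x))
      infer_instance
    · refine ⟨x, hx, lo_le_hi.2 le_rfl, fun _ _ h => h, ?_⟩
      change IsIso (𝟙 _ ≫ α.app x ≫ Y.map (homOfLE (le_refl x)))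
      rw [map_homOfLE_self]
      infer_instance

/-- The cylinder is the Kan extension of `Y` along the inclusion `hi`: over `lo x` the index set is
empty, and its colimit is the zero object `X.obj x`. -/
theorem CofTrans.of_isZero [Finite P] (hD : IsWaldhausen D cof weq) (hX : ∀ p, IsZero (X.obj p))
    (hY : Good cof Y) : CofTrans cof α := by
  refine CofTrans.of_reedy hD fun a => ?_
  refine IsKan.reedy (Y := Y) (m := hi) (T := (a ≤ ·)) (η := fun p _ => 𝟙 (Y.obj p))
    hD ⟨?_, ?_, ?_, ?_⟩ (hY a)
  · exact fun x y _ _ hxy => hxy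
  · exact fun x hx => hx
  · exact fun p q hp hq hpq => (Category.comp_id _).trans (Category.id_comp _).symm
  · rintro (x | x) hx
    · exact isColim_empty (hX x) (fun p hp => hi_le_lo hp.2) _
    · refine isColim_of_top_iso (b := x) ⟨hx, le_rfl⟩ (fun p hp => hp.2) ?_ ?_
      · intro p q hp hq hpq
        change Y.map _ ≫ 𝟙 (Y.obj q) ≫ Y.map _ = 𝟙 (Y.obj p) ≫ Y.map _
        rw [Category.id_comp, Category.id_comp, map_homOfLE_comp]
      · rw [map_homOfLE_self]
        change IsIso (𝟙 _ ≫ 𝟙 (Y.obj x))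
        infer_instance

end cyl

/-! ### Cylinders on cubes -/

section arrowCube

variable {ι : Type} {D : Type u} [Category.{v} D]

instance [Finite ι] : Finite (Vertex ι) := inferInstanceAs (Finite (ι → Fin 2))

/-- The cylinder on `I^ι` is `I^(ι ⊕ Unit)`. -/
def cylVertex (ι : Type) : Cyl (Vertex ι) ≃o Vertex (ι ⊕ Unit) where
  toFun
    | lo x => Sum.elim x fun _ => 0
    | hi x => Sum.elim x fun _ => 1
  invFun q := if q (Sum.inr ()) = 0 then lo fun i => q (Sum.inl i) else hi fun i => q (Sum.inl i)
  left_inv := by rintro (x | x) <;> rfl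
  right_inv q := by
    by_cases h : q (Sum.inr ()) = 0
    · simp only [h, if_true]
      funext s
      rcases s with i | ⟨⟩
      · rfl
      · exact h.symm
    · simp only [h, if_false]
      funext s
      rcases s with i | ⟨⟩
      · rfl
      · exact (show ∀ z : Fin 2, z ≠ 0 → 1 = z by decide) _ h
  map_rel_iff' := by
    rintro (x | x) (y | y)
    · exact ⟨fun h i => h (Sum.inl i), fun h => Sum.rec h fun _ => le_rfl⟩
    · exact ⟨fun h i => h (Sum.inl i), fun h => Sum.rec h fun _ => zero_le_one (α := Fin 2)⟩
    · refine ⟨fun h => ?_, fun h => h.elim⟩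
      have := h (Sum.inr ())
      exact absurd this (show ¬ (1 : Fin 2) ≤ 0 by decide)
    · exact ⟨fun h i => h (Sum.inl i), fun h => Sum.rec h fun _ => le_rfl⟩

theorem good_arrowCube_iff [Finite ι] {cof weq : MorphismProperty D} (hD : IsWaldhausen D cof weq)
    {X Y : Cube ι D} (α : X ⟶ Y) : IsGood cof (arrowCube α) ↔ CofTrans cof α := by
  rw [isGood_iff]
  symm
  refine good_iff_of_orderIso hD (cylVertex ι) (fun q => match q with
    | lo x => Iso.refl (X.obj x)
    | hi x => Iso.refl (Y.obj x)) ?_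
  rintro (x | x) (y | y) h
  · change X.map _ ≫ 𝟙 _ = 𝟙 _ ≫ 𝟙 _ ≫ X.map _
    simp only [Category.id_comp, Category.comp_id]; rfl
  · change (α.app x ≫ Y.map _) ≫ 𝟙 _ = 𝟙 _ ≫ (α.app x ≫ Y.map _)
    simp only [Category.id_comp, Category.comp_id]; rfl
  · exact h.elim
  · change Y.map _ ≫ 𝟙 _ = 𝟙 _ ≫ 𝟙 _ ≫ Y.map _
    simp only [Category.id_comp, Category.comp_id]; rfl

end arrowCube

open Cyl

/-! ### The Waldhausen category of multiexact functors -/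

section homs

variable {ι : Type} {C : ι → WaldCat.{u}} {D : WaldCat.{u}}

theorem isIso_of_isZero {A : Type*} [Category* A] {X Y : A} (hX : IsZero X) (hY : IsZero Y)
    (f : X ⟶ Y) : IsIso f :=
  ⟨hY.to_ X, hX.eq_of_src _ _, hY.eq_of_src _ _⟩

theorem isZero_of_isPushout {A : Type*} [Category* A] {X Y Z W : A} {f : X ⟶ Y} {g : X ⟶ Z}
    {h : Y ⟶ W} {k : Z ⟶ W} (sq : IsPushout f g h k) (hX : IsZero X) (hY : IsZero Y)
    (hZ : IsZero Z) : IsZero W :=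
  haveI := isIso_of_isZero hX hY f
  haveI := sq.isIso_inr_of_isIso
  hZ.of_iso (asIso k).symm

theorem IsWaldhausen.cof_id {A : Type u} [Category.{v} A] {cof weq : MorphismProperty A}
    (h : IsWaldhausen A cof weq) (X : A) : cof (𝟙 X) :=
  h.cof_of_isIso _ inferInstance

theorem IsWaldhausen.weq_id {A : Type u} [Category.{v} A] {cof weq : MorphismProperty A}
    (h : IsWaldhausen A cof weq) (X : A) : weq (𝟙 X) :=
  h.weq_of_isIso _ inferInstance

theorem good_of_isZero {A : Type u} [Category.{v} A] {cof weq : MorphismProperty A}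
    (h : IsWaldhausen A cof weq) {P : Type*} [PartialOrder P] {X : P ⥤ A}
    (hX : ∀ p, IsZero (X.obj p)) : Good cof X := by
  intro a b _
  refine ⟨X.obj b, fun p hp => X.map (homOfLE hp.2.le), ⟨?_, ?_, ?_⟩, 𝟙 _,
    fun p hp => (hX p).eq_of_src _ _, h.cof_id _⟩
  · exact fun p q hp hq hpq => (hX p).eq_of_src _ _
  · exact fun T d hd => ⟨(hX b).to_ T, fun p hp => (hX p).eq_of_src _ _⟩
  · exact fun T t t' htt => (hX b).eq_of_src _ _

theorem homCof_iff [Finite ι] {F G : Multiexact C D} (α : F ⟶ G) :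
    homCof α ↔ ∀ {X Y : ∀ i, C i} (f : X ⟶ Y), (∀ i, (C i).cof (f i)) →
      CofTrans D.cof (Functor.whiskerLeft (boxCube f) α.hom) := by
  constructor
  · exact fun h X Y f hf => (good_arrowCube_iff D.isWaldhausen _).1 (h f hf)
  · exact fun h X Y f hf => (good_arrowCube_iff D.isWaldhausen _).2 (h f hf)

theorem IsMultiexact.good {F : (∀ i, C i) ⥤ D} (hF : IsMultiexact C D F) {X Y : ∀ i, C i}
    (f : X ⟶ Y) (hf : ∀ i, (C i).cof (f i)) : Good D.cof (boxCube f ⋙ F) :=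
  (isGood_iff _).1 (hF.cof f hf)

theorem IsMultiexact.map_cof [Finite ι] {F : (∀ i, C i) ⥤ D} (hF : IsMultiexact C D F) {X Y : ∀ i, C i}
    (f : X ⟶ Y) (hf : ∀ i, (C i).cof (f i)) : D.cof (F.map f) := by
  have h : (fun _ => 0 : Vertex ι) ≤ (fun _ => 1) := fun _ => zero_le_one (α := Fin 2)
  exact (hF.good f hf).cof_map D.isWaldhausen h

/-- Test `α` on the identities of `X`. The component at `X` is the structure map of the good
cylinder from its first vertex to the vertex above it. -/
theorem cof_app_of_homCof [Finite ι] {F G : Multiexact C D} {α : F ⟶ G} (h : homCof α) (X : ∀ i, C i) :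
    D.cof (α.hom.app X) := by
  have h1 := (homCof_iff α).1 h (𝟙 X) (fun i => (C i).isWaldhausen.cof_id _)
  have h2 := Good.cof_map D.isWaldhausen h1 (lo_le_hi.2 (le_refl (fun _ => 0 : Vertex ι)))
  have e : (cyl (Functor.whiskerLeft (boxCube (𝟙 X)) α.hom)).map
      (homOfLE (lo_le_hi.2 (le_refl (fun _ => 0 : Vertex ι)))) = α.hom.app X := by
    refine Eq.trans ?_ (Category.comp_id _)
    exact congrArg (α.hom.app X ≫ ·) (map_homOfLE_self (boxCube (𝟙 X) ⋙ G.obj) _)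
  rwa [e] at h2

theorem isMultiexact_const [Finite ι] {Z : D} (hZ : IsZero Z) :
    IsMultiexact C D ((Functor.const _).obj Z) where
  zero _ _ _ := hZ
  pushout _ _ _ _ _ _ _ _ _ _ _ _ := IsPushout.of_id_fst
  weq _ _ := D.isWaldhausen.weq_id _
  cof _ _ := (isGood_iff _).2 (good_of_isZero D.isWaldhausen fun _ => hZ)

/-- Evaluation of multiexact functors at an object. -/
def evalAt (X : ∀ i, C i) : Multiexact C D ⥤ D where
  obj F := F.obj.obj X
  map α := α.hom.app X

theorem isZero_of_app {F : Multiexact C D} (h : ∀ X, IsZero (F.obj.obj X)) : IsZero F where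
  unique_to _ := ⟨⟨⟨ObjectProperty.homMk
    { app := fun X => (h X).to_ _
      naturality := fun X _ _ => (h X).eq_of_src _ _ }⟩,
      fun _ => ObjectProperty.hom_ext _ (NatTrans.ext (funext fun X => (h X).eq_of_src _ _))⟩⟩
  unique_from _ := ⟨⟨⟨ObjectProperty.homMk
    { app := fun X => (h X).from_ _
      naturality := fun _ Y _ => (h Y).eq_of_tgt _ _ }⟩,
      fun _ => ObjectProperty.hom_ext _ (NatTrans.ext (funext fun X => (h X).eq_of_tgt _ _))⟩⟩

/-- A constant functor at a zero object of `D` is a multiexact zero object, and every other one is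
isomorphic to it. -/
theorem isZero_app [Finite ι] {F : Multiexact C D} (h : IsZero F) (X : ∀ i, C i) : IsZero (F.obj.obj X) := by
  obtain ⟨Z, hZ⟩ := D.isWaldhausen.hasZero.zero
  have h' : IsZero (⟨_, isMultiexact_const hZ⟩ : Multiexact C D) :=
    isZero_of_app fun _ => hZ
  exact hZ.of_iso ((evalAt X).mapIso (h.iso h'))

theorem isPushout_of_app {F G H K : Multiexact C D} {f : F ⟶ G} {g : F ⟶ H} {h : G ⟶ K}
    {k : H ⟶ K} (sq : ∀ X, IsPushout (f.hom.app X) (g.hom.app X) (h.hom.app X) (k.hom.app X)) :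
    IsPushout f g h k := by
  refine isPushout_of_exists (ObjectProperty.hom_ext _ (NatTrans.ext (funext fun X => (sq X).w)))
    (fun {T} y z hyz => ?_) fun t t' h1 h2 => ObjectProperty.hom_ext _
      (NatTrans.ext (funext fun X => (sq X).hom_ext ?_ ?_))
  · have hX : ∀ X, f.hom.app X ≫ y.hom.app X = g.hom.app X ≫ z.hom.app X := fun X =>
      (evalAt X).congr_map hyz
    refine ⟨ObjectProperty.homMk
      { app := fun X => (sq X).desc (y.hom.app X) (z.hom.app X) (hX X)
        naturality := fun X Y m => (sq X).hom_ext ?_ ?_ }, ?_, ?_⟩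
    · rw [← Category.assoc, ← h.hom.naturality, Category.assoc, (sq Y).inl_desc,
        ← Category.assoc, (sq X).inl_desc, y.hom.naturality]
    · rw [← Category.assoc, ← k.hom.naturality, Category.assoc, (sq Y).inr_desc,
        ← Category.assoc, (sq X).inr_desc, z.hom.naturality]
    · exact ObjectProperty.hom_ext _ (NatTrans.ext (funext fun X => (sq X).inl_desc _ _ _))
    · exact ObjectProperty.hom_ext _ (NatTrans.ext (funext fun X => (sq X).inr_desc _ _ _))
  · exact (evalAt X).congr_map h1
  · exact (evalAt X).congr_map h2

/-- Levelwise pushouts of functors. -/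
theorem exists_pushout_functor {A B : Type*} [Category* A] [Category* B] {F G H : A ⥤ B}
    (f : F ⟶ G) (g : F ⟶ H) (hex : ∀ X, ∃ (Q : B) (h : G.obj X ⟶ Q) (k : H.obj X ⟶ Q),
      IsPushout (f.app X) (g.app X) h k) :
    ∃ (K : A ⥤ B) (h : G ⟶ K) (k : H ⟶ K),
      ∀ X, IsPushout (f.app X) (g.app X) (h.app X) (k.app X) := by
  choose Q h k sq using hex
  have w : ∀ {X Y : A} (m : X ⟶ Y),
      f.app X ≫ G.map m ≫ h Y = g.app X ≫ H.map m ≫ k Y := fun {X Y} m => by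
    rw [← Category.assoc, ← f.naturality, Category.assoc, (sq Y).w, ← Category.assoc,
      g.naturality, Category.assoc]
  refine ⟨{ obj := Q
            map := fun {X Y} m => (sq X).desc (G.map m ≫ h Y) (H.map m ≫ k Y) (w m)
            map_id := fun X => (sq X).hom_ext (by simp) (by simp)
            map_comp := fun {X Y Z} m n => (sq X).hom_ext (by simp) (by simp) },
    { app := h
      naturality := fun X Y m => ((sq X).inl_desc _ _ _).symm },
    { app := k
      naturality := fun X Y m => ((sq X).inr_desc _ _ _).symm }, sq⟩

/-- Pushouts of functors preserve the pushout squares that are preserved by the given functors. -/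
theorem isPushout_map_of_isPushout_app {A B : Type*} [Category* A] [Category* B] {F G H K : A ⥤ B}
    {f : F ⟶ G} {g : F ⟶ H} {h : G ⟶ K} {k : H ⟶ K}
    (sq : ∀ X, IsPushout (f.app X) (g.app X) (h.app X) (k.app X)) {X Y Z W : A}
    {a : X ⟶ Y} {b : X ⟶ Z} {c : Y ⟶ W} {d : Z ⟶ W} (w : a ≫ c = b ≫ d)
    (hF : IsPushout (F.map a) (F.map b) (F.map c) (F.map d))
    (hG : IsPushout (G.map a) (G.map b) (G.map c) (G.map d))
    (hH : IsPushout (H.map a) (H.map b) (H.map c) (H.map d)) :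
    IsPushout (K.map a) (K.map b) (K.map c) (K.map d) := by
  refine isPushout_of_exists (by rw [← K.map_comp, w, K.map_comp]) (fun {T} y z hyz => ?_)
    fun t t' h1 h2 => ?_
  · have e1 : G.map a ≫ h.app Y ≫ y = G.map b ≫ h.app Z ≫ z := by
      rw [← Category.assoc, ← Category.assoc, h.naturality, h.naturality, Category.assoc, hyz,
        Category.assoc]
    have e2 : H.map a ≫ k.app Y ≫ y = H.map b ≫ k.app Z ≫ z := by
      rw [← Category.assoc, ← Category.assoc, k.naturality, k.naturality, Category.assoc, hyz,
        Category.assoc]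
    have e3 : f.app W ≫ hG.desc _ _ e1 = g.app W ≫ hH.desc _ _ e2 := by
      refine hF.hom_ext ?_ ?_
      · rw [← Category.assoc, f.naturality, Category.assoc, hG.inl_desc, ← Category.assoc,
          (sq Y).w, ← Category.assoc, g.naturality, Category.assoc, Category.assoc, hH.inl_desc]
      · rw [← Category.assoc, f.naturality, Category.assoc, hG.inr_desc, ← Category.assoc,
          (sq Z).w, ← Category.assoc, g.naturality, Category.assoc, Category.assoc, hH.inr_desc]
    refine ⟨(sq W).desc _ _ e3, (sq Y).hom_ext ?_ ?_, (sq Z).hom_ext ?_ ?_⟩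
    · rw [← Category.assoc, ← h.naturality, Category.assoc, (sq W).inl_desc, hG.inl_desc]
    · rw [← Category.assoc, ← k.naturality, Category.assoc, (sq W).inr_desc, hH.inl_desc]
    · rw [← Category.assoc, ← h.naturality, Category.assoc, (sq W).inl_desc, hG.inr_desc]
    · rw [← Category.assoc, ← k.naturality, Category.assoc, (sq W).inr_desc, hH.inr_desc]
  · refine (sq W).hom_ext (hG.hom_ext ?_ ?_) (hH.hom_ext ?_ ?_)
    · rw [← Category.assoc, ← Category.assoc, h.naturality, Category.assoc, Category.assoc, h1]
    · rw [← Category.assoc, ← Category.assoc, h.naturality, Category.assoc, Category.assoc, h2]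
    · rw [← Category.assoc, ← Category.assoc, k.naturality, Category.assoc, Category.assoc, h1]
    · rw [← Category.assoc, ← Category.assoc, k.naturality, Category.assoc, Category.assoc, h2]

/-- `K` is a bare functor here because this result is what shows that the cubes `[m]_K` are good, as
targets of cofibrations; only afterwards is `K` known to be multiexact. -/
theorem homCof.of_isPushout_app [Finite ι] {F G H : Multiexact C D} {f : F ⟶ G} {g : F ⟶ H} (hf : homCof f)
    {K : (∀ i, C i) ⥤ D} {h : G.obj ⟶ K} {k : H.obj ⟶ K}
    (sq : ∀ X, IsPushout (f.hom.app X) (g.hom.app X) (h.app X) (k.app X)) {X Y : ∀ i, C i}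
    (m : X ⟶ Y) (hm : ∀ i, (C i).cof (m i)) :
    CofTrans D.cof (Functor.whiskerLeft (boxCube m) k) :=
  CofTrans.of_isPushout (Q := boxCube m ⋙ K) (γ := Functor.whiskerLeft (boxCube m) g.hom)
    (h := Functor.whiskerLeft (boxCube m) h) D.isWaldhausen (fun p => sq ((boxCube m).obj p))
    ((homCof_iff f).1 hf m hm) (H.property.good m hm)

/-- Zero objects and pushouts pass to `K` because colimits commute, weak equivalences pass to it by
the gluing axiom, and its cubes are targets of cobase changes of cofibrations. -/
theorem isMultiexact_of_isPushout_app [Finite ι] {F G H : Multiexact C D} {f : F ⟶ G} {g : F ⟶ H}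
    (hf : homCof f) {K : (∀ i, C i) ⥤ D} {h : G.obj ⟶ K} {k : H.obj ⟶ K}
    (sq : ∀ X, IsPushout (f.hom.app X) (g.hom.app X) (h.app X) (k.app X)) :
    IsMultiexact C D K where
  zero X i hX := isZero_of_isPushout (sq X) (F.property.zero X i hX) (G.property.zero X i hX)
    (H.property.zero X i hX)
  pushout i _ _ _ _ a b c d hsq hcof hiso :=
    isPushout_map_of_isPushout_app sq (funext fun j => (hsq j).w)
      (F.property.pushout i a b c d hsq hcof hiso) (G.property.pushout i a b c d hsq hcof hiso)
      (H.property.pushout i a b c d hsq hcof hiso)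
  weq {X Y} m hm := D.isWaldhausen.gluing (F.obj.map m) (G.obj.map m) (H.obj.map m) (K.map m)
    (sq X) (sq Y) (cof_app_of_homCof hf X) (cof_app_of_homCof hf Y) (F.property.weq m hm)
    (G.property.weq m hm) (H.property.weq m hm) (f.hom.naturality m).symm
    (g.hom.naturality m).symm (h.naturality m).symm (k.naturality m).symm
  cof _ hm := (isGood_iff _).2 ((hf.of_isPushout_app sq _ hm).target D.isWaldhausen)

theorem exists_isPushout_hom [Finite ι] {F G H : Multiexact C D} {f : F ⟶ G} (g : F ⟶ H) (hf : homCof f) :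
    ∃ (K : Multiexact C D) (h : G ⟶ K) (k : H ⟶ K),
      (∀ X, IsPushout (f.hom.app X) (g.hom.app X) (h.hom.app X) (k.hom.app X)) ∧ homCof k := by
  obtain ⟨K, h, k, sq⟩ := exists_pushout_functor f.hom g.hom fun X => by
    obtain ⟨Q, h, k, sq, -⟩ := D.isWaldhausen.pushout (f.hom.app X) (g.hom.app X)
      (cof_app_of_homCof hf X)
    exact ⟨Q, h, k, sq⟩
  exact ⟨⟨K, isMultiexact_of_isPushout_app hf sq⟩, ObjectProperty.homMk h,
    ObjectProperty.homMk k, sq, (homCof_iff _).2 (hf.of_isPushout_app sq)⟩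

/-- Pushouts along cofibrations of multiexact functors are levelwise. -/
theorem isPushout_app [Finite ι] {F G H K : Multiexact C D} {f : F ⟶ G} {g : F ⟶ H} {h : G ⟶ K}
    {k : H ⟶ K} (sq : IsPushout f g h k) (hf : homCof f) (X : ∀ i, C i) :
    IsPushout (f.hom.app X) (g.hom.app X) (h.hom.app X) (k.hom.app X) := by
  -- Every pushout is isomorphic to the levelwise one.
  obtain ⟨K', h', k', sq', -⟩ := exists_isPushout_hom g hf
  let e := (isPushout_of_app sq').isoIsPushout _ _ sq
  refine (sq' X).of_iso (Iso.refl _) (Iso.refl _) (Iso.refl _) ((evalAt X).mapIso e)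
    (by simp) (by simp) ?_ ?_
  · refine Eq.trans ?_ (Category.id_comp _).symm
    exact (evalAt X).congr_map (IsPushout.inl_isoIsPushout_hom _ _ (isPushout_of_app sq') sq)
  · refine Eq.trans ?_ (Category.id_comp _).symm
    exact (evalAt X).congr_map (IsPushout.inr_isoIsPushout_hom _ _ (isPushout_of_app sq') sq)

/-- The category of multiexact functors is a Waldhausen category. -/
theorem isWaldhausen_multiexact [Finite ι] : IsWaldhausen (Multiexact C D) homCof homWeq where
  cof_multiplicative :=
    { id_mem := fun F => (homCof_iff _).2 fun m hm => CofTrans.of_isIso D.isWaldhausen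
        (fun p => inferInstanceAs (IsIso (𝟙 _))) (F.property.good m hm)
      comp_mem := fun f g hf hg => (homCof_iff _).2 fun m hm => CofTrans.comp D.isWaldhausen
        ((homCof_iff _).1 hf m hm) ((homCof_iff _).1 hg m hm) }
  weq_multiplicative :=
    { id_mem := fun F X => D.isWaldhausen.weq_id _
      comp_mem := fun f g hf hg X => D.isWaldhausen.weq_comp (hf X) (hg X) }
  cof_of_isIso {F G} f hf := (homCof_iff _).2 fun m hm => CofTrans.of_isIso D.isWaldhausen
        (fun p => inferInstanceAs (IsIso ((evalAt ((boxCube m).obj p)).map f)))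
        (F.property.good m hm)
  weq_of_isIso f hf X := D.isWaldhausen.weq_of_isIso _ (inferInstanceAs (IsIso ((evalAt X).map f)))
  two_out_of_three :=
    { comp_mem := fun f g hf hg X => D.isWaldhausen.weq_comp (hf X) (hg X)
      of_postcomp := fun f g hg hfg X =>
        haveI := D.isWaldhausen.two_out_of_three
        D.weq.of_postcomp (f.hom.app X) (g.hom.app X) (hg X) (hfg X)
      of_precomp := fun f g hf hfg X =>
        haveI := D.isWaldhausen.two_out_of_three
        D.weq.of_precomp (f.hom.app X) (g.hom.app X) (hf X) (hfg X) }
  hasZero := by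
    obtain ⟨Z, hZ⟩ := D.isWaldhausen.hasZero.zero
    exact ⟨⟨⟨_, isMultiexact_const hZ⟩, isZero_of_app fun _ => hZ⟩⟩
  cof_from_zero {Z A} hZ f := (homCof_iff _).2 fun m hm => CofTrans.of_isZero D.isWaldhausen
    (fun p => isZero_app hZ _) (A.property.good m hm)
  pushout f g hf := by
    obtain ⟨K, h, k, sq, hk⟩ := exists_isPushout_hom g hf
    exact ⟨K, h, k, isPushout_of_app sq, hk⟩
  gluing a b c p sq sq₁ hf hf₁ ha hb hc e1 e2 e3 e4 X :=
    D.isWaldhausen.gluing _ _ _ _ (isPushout_app sq hf X) (isPushout_app sq₁ hf₁ X)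
      (cof_app_of_homCof hf X) (cof_app_of_homCof hf₁ X) (ha X) (hb X) (hc X)
      ((evalAt X).congr_map e1) ((evalAt X).congr_map e2) ((evalAt X).congr_map e3)
      ((evalAt X).congr_map e4)

theorem preservesCof_evalAt [Finite ι] (X : ∀ i, C i) :
    PreservesCof homCof (evalAt X : Multiexact C D ⥤ D) where
  zero _ hZ := isZero_app hZ X
  pushout _ _ _ _ sq hf := isPushout_app sq hf X

end homs

open Cyl

/-! ### Fixing all variables but one -/

section insertFunctor

variable {ι : Type} {C : ι → WaldCat.{u}}

open Classical in
/-- The functor `C i ⥤ ∏ C j` that is the identity in the coordinate `i` and constant with value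
`A j` in the other coordinates `j`. -/
def insertFunctor (i : ι) (A : ∀ j, C j) : C i ⥤ (∀ j, C j) :=
  Functor.pi' fun j => if h : i = j then
    (Pi.eqToEquivalence (fun i => (C i).carrier) h).functor else (Functor.const _).obj (A j)

theorem insertFunctor_self (i : ι) (A : ∀ j, C j) :
    insertFunctor i A ⋙ Pi.eval (fun j => (C j).carrier) i = 𝟭 _ := by
  refine (Functor.pi'_eval _ _).trans ?_
  rw [dif_pos rfl]
  rfl

theorem insertFunctor_of_ne {i j : ι} (h : i ≠ j) (A : ∀ j, C j) :
    insertFunctor i A ⋙ Pi.eval (fun j => (C j).carrier) j = (Functor.const _).obj (A j) := by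
  refine (Functor.pi'_eval _ _).trans ?_
  rw [dif_neg h]

theorem insertFunctor_obj {i : ι} {A X : ∀ j, C j} (h : ∀ j, i ≠ j → X j = A j) :
    X = (insertFunctor i A).obj (X i) := by
  funext j
  by_cases hij : i = j
  · subst hij
    exact (Functor.congr_obj (insertFunctor_self i A) (X i)).symm
  · exact (h j hij).trans (Functor.congr_obj (insertFunctor_of_ne hij A) (X i)).symm

theorem pi_eqToHom_apply {X Y : ∀ j, C j} (h : X = Y) (j : ι) :
    (eqToHom h : X ⟶ Y) j = eqToHom (congrFun h j) := by
  subst h; rfl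

theorem insertFunctor_naturality {i : ι} {A X Y : ∀ j, C j} (hX : ∀ j, i ≠ j → X j = A j)
    (hY : ∀ j, i ≠ j → Y j = A j) (f : X ⟶ Y)
    (hf : ∀ j (h : i ≠ j), f j = eqToHom ((hX j h).trans (hY j h).symm)) :
    f ≫ eqToHom (insertFunctor_obj hY) = eqToHom (insertFunctor_obj hX) ≫
      (insertFunctor i A).map (f i) := by
  -- The coordinates of `insertFunctor` are only propositionally the identity or constant;
  -- generalising over the functor allows substitution.
  have key : ∀ (G : C i ⥤ C i), G = 𝟭 _ → ∀ {a b : C i} (f : a ⟶ b) (e₁ : a = G.obj a)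
      (e₂ : b = G.obj b), f ≫ eqToHom e₂ = eqToHom e₁ ≫ G.map f := by
    rintro _ rfl a b f e₁ e₂
    exact (Category.comp_id _).trans (Category.id_comp _).symm
  have key' : ∀ (j : ι) (G : C i ⥤ C j), G = (Functor.const _).obj (A j) →
      ∀ {a b : C i} {x y : C j} (f : a ⟶ b) (hx : x = A j) (hy : y = A j) (e₁ : x = G.obj a)
      (e₂ : y = G.obj b), eqToHom (hx.trans hy.symm) ≫ eqToHom e₂ = eqToHom e₁ ≫ G.map f := by
    rintro j _ rfl a b _ _ f rfl rfl e₁ e₂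
    exact (Category.comp_id _).trans (Category.id_comp _).symm
  funext j
  change f j ≫ (eqToHom (insertFunctor_obj hY) : Y ⟶ _) j =
    (eqToHom (insertFunctor_obj hX) : X ⟶ _) j ≫
      (insertFunctor i A ⋙ Pi.eval (fun j => (C j).carrier) j).map (f i)
  rw [pi_eqToHom_apply, pi_eqToHom_apply]
  by_cases hij : i = j
  · subst hij
    exact key _ (insertFunctor_self i A) (f i) _ _
  · rw [hf j hij]
    exact key' j _ (insertFunctor_of_ne hij A) (f i) (hX j hij) (hY j hij) _ _

/-- In the fixed coordinates the square is constant, hence a pushout square of identities, so the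
one-variable axiom applies. -/
theorem IsMultiexact.preservesCof {D : WaldCat.{u}} {F : (∀ i, C i) ⥤ D}
    (hF : IsMultiexact C D F) (i : ι) (A : ∀ j, C j) :
    PreservesCof (C i).cof (insertFunctor i A ⋙ F) where
  zero Z hZ := hF.zero _ i (by
    have e := Functor.congr_obj (insertFunctor_self i A) Z
    exact hZ.of_iso (eqToIso e))
  pushout f g h k sq hf := by
    refine hF.pushout i _ _ _ _ (fun j => ?_) ?_ fun j hj => ?_
    · change IsPushout ((insertFunctor i A ⋙ Pi.eval (fun j => (C j).carrier) j).map f)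
        ((insertFunctor i A ⋙ Pi.eval (fun j => (C j).carrier) j).map g)
        ((insertFunctor i A ⋙ Pi.eval (fun j => (C j).carrier) j).map h)
        ((insertFunctor i A ⋙ Pi.eval (fun j => (C j).carrier) j).map k)
      by_cases hij : i = j
      · subst hij
        rw [insertFunctor_self]
        exact sq
      · rw [insertFunctor_of_ne hij]
        exact IsPushout.of_id_fst
    · change (C i).cof ((insertFunctor i A ⋙ Pi.eval (fun j => (C j).carrier) i).map f)
      rw [insertFunctor_self]
      exact hf
    · change IsIso ((insertFunctor i A ⋙ Pi.eval (fun j => (C j).carrier) j).map f) ∧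
        IsIso ((insertFunctor i A ⋙ Pi.eval (fun j => (C j).carrier) j).map g)
      rw [insertFunctor_of_ne hj.symm]
      exact ⟨inferInstanceAs (IsIso (𝟙 _)), inferInstanceAs (IsIso (𝟙 _))⟩

end insertFunctor

/-! ### Colimits in all variables -/

section product

variable {ι : Type}

/-- The product of partial orders. -/
@[ext]
structure PiOrder (P : ι → Type) where
  /-- The underlying tuple. -/
  val : ∀ i, P i

instance (P : ι → Type) [∀ i, PartialOrder (P i)] : PartialOrder (PiOrder P) :=
  PartialOrder.lift PiOrder.val fun _ _ h => PiOrder.ext h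

instance (P : ι → Type) [Finite ι] [∀ i, Finite (P i)] : Finite (PiOrder P) :=
  Finite.of_injective PiOrder.val fun _ _ h => PiOrder.ext h

variable {C : ι → WaldCat.{u}} {D : WaldCat.{u}} {P : ι → Type} [∀ i, PartialOrder (P i)]

/-- The product of diagrams. -/
def prodDiagram (X : ∀ i, P i ⥤ C i) : PiOrder P ⥤ (∀ i, C i) where
  obj x i := (X i).obj (x.val i)
  map f i := (X i).map (homOfLE (leOfHom f i))
  map_id x := funext fun i => (X i).map_id (x.val i)
  map_comp f g := funext fun i => (map_homOfLE_comp (X i) (leOfHom f i) (leOfHom g i)).symm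

variable {F : (∀ i, C i) ⥤ D} {X : ∀ i, P i ⥤ C i}

theorem map_homOfLE_of_eq {Q A : Type*} [PartialOrder Q] [Category* A] (Y : Q ⥤ A) {x y : Q}
    (h : x ≤ y) (e : x = y) : Y.map (homOfLE h) = eqToHom (congrArg Y.obj e) := by
  subst e
  exact map_homOfLE_self _ _

/-- On the line through `q` in direction `i` the diagram is, up to `eqToHom`, `X i` followed by `F`
with its other variables fixed, and that functor preserves Reedy colimits. The colimit is required
to be a value of the diagram itself, so that every cocone map is a structure map. -/
theorem IsMultiexact.isColim_coordinate (hF : IsMultiexact C D F) (q : PiOrder P) (i : ι)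
    [Finite (P i)] {T : P i → Prop} (hR : Reedy (C i).cof (X i) T) (hq : ∀ p, T p → p ≤ q.val i)
    (hT : IsColim (X i) T ((X i).obj (q.val i)) (fun p hp => (X i).map (homOfLE (hq p hp))))
    (hle : ∀ x : PiOrder P, (T (x.val i) ∧ ∀ j, i ≠ j → x.val j = q.val j) → x ≤ q) :
    IsColim (prodDiagram X ⋙ F) (fun x => T (x.val i) ∧ ∀ j, i ≠ j → x.val j = q.val j)
      ((prodDiagram X ⋙ F).obj q)
      (fun x hx => (prodDiagram X ⋙ F).map (homOfLE (hle x hx))) := by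
  classical
  let A : ∀ j, C j := (prodDiagram X).obj q
  have h1 := (hF.preservesCof i A).isColim (C i).isWaldhausen hR hT
  have hobj : ∀ x : PiOrder P, (∀ j, i ≠ j → x.val j = q.val j) →
      ∀ j, i ≠ j → (prodDiagram X).obj x j = A j :=
    fun x hx j hj => congrArg (X j).obj (hx j hj)
  let η : ∀ x : PiOrder P, (∀ j, i ≠ j → x.val j = q.val j) →
      ((prodDiagram X ⋙ F).obj x ≅ (X i ⋙ insertFunctor i A ⋙ F).obj (x.val i)) :=
    fun x hx => F.mapIso (eqToIso (insertFunctor_obj (hobj x hx)))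
  have hnat : ∀ x y : PiOrder P, ∀ (hx : ∀ j, i ≠ j → x.val j = q.val j)
      (hy : ∀ j, i ≠ j → y.val j = q.val j) (h : x ≤ y),
      (prodDiagram X ⋙ F).map (homOfLE h) ≫ (η y hy).hom =
      (η x hx).hom ≫ (X i ⋙ insertFunctor i A ⋙ F).map (homOfLE (h i)) := by
    intro x y hx hy h
    refine (F.map_comp _ _).symm.trans (Eq.trans ?_ (F.map_comp _ _))
    refine congrArg F.map ?_
    refine insertFunctor_naturality (hobj x hx) (hobj y hy) ((prodDiagram X).map (homOfLE h)) ?_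
    intro j hj
    exact map_homOfLE_of_eq (X j) (h j) ((hx j hj).trans (hy j hj).symm)
  have hK : IsKan (prodDiagram X ⋙ F) (X i ⋙ insertFunctor i A ⋙ F) (fun x => x.val i)
      (fun x => T (x.val i) ∧ ∀ j, i ≠ j → x.val j = q.val j) T
      (fun x hx => (η x hx.2).hom) := by
    refine IsKan.of_top (fun x y _ _ h => h i) (fun x hx => hx.1)
      (fun x y hx hy h => hnat x y hx.2 hy.2 h) ?_
    intro t ht
    have hself : Function.update q.val i t i = t := Function.update_self i t q.val
    refine ⟨⟨Function.update q.val i t⟩, ⟨(congrArg T hself).mpr ht, ?_⟩, hself.le, ?_, ?_⟩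
    · intro j hj
      exact Function.update_of_ne hj.symm _ _
    · intro x hx hxt j
      by_cases hij : i = j
      · subst hij
        exact hxt.trans hself.symm.le
      · exact ((hx.2 j hij).trans (Function.update_of_ne (Ne.symm hij) _ _).symm).le
    · rw [map_homOfLE_of_eq _ _ hself]
      infer_instance
  have h2 := (hK.isColim h1).of_iso (η q fun _ _ => rfl).symm
  have e : (fun (x : PiOrder P) (hx : T (x.val i) ∧ ∀ j, i ≠ j → x.val j = q.val j) =>
      (prodDiagram X ⋙ F).map (homOfLE (hle x hx))) = fun x hx =>
      ((η x hx.2).hom ≫ (insertFunctor i A ⋙ F).map ((X i).map (homOfLE (hq _ hx.1)))) ≫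
        (η q fun _ _ => rfl).symm.hom := by
    funext x hx
    exact (Iso.eq_comp_inv _).2 (hnat x q hx.2 (fun _ _ => rfl) (hle x hx))
  rw [e]
  exact h2

open Classical in
/-- Multiexact functors preserve colimits of Reedy cofibrant diagrams in all variables. -/
theorem IsMultiexact.isColim_prod_top [Finite ι] [∀ i, Finite (P i)] (hF : IsMultiexact C D F)
    (t : PiOrder P) (ht : ∀ x, x ≤ t) {T : ∀ i, P i → Prop}
    (hR : ∀ i, Reedy (C i).cof (X i) (T i)) (hle : ∀ i (p : P i), p ≤ t.val i)
    (hT : ∀ i, IsColim (X i) (T i) ((X i).obj (t.val i))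
      (fun p _ => (X i).map (homOfLE (hle i p)))) :
    IsColim (prodDiagram X ⋙ F) (fun x => ∀ i, T i (x.val i)) ((prodDiagram X ⋙ F).obj t)
      (fun x _ => (prodDiagram X ⋙ F).map (homOfLE (ht x))) := by
  have := Fintype.ofFinite ι
  -- Coordinates in `s` run through `T i`, the others stay at the top value: for `s` empty only `t`
  -- remains, for `s` everything this is the claim.
  suffices h : ∀ s : Finset ι, IsColim (prodDiagram X ⋙ F)
      (fun x => ∀ i, (i ∈ s → T i (x.val i)) ∧ (i ∉ s → x.val i = t.val i))
      ((prodDiagram X ⋙ F).obj t) (fun x _ => (prodDiagram X ⋙ F).map (homOfLE (ht x))) by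
    exact (h Finset.univ).congr_set fun x => by simp
  intro s
  induction s using Finset.induction_on with
  | empty =>
    exact isColim_of_top (b := t) (fun i => by simp) fun p _ => ht p
  | insert i s his ih =>
    -- Raising coordinate `i` to its top value: freeing this coordinate is undone by a Kan extension
    -- along `m`, computed in the single variable `i`.
    let m : PiOrder P → PiOrder P := fun x => ⟨Function.update x.val i (t.val i)⟩
    have hm : ∀ x, x ≤ m x := fun x j => by
      by_cases hj : j = i
      · subst hj
        exact (hle j _).trans (Function.update_self j (t.val j) x.val).symm.le
      · exact (Function.update_of_ne hj _ _).symm.le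
    have hK : IsKan (prodDiagram X ⋙ F) (prodDiagram X ⋙ F) m
        (fun x => ∀ j, (j ∈ insert i s → T j (x.val j)) ∧ (j ∉ insert i s → x.val j = t.val j))
        (fun x => ∀ j, (j ∈ s → T j (x.val j)) ∧ (j ∉ s → x.val j = t.val j))
        (fun x _ => (prodDiagram X ⋙ F).map (homOfLE (hm x))) := by
      refine ⟨?_, ?_, ?_, ?_⟩
      · intro x y _ _ hxy j
        by_cases hj : j = i
        · subst hj
          exact ((Function.update_self j (t.val j) x.val).trans
            (Function.update_self j (t.val j) y.val).symm).le
        · refine (Function.update_of_ne hj _ _).le.trans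
            ((hxy j).trans (Function.update_of_ne hj _ _).symm.le)
      · intro x hx j
        by_cases hj : j = i
        · subst hj
          exact ⟨fun h => absurd h his, fun _ => Function.update_self j (t.val j) x.val⟩
        · have e : (m x).val j = x.val j := Function.update_of_ne hj _ _
          rw [e]
          exact ⟨fun h => (hx j).1 (Finset.mem_insert_of_mem h),
            fun h => (hx j).2 (by simp [hj, h])⟩
      · intro x y _ _ h
        rw [map_homOfLE_comp, map_homOfLE_comp]
      · intro q hq
        have hqi : q.val i = t.val i := (hq i).2 his
        have hTi : IsColim (X i) (T i) ((X i).obj (q.val i)) (fun p _ => (X i).map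
            (homOfLE ((hle i p).trans hqi.symm.le))) := by
          have key : ∀ z : P i, ∀ hz : z = t.val i, IsColim (X i) (T i) ((X i).obj z)
              (fun p _ => (X i).map (homOfLE ((hle i p).trans hz.symm.le))) := by
            rintro _ rfl; exact hT i
          exact key _ hqi
        have hle' : ∀ x : PiOrder P, (T i (x.val i) ∧ ∀ j, i ≠ j → x.val j = q.val j) → x ≤ q := by
          intro x hx j
          by_cases hj : i = j
          · subst hj; exact (hle i _).trans hqi.symm.le
          · exact (hx.2 j hj).le
        have h1 := hF.isColim_coordinate q i (hR i) _ hTi hle'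
        have e : (fun (x : PiOrder P) (hx : (∀ j, (j ∈ insert i s → T j (x.val j)) ∧
              (j ∉ insert i s → x.val j = t.val j)) ∧ m x ≤ q) =>
            (prodDiagram X ⋙ F).map (homOfLE (hm x)) ≫ (prodDiagram X ⋙ F).map (homOfLE hx.2)) =
            fun x hx => (prodDiagram X ⋙ F).map (homOfLE ((hm x).trans hx.2)) := by
          funext x hx
          rw [map_homOfLE_comp]
        rw [e]
        -- Every `x` with `m x ≤ q` lies below the tuple `q` with its coordinate `i` replaced by
        -- that of `x`, so the line through `q` is cofinal.
        refine IsColim.of_cofinal (S := fun x => T i (x.val i) ∧ ∀ j, i ≠ j → x.val j = q.val j)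
          ?_ ?_ ?_ h1
        · intro x hx
          refine ⟨fun j => ?_, fun j => ?_⟩
          · by_cases hj : i = j
            · subst hj
              exact ⟨fun _ => hx.1, fun h => absurd (Finset.mem_insert_self _ _) h⟩
            · rw [hx.2 j hj]
              exact ⟨fun h => (hq j).1 (Finset.mem_of_mem_insert_of_ne h (Ne.symm hj)),
                fun h => (hq j).2 fun h' => h (Finset.mem_insert_of_mem h')⟩
          · by_cases hj : i = j
            · subst hj
              exact (Function.update_self i (t.val i) x.val).le.trans hqi.symm.le
            · exact (Function.update_of_ne (Ne.symm hj) _ _).le.trans (hx.2 j hj).le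
        · intro x hx
          refine ⟨⟨Function.update q.val i (x.val i)⟩, ⟨?_, fun j hj => ?_⟩, fun j => ?_⟩
          · have e' : Function.update q.val i (x.val i) i = x.val i := Function.update_self _ _ _
            exact (congrArg (T i) e').mpr ((hx.1 i).1 (Finset.mem_insert_self _ _))
          · exact Function.update_of_ne hj.symm _ _
          · by_cases hj : j = i
            · subst hj; exact (Function.update_self _ _ _).symm.le
            · have e1 := hx.2 j
              have e2 : (m x).val j = x.val j := Function.update_of_ne hj _ _
              have e3 : Function.update q.val i (x.val i) j = q.val j := Function.update_of_ne hj _ _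
              exact (e2.symm.le.trans e1).trans e3.symm.le
        · intro x y hx hy h
          rw [map_homOfLE_comp]
    have h2 := hK.isColim ih
    have e : (fun (x : PiOrder P) (_ : ∀ j, (j ∈ insert i s → T j (x.val j)) ∧
          (j ∉ insert i s → x.val j = t.val j)) => (prodDiagram X ⋙ F).map (homOfLE (ht x))) =
        fun x _ => (prodDiagram X ⋙ F).map (homOfLE (hm x)) ≫
          (prodDiagram X ⋙ F).map (homOfLE (ht (m x))) := by
      funext x _
      rw [map_homOfLE_comp]
    rw [e]
    exact h2

end product

open Cyl

/-! ### Adjoining colimits as top elements -/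

/-- A partial order with a top element added. -/
inductive TopExt (P : Type) : Type
  | pt : P → TopExt P
  | top : TopExt P

namespace TopExt

variable {P : Type} [PartialOrder P]

/-- The order on `TopExt P`. -/
protected def le : TopExt P → TopExt P → Prop
  | pt x, pt y => x ≤ y
  | _, top => True
  | top, pt _ => False

instance : PartialOrder (TopExt P) where
  le := TopExt.le
  le_refl := by
    rintro (x | _)
    · exact le_refl x
    · trivial
  le_trans := by
    rintro (x | _) (y | _) (z | _) h h'
    all_goals first | trivial | exact h.elim | exact h'.elim | exact le_trans (α := P) h h'
  le_antisymm := by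
    rintro (x | _) (y | _) h h'
    all_goals first | rfl | exact h.elim | exact h'.elim | exact congrArg _ (le_antisymm (α := P) h h')

theorem pt_le_pt {x y : P} : pt x ≤ pt y ↔ x ≤ y := Iff.rfl

theorem le_top (x : TopExt P) : x ≤ top := by
  rcases x with x | _ <;> trivial

instance [Finite P] : Finite (TopExt P) :=
  Finite.of_surjective (fun s : Option P => match s with
    | some p => pt p
    | none => top) (by
    rintro (x | _)
    · exact ⟨some x, rfl⟩
    · exact ⟨none, rfl⟩)

variable {D : Type u} [Category.{v} D] (X : P ⥤ D) {E : D} (c : ∀ p, X.obj p ⟶ E)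

/-- The objects of the extension of `X` with the value `E` at the top element. -/
def obj (E : D) : TopExt P → D
  | pt x => X.obj x
  | top => E

/-- The morphisms of the extension of `X`. -/
def map : ∀ x y : TopExt P, x ≤ y → (obj X E x ⟶ obj X E y)
  | pt _, pt _, h => X.map (homOfLE (pt_le_pt.1 h))
  | pt x, top, _ => c x
  | top, top, _ => 𝟙 E
  | top, pt _, h => h.elim

/-- The extension of `X` by a cocone. -/
def diagram (w : ∀ p q (h : p ≤ q), X.map (homOfLE h) ≫ c q = c p) : TopExt P ⥤ D where
  obj := obj X E
  map {x y} f := map X c x y (leOfHom f)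
  map_id x := by
    rcases x with x | _
    · exact X.map_id x
    · rfl
  map_comp {x y z} f g := by
    have hf := leOfHom f
    have hg := leOfHom g
    rcases x with x | _ <;> rcases y with y | _ <;> rcases z with z | _
    all_goals first
      | exact hf.elim
      | exact hg.elim
      | skip
    · exact (map_homOfLE_comp X _ _).symm
    · exact (w x y _).symm
    · exact (Category.comp_id _).symm
    · exact (Category.comp_id _).symm

end TopExt

open TopExt

theorem IsColim.congr_map {P : Type} [PartialOrder P] {A : Type*} [Category* A] {X : P ⥤ A}
    {S : P → Prop} {E : A} {c c' : ∀ p, S p → (X.obj p ⟶ E)} (h : IsColim X S E c)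
    (e : ∀ p hp, c p hp = c' p hp) : IsColim X S E c' := by
  obtain rfl : c = c' := funext fun p => funext (e p)
  exact h

section product

variable {ι : Type} [Finite ι] {C : ι → WaldCat.{u}} {D : WaldCat.{u}} {P : ι → Type}
  [∀ i, PartialOrder (P i)] {F : (∀ i, C i) ⥤ D} {X : ∀ i, P i ⥤ C i} [∀ i, Finite (P i)]
  {E : ∀ i, C i}

/-- Extending each `X i` by its colimit at a new top element turns the cocone maps into structure
maps, so that `IsMultiexact.isColim_prod_top` applies; the result is then restricted to the old
elements. -/
theorem IsMultiexact.isColim_prod_univ (hF : IsMultiexact C D F)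
    (hR : ∀ i, Reedy (C i).cof (X i) fun _ => True) {c : ∀ i p, (X i).obj p ⟶ E i}
    (hT : ∀ i, IsColim (X i) (fun _ => True) (E i) (fun p _ => c i p)) :
    IsColim (prodDiagram X ⋙ F) (fun _ => True) (F.obj E)
      (fun x _ => F.map (fun i => c i (x.val i))) := by
  let X' : ∀ i, TopExt (P i) ⥤ C i := fun i =>
    TopExt.diagram (X i) (c i) (fun p q h => (hT i).w p q trivial trivial h)
  have hK : ∀ i, IsKan (X i) (X' i) pt (fun _ => True) (fun q => ∃ p, q = pt p)
      (fun p _ => 𝟙 ((X i).obj p)) := by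
    intro i
    refine IsKan.of_top (fun x y _ _ h => h) (fun x _ => ⟨x, rfl⟩)
      (fun p q _ _ h => (Category.comp_id _).trans (Category.id_comp _).symm) ?_
    rintro _ ⟨p, rfl⟩
    refine ⟨p, trivial, le_rfl, fun _ _ h => h, ?_⟩
    rw [map_homOfLE_self]
    exact inferInstanceAs (IsIso (𝟙 _ ≫ 𝟙 ((X i).obj p)))
  have hT' : ∀ i, IsColim (X' i) (fun q => ∃ p, q = pt p) (E i)
      (fun p _ => (X' i).map (homOfLE (TopExt.le_top p))) := by
    intro i
    obtain ⟨c', hc', hcc⟩ := (hK i).exists_isColim (hT i)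
    have : c' = fun p _ => (X' i).map (homOfLE (TopExt.le_top p)) := by
      funext q hq
      obtain ⟨p, rfl⟩ := hq
      exact (Category.id_comp _).symm.trans (hcc p trivial)
    rwa [this] at hc'
  have h := hF.isColim_prod_top (X := X') ⟨fun _ => top⟩ (fun x i => TopExt.le_top _)
    (fun i => (hK i).reedy (C i).isWaldhausen (hR i)) (fun i p => TopExt.le_top p) hT'
  have hK' : IsKan (prodDiagram X ⋙ F) (prodDiagram X' ⋙ F) (fun x => ⟨fun i => pt (x.val i)⟩)
      (fun _ => True) (fun q => ∀ i, ∃ p, q.val i = pt p)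
      (fun x _ => 𝟙 ((prodDiagram X ⋙ F).obj x)) := by
    refine IsKan.of_top (fun x y _ _ h => h) (fun x _ i => ⟨_, rfl⟩)
      (fun p q _ _ h => (Category.comp_id _).trans (Category.id_comp _).symm) ?_
    rintro ⟨q⟩ hq
    choose r hr using hq
    obtain rfl : q = fun i => pt (r i) := funext hr
    refine ⟨⟨r⟩, trivial, le_rfl, fun _ _ h => h, ?_⟩
    rw [map_homOfLE_self]
    exact inferInstanceAs (IsIso (𝟙 _ ≫ 𝟙 ((prodDiagram X ⋙ F).obj ⟨r⟩)))
  have h' := hK'.isColim h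
  exact IsColim.congr_map (E := F.obj E) h' fun x _ => Category.id_comp _

/-- Multiexact functors preserve colimits of Reedy cofibrant diagrams in all variables. -/
theorem IsMultiexact.isColim_prod (hF : IsMultiexact C D F) {T : ∀ i, P i → Prop}
    (hR : ∀ i, Reedy (C i).cof (X i) (T i)) {c : ∀ i p, T i p → ((X i).obj p ⟶ E i)}
    (hT : ∀ i, IsColim (X i) (T i) (E i) (c i)) :
    IsColim (prodDiagram X ⋙ F) (fun x => ∀ i, T i (x.val i)) (F.obj E)
      (fun x hx => F.map (fun i => c i (x.val i) (hx i))) := by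
  -- Restricting to subtypes reduces to colimits over whole partial orders.
  let X' : ∀ i, {p // T i p} ⥤ C i := fun i =>
    Monotone.functor (f := fun p : {p // T i p} => p.1) (fun _ _ h => h) ⋙ X i
  have hK : ∀ i (S : P i → Prop), (∀ p, S p → T i p) → IsKan (X' i) (X i) (fun p => p.1)
      (fun p => S p.1) S (fun p _ => 𝟙 ((X i).obj p.1)) := by
    intro i S hS
    refine IsKan.of_top (fun x y _ _ h => h) (fun x hx => hx)
      (fun p q _ _ h => (Category.comp_id _).trans (Category.id_comp _).symm) ?_
    intro p hp
    refine ⟨⟨p, hS p hp⟩, hp, le_rfl, fun _ _ h => h, ?_⟩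
    rw [map_homOfLE_self]
    exact inferInstanceAs (IsIso (𝟙 _ ≫ 𝟙 ((X i).obj p)))
  have hR' : ∀ i, Reedy (C i).cof (X' i) fun _ => True := by
    rintro i ⟨b, hb⟩ -
    obtain ⟨A, cA, hA, s, hs, hcof⟩ := hR i b hb
    have h1 := ((hK i (fun p => T i p ∧ p < b) fun p hp => hp.1).isColim hA).congr_set
      (T := fun p : {p // T i p} => True ∧ p < ⟨b, hb⟩) (fun p => ⟨fun h => ⟨trivial, h.2⟩, fun h => ⟨p.2, h.2⟩⟩)
    refine ⟨A, _, h1, s, fun p hp => ?_, hcof⟩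
    exact (congrArg (· ≫ s) (Category.id_comp _)).trans (hs p.1 _)
  have h1 := hF.isColim_prod_univ (X := X') (E := E) (c := fun i p => c i p.1 p.2) hR' (fun i => by
    have h := ((hK i (T i) fun _ h => h).isColim (hT i)).congr_set
      (T := fun _ => True) (fun p => ⟨fun _ => trivial, fun _ => p.2⟩)
    have e : (fun (p : {p // T i p}) (_ : True) => c i p.1 p.2) =
        fun (p : {p // T i p}) _ => 𝟙 ((X i).obj p.1) ≫ c i p.1 p.2 := by
      funext p _
      exact (Category.id_comp _).symm
    rw [e]
    exact h)
  have hK' : IsKan (prodDiagram X' ⋙ F) (prodDiagram X ⋙ F) (fun x => ⟨fun i => (x.val i).1⟩)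
      (fun _ => True) (fun x => ∀ i, T i (x.val i))
      (fun x _ => 𝟙 ((prodDiagram X' ⋙ F).obj x)) := by
    refine IsKan.of_top (fun x y _ _ h => h) (fun x _ i => (x.val i).2)
      (fun p q _ _ h => (Category.comp_id _).trans (Category.id_comp _).symm) ?_
    intro q hq
    refine ⟨⟨fun i => ⟨q.val i, hq i⟩⟩, trivial, le_rfl, fun _ _ h => h, ?_⟩
    rw [map_homOfLE_self]
    exact inferInstanceAs (IsIso (𝟙 _ ≫ 𝟙 ((prodDiagram X ⋙ F).obj q)))
  obtain ⟨c', hc', hcc⟩ := hK'.exists_isColim h1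
  exact hc'.congr_map fun x hx =>
    (Category.id_comp _).symm.trans (hcc ⟨fun i => ⟨x.val i, hx i⟩⟩ trivial)

end product

/-! ### Latching maps of products of good diagrams -/

section box

variable {ι : Type} [Finite ι] {B : ι → WaldCat.{u}} {D : WaldCat.{u}} {P : ι → Type}
  [∀ i, PartialOrder (P i)] [∀ i, Finite (P i)] {F : (∀ i, B i) ⥤ D} {X : ∀ i, P i ⥤ B i}

section arrow

variable {Q : Type} [PartialOrder Q] {A : Type*} [Category* A] {Y : Q ⥤ A} {a b : Q} {L : A}
  {c : ∀ p, a ≤ p ∧ p < b → (Y.obj p ⟶ L)} {s : L ⟶ Y.obj b}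

/-- The maps from the values of `Y` on the interval `[a, b]` to the southern arrow. -/
def toSouthern (c : ∀ p, a ≤ p ∧ p < b → (Y.obj p ⟶ L)) (s : L ⟶ Y.obj b) (p : Q) :
    ∀ ε : Fin 2, (a ≤ p ∧ p ≤ b ∧ (ε = 0 → p < b)) →
      (Y.obj p ⟶ (ComposableArrows.mk₁ s).obj ε)
  | 0, h => c p ⟨h.1, h.2.2 rfl⟩
  | 1, h => Y.map (homOfLE h.2.1)

theorem toSouthern_w (hc : IsColim Y (fun p => a ≤ p ∧ p < b) L c)
    (hs : ∀ p hp, c p hp ≫ s = Y.map (homOfLE hp.2.le)) {p q : Q} (hpq : p ≤ q) :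
    ∀ (ε ε' : Fin 2) (hε : ε ≤ ε') (h : a ≤ p ∧ p ≤ b ∧ (ε = 0 → p < b))
      (h' : a ≤ q ∧ q ≤ b ∧ (ε' = 0 → q < b)),
      Y.map (homOfLE hpq) ≫ toSouthern c s q ε' h' =
        toSouthern c s p ε h ≫ (ComposableArrows.mk₁ s).map (homOfLE hε)
  | 0, 0, _, h, h' => (hc.w p q ⟨h.1, h.2.2 rfl⟩ ⟨h'.1, h'.2.2 rfl⟩ hpq).trans
      (Category.comp_id _).symm
  | 0, 1, _, h, h' => (map_homOfLE_comp _ _ _).trans (hs p ⟨h.1, h.2.2 rfl⟩).symm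
  | 1, 1, _, h, h' => (map_homOfLE_comp _ _ _).trans (Category.comp_id _).symm
  | 1, 0, hε, _, _ => absurd hε (by decide)

/-- Both ends of the southern arrow are colimits over parts of the interval: the source with `b`
removed, the target with `b` as greatest element. -/
theorem isColim_toSouthern (hab : a ≤ b) (hc : IsColim Y (fun p => a ≤ p ∧ p < b) L c) :
    ∀ ε : Fin 2, IsColim Y (fun p => a ≤ p ∧ p ≤ b ∧ (ε = 0 → p < b))
      ((ComposableArrows.mk₁ s).obj ε) (fun p h => toSouthern c s p ε h)
  | 0 => hc.congr_set fun p => ⟨fun h => ⟨h.1, h.2.le, fun _ => h.2⟩, fun h => ⟨h.1, h.2.2 rfl⟩⟩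
  | 1 => isColim_of_top (b := b) ⟨hab, le_rfl, fun h => absurd h (by decide)⟩ fun p h => h.2.1

end arrow

/-- A multiexact functor sends a tuple of good diagrams to a good diagram. -/
theorem IsMultiexact.good_prod (hF : IsMultiexact B D F) (hX : ∀ i, Good (B i).cof (X i)) :
    Good D.cof (prodDiagram X ⋙ F) := by
  classical
  intro a b hab
  choose L c hc s hs hcof using fun i => hX i (a.val i) (b.val i) (hab i)
  -- The tuple of latching maps. The southern arrow `σ` of its cube under `F` will be the latching
  -- map at `b`.
  let f : L ⟶ (prodDiagram X).obj b := s
  have h01 : (fun _ => 0 : Vertex ι) ≤ (fun _ => 1) := fun _ => zero_le_one (α := Fin 2)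
  obtain ⟨E, cE, hE, σ, hσ, hσcof⟩ := hF.good f hcof (fun _ => 0) (fun _ => 1) h01
  -- `m x` records the coordinates in which `x` has reached `b`; the punctured cube is a Kan
  -- extension along `m`.
  let m : PiOrder P → Vertex ι := fun x i => if x.val i = b.val i then 1 else 0
  have hm1 : ∀ (x : PiOrder P) i, x.val i ≠ b.val i → m x i = 0 := fun x i h => if_neg h
  have hm2 : ∀ (x : PiOrder P) i, x.val i = b.val i → m x i = 1 := fun x i h => if_pos h
  have hm0 : ∀ (x : PiOrder P), x ≤ b → ∀ i, m x i = 0 → x.val i < b.val i := fun x hx i h =>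
    lt_of_le_of_ne (hx i) fun e => by
      rw [hm2 x i e] at h
      exact absurd h (by decide)
  have hmlt : ∀ (x : PiOrder P), x < b → m x < fun _ => 1 := fun x hx => by
    refine lt_of_le_of_ne (fun i => Fin.le_last _) fun e => hx.ne ?_
    refine PiOrder.ext (funext fun i => ?_)
    by_contra hi
    have h1 := hm1 x i hi
    rw [e] at h1
    exact absurd (show (1 : Fin 2) = 0 from h1) (by decide)
  have hmem : ∀ (x : PiOrder P) (_ : a ≤ x ∧ x ≤ b) (ε : Vertex ι), m x ≤ ε → ∀ i,
      a.val i ≤ x.val i ∧ x.val i ≤ b.val i ∧ (ε i = 0 → x.val i < b.val i) :=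
    fun x hx ε hε i => ⟨hx.1 i, hx.2 i, fun h => hm0 x hx.2 i (by
      have h1 : m x i ≤ ε i := hε i
      rw [h] at h1
      exact le_antisymm h1 (Fin.zero_le _))⟩
  let η : ∀ (x : PiOrder P), (a ≤ x ∧ x ≤ b) → ((prodDiagram X ⋙ F).obj x ⟶
      (boxCube f ⋙ F).obj (m x)) := fun x hx =>
    F.map (fun i => toSouthern (c i) (s i) (x.val i) (m x i) (hmem x hx (m x) le_rfl i))
  have hη : ∀ (x y : PiOrder P) (hx : a ≤ x ∧ x ≤ b) (hxy : x ≤ y) (ε : Vertex ι) (hε : m x ≤ ε)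
      (hy : ∀ i, a.val i ≤ y.val i ∧ y.val i ≤ b.val i ∧ (ε i = 0 → y.val i < b.val i)),
      η x hx ≫ (boxCube f ⋙ F).map (homOfLE hε) = (prodDiagram X ⋙ F).map (homOfLE hxy) ≫
        F.map (fun i => toSouthern (c i) (s i) (y.val i) (ε i) (hy i)) := by
    intro x y hx hxy ε hε hy
    refine (F.map_comp _ _).symm.trans (Eq.trans ?_ (F.map_comp _ _))
    refine congrArg F.map (funext fun i => ?_)
    exact (toSouthern_w (hc i) (hs i) (hxy i) (m x i) (ε i) (hε i) _ (hy i)).symm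
  have hmono : ∀ x y : PiOrder P, x ≤ y → y ≤ b → m x ≤ m y := fun x y hxy hy i => by
    by_cases h : x.val i = b.val i
    · rw [hm2 y i (le_antisymm (hy i) (h.symm.le.trans (hxy i)))]
      exact Fin.le_last _
    · rw [hm1 x i h]
      exact Fin.zero_le _
  have hK : IsKan (prodDiagram X ⋙ F) (boxCube f ⋙ F) m (fun x => a ≤ x ∧ x < b)
      (fun ε => (fun _ => 0) ≤ ε ∧ ε < fun _ => 1) (fun x hx => η x ⟨hx.1, hx.2.le⟩) := by
    refine ⟨fun x y _ hy hxy => hmono x y hxy hy.2.le, ?_, ?_, ?_⟩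
    · exact fun x hx => ⟨fun i => Fin.zero_le _, hmlt x hx.2⟩
    · intro x y hx hy hxy
      exact (hη x y ⟨hx.1, hx.2.le⟩ hxy (m y) (hmono x y hxy hy.2.le)
        (hmem y ⟨hy.1, hy.2.le⟩ _ le_rfl)).symm
    · intro ε hε
      -- The elements with `m x ≤ ε` form a product of intervals, punctured where `ε i = 0`; so `F`
      -- of the tuple of their colimits is the colimit, and it is the value of the cube at `ε`.
      have h1 := hF.isColim_prod (X := X) (E := (boxCube f).obj ε)
        (T := fun i p => a.val i ≤ p ∧ p ≤ b.val i ∧ (ε i = 0 → p < b.val i))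
        (c := fun i p h => toSouthern (c i) (s i) p (ε i) h)
        (fun i => (hX i (a.val i)).subset (fun p hp => hp.1) fun x hx y hy hxy =>
          ⟨hx, hxy.trans hy.2.1, fun h => hxy.trans_lt (hy.2.2 h)⟩)
        (fun i => isColim_toSouthern (hab i) (hc i) (ε i))
      have hset : ∀ x : PiOrder P, (∀ i, a.val i ≤ x.val i ∧ x.val i ≤ b.val i ∧
          (ε i = 0 → x.val i < b.val i)) ↔ ((a ≤ x ∧ x < b) ∧ m x ≤ ε) := by
        intro x
        constructor
        · intro h
          have hle : m x ≤ ε := fun i => by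
            by_cases hi : x.val i = b.val i
            · have h0 : ε i ≠ 0 := fun h0 => ((h i).2.2 h0).ne hi
              have : ∀ z : Fin 2, z ≠ 0 → 1 ≤ z := by decide
              exact (hm2 x i hi).le.trans (this _ h0)
            · rw [hm1 x i hi]
              exact Fin.zero_le _
          refine ⟨⟨fun i => (h i).1, lt_of_le_of_ne (fun i => (h i).2.1) ?_⟩, hle⟩
          rintro rfl
          refine hε.2.not_ge fun i => ?_
          have h1 := hle i
          rwa [hm2 x i rfl] at h1
        · exact fun h => hmem x ⟨h.1.1, h.1.2.le⟩ ε h.2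
      have h2 := h1.congr_set hset
      have e : (fun (x : PiOrder P) (hx : (a ≤ x ∧ x < b) ∧ m x ≤ ε) =>
          η x ⟨hx.1.1, hx.1.2.le⟩ ≫ (boxCube f ⋙ F).map (homOfLE hx.2)) = fun x hx =>
          F.map (fun i => toSouthern (c i) (s i) (x.val i) (ε i) ((hset x).2 hx i)) := by
        funext x hx
        rw [hη x x ⟨hx.1.1, hx.1.2.le⟩ le_rfl ε hx.2 ((hset x).2 hx), map_homOfLE_self]
        exact Category.id_comp _
      rw [e]
      exact h2
  refine ⟨E, _, hK.isColim hE, σ, fun x hx => ?_, hσcof⟩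
  have hb : ∀ i, a.val i ≤ b.val i ∧ b.val i ≤ b.val i ∧ ((1 : Fin 2) = 0 → b.val i < b.val i) :=
    fun i => ⟨hab i, le_rfl, fun h => absurd h (by decide)⟩
  refine (Category.assoc _ _ _).trans ((congrArg (η x ⟨hx.1, hx.2.le⟩ ≫ ·) (hσ _ _)).trans ?_)
  refine (hη x b ⟨hx.1, hx.2.le⟩ hx.2.le (fun _ => 1) (hmlt x hx.2).le hb).trans ?_
  refine Eq.trans ?_ (Category.comp_id _)
  refine congrArg ((prodDiagram X ⋙ F).map (homOfLE hx.2.le) ≫ ·) ?_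
  refine Eq.trans (congrArg F.map (funext fun i => ?_)) (F.map_id _)
  exact map_homOfLE_self (X i) _

end box

open Cyl

/-! ### Identities, permutations and composition -/

section stable

/-- `hP` says that intervals have no interior. Latching objects are then zero objects (`a = b`) or
`X.obj a`, so only structure maps and maps from zero need be cofibrations. -/
theorem good_of_cof_map {D : Type u} [Category.{v} D] {cof weq : MorphismProperty D}
    (hD : IsWaldhausen D cof weq) {P : Type*} [PartialOrder P]
    (hP : ∀ a p b : P, a ≤ p → p < b → p = a) {X : P ⥤ D}
    (h : ∀ (a b : P) (hab : a ≤ b), cof (X.map (homOfLE hab))) : Good cof X := by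
  intro a b hab
  by_cases e : a = b
  · subst e
    obtain ⟨Z, hZ⟩ := hD.hasZero.zero
    exact ⟨Z, fun p hp => absurd hp.1 hp.2.not_ge, isColim_empty hZ (fun p hp => hp.2.not_ge hp.1) _,
      hZ.to_ _, fun p hp => absurd hp.1 hp.2.not_ge, hD.cof_from_zero hZ _⟩
  · refine ⟨X.obj a, _, isColim_of_top (b := a) ⟨le_rfl, lt_of_le_of_ne hab e⟩
      fun p hp => (hP a p b hp.1 hp.2).le, X.map (homOfLE hab), fun p hp => ?_, h a b hab⟩
    rw [map_homOfLE_comp]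

theorem isMultiexact_idFunctor (C : WaldCat.{u}) :
    IsMultiexact (fun _ : Unit => C) C (idFunctor C) where
  zero _ _ h := h
  pushout _ _ _ _ _ _ _ _ _ sq _ _ := sq ()
  weq _ h := h ()
  cof {X Y} f h := (isGood_iff _).2 <| good_of_cof_map C.isWaldhausen
    (fun a p b hap hpb => by
      have h1 : ∀ x y z : Fin 2, x ≤ y → y < z → y = x := by decide
      have hlt : p () < b () := by
        refine lt_of_le_of_ne (hpb.le ()) fun e => hpb.ne (funext fun _ => e)
      exact funext fun _ => h1 _ _ _ (hap ()) hlt)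
    fun a b hab => by
      have key : ∀ (x y : Fin 2) (hxy : x ≤ y),
          C.cof ((ComposableArrows.mk₁ (f ())).map (homOfLE hxy)) := by
        intro x y hxy
        match x, y, hxy with
        | 0, 0, _ => exact C.isWaldhausen.cof_id _
        | 0, 1, _ => exact h ()
        | 1, 1, _ => exact C.isWaldhausen.cof_id _
        | 1, 0, h => exact absurd h (by decide)
      exact key _ _ (hab ())

section reindex

variable {ι ι' : Type} {C : ι → WaldCat.{u}} {D : WaldCat.{u}}

theorem permute_comap (C : ι → WaldCat.{u}) (e : ι' ≃ ι) :
    permute C e ⋙ Pi.comap (fun i => (C i).carrier) e = 𝟭 _ := by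
  refine Functor.pi_ext _ _ fun j => ?_
  have key : ∀ (j' : ι') (h : e j' = e j),
      Pi.eval (fun j => (C (e j)).carrier) j' ⋙
        (Pi.eqToEquivalence (fun i => (C i).carrier) h).functor =
      Pi.eval (fun j => (C (e j)).carrier) j := by
    intro j' h
    obtain rfl := e.injective h
    rfl
  exact key (e.symm (e j)) (by simp)

/-- Characterises the permuted functor through the reindexing `Pi.comap`, the inverse of `permute`,
which computes without transports. In the applications the hypothesis is often `rfl`. -/
theorem eq_actFunctor {e : ι' ≃ ι} {F : (∀ i, C i) ⥤ D} {H : (∀ j, C (e j)) ⥤ D}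
    (h : Pi.comap (fun i => (C i).carrier) e ⋙ H = F) : H = actFunctor e F := by
  subst h
  change H = (permute C e ⋙ Pi.comap (fun i => (C i).carrier) e) ⋙ H
  rw [permute_comap]
  rfl

/-- Reindexing of cubes. -/
def vertexCongr (e : ι' ≃ ι) : Vertex ι ≃o Vertex ι' where
  toFun x j := x (e j)
  invFun y i := y (e.symm i)
  left_inv x := funext fun i => congrArg x (e.apply_symm_apply i)
  right_inv y := funext fun j => congrArg y (e.symm_apply_apply j)
  map_rel_iff' {x y} := ⟨fun h i => by
    obtain ⟨j, rfl⟩ := e.surjective i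
    exact h j, fun h j => h (e j)⟩

theorem good_comap_iff [Finite ι] (e : ι' ≃ ι) (H : (∀ j, C (e j)) ⥤ D) {X Y : ∀ i, C i}
    (f : X ⟶ Y) : Good D.cof (boxCube f ⋙ Pi.comap (fun i => (C i).carrier) e ⋙ H) ↔
      Good D.cof (boxCube (C := fun j => C (e j)) (X := fun j => X (e j)) (Y := fun j => Y (e j))
        (fun j => f (e j)) ⋙ H) :=
  good_iff_of_orderIso D.isWaldhausen (vertexCongr e) (fun _ => Iso.refl _) fun _ _ _ =>
    (Category.comp_id _).trans (Category.id_comp _).symm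

theorem IsMultiexact.comap [Finite ι] {e : ι' ≃ ι} {H : (∀ j, C (e j)) ⥤ D}
    (h : IsMultiexact (fun j => C (e j)) D H) :
    IsMultiexact C D (Pi.comap (fun i => (C i).carrier) e ⋙ H) where
  zero X i hX := by
    obtain ⟨j, rfl⟩ := e.surjective i
    exact h.zero (fun j => X (e j)) j hX
  pushout i _ _ _ _ a b c d sq hc hiso := by
    obtain ⟨j, rfl⟩ := e.surjective i
    exact h.pushout j _ _ _ _ (fun j => sq (e j)) hc fun j' hj => hiso _ (e.injective.ne hj)
  weq f hf := h.weq (fun j => f (e j)) fun j => hf (e j)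
  cof {X Y} f hf := (isGood_iff _).2 <| (good_comap_iff e H f).2 <|
    (isGood_iff _).1 <| h.cof (X := fun j => X (e j)) (Y := fun j => Y (e j)) (fun j => f (e j))
      fun j => hf (e j)

/-- Replaces a tuple over `ι'` by a reindexed tuple over `ι`, so that statements about reindexed
functors can be read backwards without casts. -/
theorem exists_comp_equiv {A : ι → Type*} (e : ι' ≃ ι) (x : ∀ j, A (e j)) :
    ∃ y : ∀ i, A i, (fun j => y (e j)) = x :=
  (Equiv.piCongrLeft A e).symm.surjective x

theorem IsMultiexact.of_comap [Finite ι] {e : ι' ≃ ι} {H : (∀ j, C (e j)) ⥤ D}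
    (h : IsMultiexact C D (Pi.comap (fun i => (C i).carrier) e ⋙ H)) :
    IsMultiexact (fun j => C (e j)) D H where
  zero X j hX := by
    obtain ⟨X, rfl⟩ := exists_comp_equiv (A := fun i => C i) e X
    exact h.zero X (e j) hX
  pushout j A₀ A₁ A₂ A₃ a b c d sq hc hiso := by
    obtain ⟨A₀, rfl⟩ := exists_comp_equiv (A := fun i => C i) e A₀
    obtain ⟨A₁, rfl⟩ := exists_comp_equiv (A := fun i => C i) e A₁
    obtain ⟨A₂, rfl⟩ := exists_comp_equiv (A := fun i => C i) e A₂
    obtain ⟨A₃, rfl⟩ := exists_comp_equiv (A := fun i => C i) e A₃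
    obtain ⟨a, rfl⟩ := exists_comp_equiv (A := fun i => A₀ i ⟶ A₁ i) e a
    obtain ⟨b, rfl⟩ := exists_comp_equiv (A := fun i => A₀ i ⟶ A₂ i) e b
    obtain ⟨c, rfl⟩ := exists_comp_equiv (A := fun i => A₁ i ⟶ A₃ i) e c
    obtain ⟨d, rfl⟩ := exists_comp_equiv (A := fun i => A₂ i ⟶ A₃ i) e d
    refine h.pushout (e j) a b c d (fun i => ?_) hc fun i hi => ?_
    · obtain ⟨j, rfl⟩ := e.surjective i
      exact sq j
    · obtain ⟨j, rfl⟩ := e.surjective i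
      exact hiso j fun h => hi (congrArg e h)
  weq {X Y} f hf := by
    obtain ⟨X, rfl⟩ := exists_comp_equiv (A := fun i => C i) e X
    obtain ⟨Y, rfl⟩ := exists_comp_equiv (A := fun i => C i) e Y
    obtain ⟨f, rfl⟩ := exists_comp_equiv (A := fun i => X i ⟶ Y i) e f
    refine h.weq f fun i => ?_
    obtain ⟨j, rfl⟩ := e.surjective i
    exact hf j
  cof {X Y} f hf := by
    obtain ⟨X, rfl⟩ := exists_comp_equiv (A := fun i => C i) e X
    obtain ⟨Y, rfl⟩ := exists_comp_equiv (A := fun i => C i) e Y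
    obtain ⟨f, rfl⟩ := exists_comp_equiv (A := fun i => X i ⟶ Y i) e f
    refine (isGood_iff _).2 <| (good_comap_iff e H f).1 <| h.good f fun i => ?_
    obtain ⟨j, rfl⟩ := e.surjective i
    exact hf j

theorem comap_actFunctor (e : ι' ≃ ι) (F : (∀ i, C i) ⥤ D) :
    Pi.comap (fun i => (C i).carrier) e ⋙ actFunctor e F = F := by
  change (Pi.comap (fun i => (C i).carrier) e ⋙ permute C e) ⋙ F = F
  rw [comap_permute]
  rfl

theorem IsMultiexact.act [Finite ι] (e : ι' ≃ ι) {F : (∀ i, C i) ⥤ D} (hF : IsMultiexact C D F) :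
    IsMultiexact (fun j => C (e j)) D (actFunctor e F) :=
  IsMultiexact.of_comap (by rwa [comap_actFunctor])

end reindex

section comp

variable {ι : Type} [Finite ι] {J : ι → Type} [∀ i, Finite (J i)]
    {A : (Σ i, J i) → WaldCat.{u}} {B : ι → WaldCat.{u}} {D : WaldCat.{u}}
    {F : (∀ i, B i) ⥤ D} {G : ∀ i, (∀ j, A ⟨i, j⟩) ⥤ B i}

/-- Concatenation of the vertices of cubes. -/
def vertexSigma (J : ι → Type) : PiOrder (fun i => Vertex (J i)) ≃o Vertex (Σ i, J i) where
  toFun x p := x.val p.1 p.2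
  invFun y := ⟨fun i j => y ⟨i, j⟩⟩
  left_inv _ := rfl
  right_inv _ := rfl
  map_rel_iff' {_ _} := ⟨fun h i j => h ⟨i, j⟩, fun h p => h p.1 p.2⟩

theorem isIso_pi {ι : Type} {C : ι → WaldCat.{u}} {X Y : ∀ i, C i} (f : X ⟶ Y)
    (h : ∀ i, IsIso (f i)) : IsIso f :=
  ⟨fun i => inv (f i), funext fun i => IsIso.hom_inv_id (f i),
    funext fun i => IsIso.inv_hom_id (f i)⟩

theorem IsMultiexact.comp (hF : IsMultiexact B D F)
    (hG : ∀ i, IsMultiexact (fun j => A ⟨i, j⟩) (B i) (G i)) :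
    IsMultiexact A D (compFunctor F G) where
  zero X p hX := hF.zero _ p.1 ((hG p.1).zero _ p.2 hX)
  pushout p _ _ _ _ a b c d sq hc hiso := by
    have hiso' : ∀ i, i ≠ p.1 →
        IsIso ((G i).map fun j => a ⟨i, j⟩) ∧ IsIso ((G i).map fun j => b ⟨i, j⟩) := by
      intro i hi
      have h1 : ∀ j, (⟨i, j⟩ : Σ i, J i) ≠ p := fun j h => hi (congrArg Sigma.fst h)
      have h2 := isIso_pi (C := fun j => A ⟨i, j⟩) (fun j => a ⟨i, j⟩) fun j => (hiso _ (h1 j)).1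
      have h3 := isIso_pi (C := fun j => A ⟨i, j⟩) (fun j => b ⟨i, j⟩) fun j => (hiso _ (h1 j)).2
      exact ⟨inferInstance, inferInstance⟩
    -- Within the block containing `p` the other components are isomorphisms, hence cofibrations, so
    -- `G p.1` sends the tuple to a cofibration.
    have hcof : ∀ j, (A ⟨p.1, j⟩).cof (a ⟨p.1, j⟩) := by
      intro j
      by_cases h : (⟨p.1, j⟩ : Σ i, J i) = p
      · have key : ∀ q : (Σ i, J i), q = p → (A q).cof (a q) := by
          rintro _ rfl; exact hc
        exact key _ h
      · have := (hiso _ h).1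
        exact (A _).isWaldhausen.cof_of_isIso _ this
    refine hF.pushout p.1 _ _ _ _ (fun i => ?_) ((hG p.1).map_cof _ hcof) hiso'
    by_cases hi : i = p.1
    · subst hi
      exact (hG p.1).pushout p.2 (fun j => a ⟨p.1, j⟩) (fun j => b ⟨p.1, j⟩)
        (fun j => c ⟨p.1, j⟩) (fun j => d ⟨p.1, j⟩) (fun j => sq _) hc fun j hj =>
          hiso _ fun h => hj (by rw [Sigma.ext_iff] at h; exact eq_of_heq h.2)
    -- In the other blocks `a`, and hence `d`, are isomorphisms, and a commutative square with two
    -- such parallel sides is a pushout.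
    · have hac : (fun j => a ⟨i, j⟩ ≫ c ⟨i, j⟩) = fun j => b ⟨i, j⟩ ≫ d ⟨i, j⟩ :=
        funext fun j => (sq _).w
      obtain ⟨h1, h2⟩ := hiso' i hi
      have hd : ∀ j, IsIso (d ⟨i, j⟩) := fun j => by
        have h3 := (hiso ⟨i, j⟩ fun h => hi (congrArg Sigma.fst h)).1
        exact (sq ⟨i, j⟩).isIso_inr_of_isIso
      have h4 := isIso_pi (C := fun j => A ⟨i, j⟩) (fun j => d ⟨i, j⟩) hd
      have h5 : IsIso ((G i).map (fun j => d ⟨i, j⟩)) := inferInstance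
      refine IsPushout.of_horiz_isIso (f := (G i).map fun j => a ⟨i, j⟩)
        (inr := (G i).map fun j => d ⟨i, j⟩) ⟨?_⟩
      exact ((G i).map_comp _ _).symm.trans ((congrArg (G i).map hac).trans ((G i).map_comp _ _))
  weq f hf := hF.weq _ fun i => (hG i).weq _ fun j => hf _
  cof {X Y} f hf := (isGood_iff _).2 <| by
    -- The cube of the composite is `F` applied to the tuple of good cubes of the `G i`.
    refine (good_iff_of_orderIso D.isWaldhausen (vertexSigma J) (fun _ => Iso.refl _) ?_).1
      (hF.good_prod (X := fun i => boxCube (C := fun j => A ⟨i, j⟩) (X := fun j => X ⟨i, j⟩)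
        (Y := fun j => Y ⟨i, j⟩) (fun j => f ⟨i, j⟩) ⋙ G i)
        fun i => (hG i).good _ fun j => hf _)
    exact fun _ _ _ => (Category.comp_id _).trans (Category.id_comp _).symm

end comp

/-- Multiexact functors are stable under permutation of the variables and under composition. -/
theorem multiexactStable : MultiexactStable.{u} where
  id := isMultiexact_idFunctor
  act e _ hF := hF.act e
  comp _ _ hF hG := hF.comp hG

end stable

open Cyl

/-! ### Evaluation -/

section ev

variable {ι : Type} {C : ι → WaldCat.{u}} {D : WaldCat.{u}}

/-- The value at an object of a pushout square of multiexact functors that is constant up to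
isomorphism and of a pushout square of objects. -/
theorem isPushout_ev_left {F₀ F₁ F₂ F₃ : Multiexact C D} {α : F₀ ⟶ F₁} {β : F₀ ⟶ F₂}
    {γ : F₁ ⟶ F₃} {δ : F₂ ⟶ F₃} (sq' : IsPushout α β γ δ) (hα : IsIso α) (hβ : IsIso β)
    {A₀ A₁ A₂ A₃ : ∀ i, C i} {a : A₀ ⟶ A₁} {b : A₀ ⟶ A₂} {c : A₁ ⟶ A₃} {d : A₂ ⟶ A₃}
    (sq : IsPushout (F₀.obj.map a) (F₀.obj.map b) (F₀.obj.map c) (F₀.obj.map d)) :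
    IsPushout (F₀.obj.map a ≫ α.hom.app A₁) (F₀.obj.map b ≫ β.hom.app A₂)
      (F₁.obj.map c ≫ γ.hom.app A₃) (F₂.obj.map d ≫ δ.hom.app A₃) := by
  have hγ : IsIso γ := sq'.isIso_inl_of_isIso
  have hiso : ∀ {F G : Multiexact C D} (φ : F ⟶ G) (_ : IsIso φ) A, IsIso (φ.hom.app A) :=
    fun φ _ A => inferInstanceAs (IsIso ((evalAt A).map φ))
  have h1 := hiso α hα
  have h2 := hiso β hβ
  have h3 := hiso γ hγ
  have hw : ∀ A, α.hom.app A ≫ γ.hom.app A = β.hom.app A ≫ δ.hom.app A := fun A =>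
    (evalAt A).congr_map sq'.w
  refine sq.of_iso (Iso.refl _) (asIso (α.hom.app A₁)) (asIso (β.hom.app A₂))
    (asIso (α.hom.app A₃) ≪≫ asIso (γ.hom.app A₃)) ?_ ?_ ?_ ?_
  · exact (Category.id_comp _).symm
  · exact (Category.id_comp _).symm
  · simp
  · simp [hw]

/-- Pushouts along cofibrations of multiexact functors are levelwise; the square is isomorphic to
the one at `A₃`, since all object arrows are invertible. -/
theorem isPushout_ev_right [Finite ι] {F₀ F₁ F₂ F₃ : Multiexact C D} {α : F₀ ⟶ F₁} {β : F₀ ⟶ F₂}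
    {γ : F₁ ⟶ F₃} {δ : F₂ ⟶ F₃} (sq : IsPushout α β γ δ) (hα : homCof α)
    {A₀ A₁ A₂ A₃ : ∀ i, C i} {a : A₀ ⟶ A₁} {b : A₀ ⟶ A₂} {c : A₁ ⟶ A₃} {d : A₂ ⟶ A₃}
    (w : a ≫ c = b ≫ d) (ha : IsIso a) (hb : IsIso b) (hc : IsIso c) (hd : IsIso d) :
    IsPushout (F₀.obj.map a ≫ α.hom.app A₁) (F₀.obj.map b ≫ β.hom.app A₂)
      (F₁.obj.map c ≫ γ.hom.app A₃) (F₂.obj.map d ≫ δ.hom.app A₃) := by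
  refine (isPushout_app sq hα A₃).of_iso (asIso (F₀.obj.map (a ≫ c))).symm
    (asIso (F₁.obj.map c)).symm (asIso (F₂.obj.map d)).symm (Iso.refl _) ?_ ?_ ?_ ?_
  · simp
  · simp [w]
  · simp
  · simp

/-- Evaluation is multiexact. -/
theorem isMultiexact_evFunctor [Finite ι] (hW : IsWaldhausen (Multiexact C D) homCof homWeq) :
    IsMultiexact (Sum.elim C (fun _ : Unit => internalHom C D hW)) D (evFunctor C D hW) where
  zero X s hX := by
    let F : Multiexact C D := X (Sum.inr ())
    rcases s with i | ⟨⟩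
    · exact F.property.zero (fun i => X (Sum.inl i)) i hX
    · exact isZero_app (F := F) hX _
  pushout s A₀ A₁ A₂ A₃ a b c d sq hc hiso := by
    have hr : IsPushout (C := Multiexact C D) (a (Sum.inr ())) (b (Sum.inr ())) (c (Sum.inr ()))
      (d (Sum.inr ())) := sq (Sum.inr ())
    rcases s with i | ⟨⟩
    · obtain ⟨h1, h2⟩ := hiso (Sum.inr ()) (by simp)
      refine isPushout_ev_left hr h1 h2 ?_
      let F : Multiexact C D := A₀ (Sum.inr ())
      exact F.property.pushout i (fun i => a (Sum.inl i)) (fun i => b (Sum.inl i))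
        (fun i => c (Sum.inl i)) (fun i => d (Sum.inl i)) (fun i => sq (Sum.inl i)) hc
        fun j hj => hiso _ (by simpa using hj)
    · have hiso' := fun i => hiso (Sum.inl i) (by simp)
      refine isPushout_ev_right hr hc (funext fun i => (sq (Sum.inl i)).w)
        (isIso_pi _ fun i => (hiso' i).1) (isIso_pi _ fun i => (hiso' i).2) (isIso_pi _ fun i => ?_)
        (isIso_pi _ fun i => ?_)
      · have := (hiso' i).2
        exact (sq (Sum.inl i)).isIso_inl_of_isIso
      · have := (hiso' i).1
        exact (sq (Sum.inl i)).isIso_inr_of_isIso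
  weq {X Y} f hf := by
    let F : Multiexact C D := X (Sum.inr ())
    have h1 : homWeq (C := C) (D := D) (f (Sum.inr ())) := hf (Sum.inr ())
    exact D.isWaldhausen.weq_comp (F.property.weq (fun i => f (Sum.inl i)) fun i => hf (Sum.inl i))
      (h1 _)
  cof {X Y} f hf := (isGood_iff _).2 <| by
    let F : Multiexact C D := X (Sum.inr ())
    let G : Multiexact C D := Y (Sum.inr ())
    let α : F ⟶ G := f (Sum.inr ())
    let m : (fun i => X (Sum.inl i) : ∀ i, C i) ⟶ (fun i => Y (Sum.inl i) : ∀ i, C i) :=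
      fun i => f (Sum.inl i)
    have hα : homCof α := hf (Sum.inr ())
    have h := (homCof_iff α).1 hα m fun i => hf (Sum.inl i)
    -- The cube of evaluation at `(m, α)` is the cylinder of `α` on the box of `m`, up to the order
    -- in which its maps are composed.
    refine (good_iff_of_orderIso D.isWaldhausen (cylVertex ι) (fun q => match q with
      | lo x => Iso.refl (F.obj.obj ((boxCube m).obj x))
      | hi x => Iso.refl (G.obj.obj ((boxCube m).obj x))) ?_).1 h
    rintro (x | x) (y | y) h
    · refine (Category.comp_id _).trans (Eq.trans ?_ (Category.id_comp _).symm)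
      exact (Category.comp_id _).symm
    · refine (Category.comp_id _).trans (Eq.trans ?_ (Category.id_comp _).symm)
      exact (α.hom.naturality _).symm
    · exact h.elim
    · refine (Category.comp_id _).trans (Eq.trans ?_ (Category.id_comp _).symm)
      exact (Category.comp_id _).symm

end ev

/-! ### Cubes of cubes -/

section join

variable {ι κ : Type} {D : Type u} [Category.{v} D]

/-- The first coordinates of a vertex. -/
def leftVertex (p : Vertex (ι ⊕ κ)) : Vertex ι := fun i => p (Sum.inl i)

/-- The last coordinates of a vertex. -/
def rightVertex (p : Vertex (ι ⊕ κ)) : Vertex κ := fun k => p (Sum.inr k)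

/-- The concatenation of two vertices. -/
def joinVertex (x : Vertex ι) (y : Vertex κ) : Vertex (ι ⊕ κ) := Sum.elim x y

theorem leftVertex_mono {p q : Vertex (ι ⊕ κ)} (h : p ≤ q) : leftVertex p ≤ leftVertex q :=
  fun i => h (Sum.inl i)

theorem rightVertex_mono {p q : Vertex (ι ⊕ κ)} (h : p ≤ q) : rightVertex p ≤ rightVertex q :=
  fun k => h (Sum.inr k)

theorem le_of_leftVertex_le {p q : Vertex (ι ⊕ κ)} (h : leftVertex p ≤ leftVertex q)
    (h' : rightVertex p ≤ rightVertex q) : p ≤ q :=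
  fun s => Sum.rec h h' s

/-- The cube of cubes `W` as a cube. -/
def joinCube (W : Vertex κ ⥤ Vertex ι ⥤ D) : Vertex (ι ⊕ κ) ⥤ D where
  obj p := (W.obj (rightVertex p)).obj (leftVertex p)
  map {p q} h := (W.obj (rightVertex p)).map (homOfLE (leftVertex_mono (leOfHom h))) ≫
    (W.map (homOfLE (rightVertex_mono (leOfHom h)))).app (leftVertex q)
  map_id p := by
    refine (congrArg₂ (· ≫ ·) (map_homOfLE_self _ _)
      (congrArg (fun z => NatTrans.app z _) (map_homOfLE_self W _))).trans (Category.comp_id _)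
  map_comp {p q r} h h' := by
    rw [← map_comp_app, ← W.map_comp]
    rfl

variable {cof weq : MorphismProperty D} {W : Vertex κ ⥤ Vertex ι ⥤ D}

variable {a' b' : Vertex κ} {L : Vertex ι ⥤ D}

/-- The maps to the cylinder of the southern arrow from the cube of cubes. -/
def joinToCyl (c : ∀ y, a' ≤ y ∧ y < b' → (W.obj y ⟶ L)) (s : L ⟶ W.obj b')
    (p : Vertex (ι ⊕ κ)) : ∀ (q : Cyl (Vertex ι)), leftVertex p ≤ proj q → a' ≤ rightVertex p →
      rightVertex p ≤ b' → (rightVertex p = b' → q = hi (proj q)) →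
      ((joinCube W).obj p ⟶ (cyl s).obj q)
  | lo x, h, h1, h2, h3 => (W.obj (rightVertex p)).map (homOfLE h) ≫
      (c (rightVertex p) ⟨h1, lt_of_le_of_ne h2 fun e => by cases h3 e⟩).app x
  | hi x, h, _, h2, _ => (W.obj (rightVertex p)).map (homOfLE h) ≫
      (W.map (homOfLE h2)).app x

variable {c : ∀ y, a' ≤ y ∧ y < b' → (W.obj y ⟶ L)} {s : L ⟶ W.obj b'}

theorem joinToCyl_comp (hs : ∀ y hy, c y hy ≫ s = W.map (homOfLE hy.2.le))
    {p : Vertex (ι ⊕ κ)} : ∀ (q q' : Cyl (Vertex ι)) (hqq : q ≤ q') (h0 : leftVertex p ≤ proj q)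
    (h1 : a' ≤ rightVertex p) (h2 : rightVertex p ≤ b') (h3 : rightVertex p = b' → q = hi (proj q))
    (h3' : rightVertex p = b' → q' = hi (proj q')),
    joinToCyl c s p q h0 h1 h2 h3 ≫ (cyl s).map (homOfLE hqq) =
      joinToCyl c s p q' (h0.trans (proj_mono hqq)) h1 h2 h3'
  | lo x, lo y, hqq, h0, h1, h2, h3, h3' => by
    refine (Category.assoc _ _ _).trans ?_
    refine (congrArg (_ ≫ ·) ((c _ _).naturality _).symm).trans ?_
    exact (map_homOfLE_comp_assoc _ _ _ _)
  | lo x, hi y, hqq, h0, h1, h2, h3, h3' => by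
    have hp : a' ≤ rightVertex p ∧ rightVertex p < b' :=
      ⟨h1, lt_of_le_of_ne h2 fun e => by cases h3 e⟩
    replace h0 : leftVertex p ≤ x := h0
    change ((W.obj (rightVertex p)).map (homOfLE h0) ≫ (c (rightVertex p) hp).app x) ≫
      s.app x ≫ (W.obj b').map (homOfLE _) = (W.obj (rightVertex p)).map (homOfLE _) ≫
        (W.map (homOfLE h2)).app y
    have e : (c (rightVertex p) hp).app x ≫ s.app x = (W.map (homOfLE h2)).app x :=
      congrArg (fun z => NatTrans.app z x) (hs _ hp)
    rw [Category.assoc, ← Category.assoc ((c (rightVertex p) hp).app x), e,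
      ← (W.map (homOfLE h2)).naturality, map_homOfLE_comp_assoc]
  | hi x, hi y, hqq, h0, h1, h2, h3, h3' => by
    refine (Category.assoc _ _ _).trans ?_
    refine (congrArg (_ ≫ ·) ((W.map _).naturality _).symm).trans ?_
    exact (map_homOfLE_comp_assoc _ _ _ _)

theorem comp_joinToCyl (hc : ∀ y y' (hy : a' ≤ y ∧ y < b') (hy' : a' ≤ y' ∧ y' < b') (h : y ≤ y'),
      W.map (homOfLE h) ≫ c y' hy' = c y hy) {p p' : Vertex (ι ⊕ κ)} (hpp : p ≤ p') :
    ∀ (q : Cyl (Vertex ι)) (h0 : leftVertex p' ≤ proj q)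
    (h1 : a' ≤ rightVertex p) (h1' : a' ≤ rightVertex p') (h2 : rightVertex p' ≤ b')
    (h3 : rightVertex p = b' → q = hi (proj q)) (h3' : rightVertex p' = b' → q = hi (proj q)),
    (joinCube W).map (homOfLE hpp) ≫ joinToCyl c s p' q h0 h1' h2 h3' =
      joinToCyl c s p q ((leftVertex_mono hpp).trans h0) h1 ((rightVertex_mono hpp).trans h2) h3
  | lo x, h0, h1, h1', h2, h3, h3' => by
    have hp' : a' ≤ rightVertex p' ∧ rightVertex p' < b' :=
      ⟨h1', lt_of_le_of_ne h2 fun e => by cases h3' e⟩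
    have hp : a' ≤ rightVertex p ∧ rightVertex p < b' :=
      ⟨h1, (rightVertex_mono hpp).trans_lt hp'.2⟩
    replace h0 : leftVertex p' ≤ x := h0
    change ((W.obj (rightVertex p)).map (homOfLE (leftVertex_mono hpp)) ≫
      (W.map (homOfLE (rightVertex_mono hpp))).app (leftVertex p')) ≫
      (W.obj (rightVertex p')).map (homOfLE h0) ≫ (c (rightVertex p') hp').app x =
      (W.obj (rightVertex p)).map (homOfLE _) ≫ (c (rightVertex p) hp).app x
    rw [← map_comp_app, hc _ _ hp hp']
    rfl
  | hi x, h0, h1, h1', h2, h3, h3' => by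
    replace h0 : leftVertex p' ≤ x := h0
    change ((W.obj (rightVertex p)).map (homOfLE (leftVertex_mono hpp)) ≫
      (W.map (homOfLE (rightVertex_mono hpp))).app (leftVertex p')) ≫
      (W.obj (rightVertex p')).map (homOfLE h0) ≫ (W.map (homOfLE h2)).app x =
      (W.obj (rightVertex p)).map (homOfLE _) ≫ (W.map (homOfLE _)).app x
    rw [← map_comp_app, ← W.map_comp]
    rfl

/-- The southern arrows of a cube of cubes are cofibrations if the cube is good. -/
theorem cofTrans_of_good_joinCube [Finite ι] [Finite κ] (hD : IsWaldhausen D cof weq)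
    (hW : Good cof (joinCube W)) (hab : a' ≤ b')
    (hc : ∀ y y' (hy : a' ≤ y ∧ y < b') (hy' : a' ≤ y' ∧ y' < b') (h : y ≤ y'),
      W.map (homOfLE h) ≫ c y' hy' = c y hy)
    (hL : ∀ x, IsColim (W ⋙ (evaluation _ _).obj x) (fun y => a' ≤ y ∧ y < b') (L.obj x)
      (fun y hy => (c y hy).app x))
    (hs : ∀ y hy, c y hy ≫ s = W.map (homOfLE hy.2.le)) : CofTrans cof s := by
  classical
  refine CofTrans.of_reedy hD fun a => ?_
  -- Vertices over `b'` go to the top copy, all others to the bottom copy. Along `m` the cylinder of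
  -- `s` is a Kan extension of the part of the cube between `a'` and `b'`.
  let m : Vertex (ι ⊕ κ) → Cyl (Vertex ι) := fun p =>
    if rightVertex p = b' then hi (leftVertex p) else lo (leftVertex p)
  have hm : ∀ p, (rightVertex p = b' ∧ m p = hi (leftVertex p)) ∨
      (rightVertex p ≠ b' ∧ m p = lo (leftVertex p)) := fun p => by
    by_cases h : rightVertex p = b'
    · exact Or.inl ⟨h, if_pos h⟩
    · exact Or.inr ⟨h, if_neg h⟩
  have hproj : ∀ p, proj (m p) = leftVertex p := fun p => by
    rcases hm p with h | h <;> rw [h.2] <;> rfl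
  have hle : ∀ p q, rightVertex p ≤ b' → (m p ≤ q ↔ leftVertex p ≤ proj q ∧
      (rightVertex p = b' → q = hi (proj q))) := by
    intro p q hp
    rcases hm p with h | h <;> rw [h.2] <;> rcases q with q | q
    · exact ⟨fun h => h.elim, fun h' => by cases h'.2 h.1⟩
    · exact ⟨fun h => ⟨h, fun _ => rfl⟩, fun h => h.1⟩
    · exact ⟨fun h' => ⟨h', fun e => absurd e h.1⟩, fun h => h.1⟩
    · exact ⟨fun h' => ⟨h', fun _ => rfl⟩, fun h => h.1⟩
  let T : Vertex (ι ⊕ κ) → Prop := fun p => a ≤ leftVertex p ∧ a' ≤ rightVertex p ∧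
    rightVertex p ≤ b'
  let η : ∀ p, T p → ((joinCube W).obj p ⟶ (cyl s).obj (m p)) := fun p hp =>
    joinToCyl c s p (m p) (hproj p).symm.le hp.2.1 hp.2.2 ((hle p (m p) hp.2.2).1 le_rfl).2
  have hη : ∀ p (hp : T p) q (hq : m p ≤ q), η p hp ≫ (cyl s).map (homOfLE hq) =
      joinToCyl c s p q ((hle p q hp.2.2).1 hq).1 hp.2.1 hp.2.2 ((hle p q hp.2.2).1 hq).2 :=
    fun p hp q hq => joinToCyl_comp hs _ _ hq _ _ _ _ _
  have hmono : ∀ p p' : Vertex (ι ⊕ κ), T p' → p ≤ p' → m p ≤ m p' := by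
    intro p p' hp' hpp
    rw [hle p _ ((rightVertex_mono hpp).trans hp'.2.2)]
    refine ⟨(leftVertex_mono hpp).trans (hproj p').symm.le, fun e => ?_⟩
    have e' : rightVertex p' = b' := le_antisymm hp'.2.2 (e.symm.le.trans (rightVertex_mono hpp))
    exact ((hle p' (m p') hp'.2.2).1 le_rfl).2 e'
  refine IsKan.reedy (Y := joinCube W) (m := m) (T := T) (η := η) hD ⟨?_, ?_, ?_, ?_⟩
    ((hW (joinVertex a a')).subset ?_ ?_)
  · exact fun p p' _ hp' hpp => hmono p p' hp' hpp
  · intro p hp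
    rcases hm p with h | h <;> rw [h.2] <;> exact hp.1
  · intro p p' hp hp' hpp
    rw [hη p hp]
    exact comp_joinToCyl hc hpp _ _ _ _ _ _ _
  · intro q hq
    refine IsColim.congr_map (c := fun p hp => joinToCyl c s p q ((hle p q hp.1.2.2).1 hp.2).1
      hp.1.2.1 hp.1.2.2 ((hle p q hp.1.2.2).1 hp.2).2) ?_ fun p hp => (hη p hp.1 q hp.2).symm
    rcases q with x | x
    -- Over `lo x` the index set maps to the interval from `a'` to `b'` without `b'`; a second Kan
    -- extension, along `rightVertex`, reduces to the levelwise colimit `hL x`.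
    · replace hq : a ≤ x := hq
      have hset : ∀ p, T p ∧ m p ≤ lo x → a' ≤ rightVertex p ∧ rightVertex p < b' := fun p hp =>
        ⟨hp.1.2.1, lt_of_le_of_ne hp.1.2.2 fun e => by
          have h1 := ((hle p _ hp.1.2.2).1 hp.2).2 e
          cases h1⟩
      have hK : IsKan (joinCube W) (W ⋙ (evaluation _ _).obj x) rightVertex
          (fun p => T p ∧ m p ≤ lo x) (fun y => a' ≤ y ∧ y < b') (fun p hp =>
            (W.obj (rightVertex p)).map (homOfLE (((hle p _ hp.1.2.2).1 hp.2).1))) := by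
        refine IsKan.of_top (fun p p' _ _ h => rightVertex_mono h) hset ?_ ?_
        · intro p p' hp hp' hpp
          have h1 : leftVertex p' ≤ x := ((hle p' _ hp'.1.2.2).1 hp'.2).1
          refine (Category.assoc _ _ _).trans ((congrArg (_ ≫ ·)
            ((W.map (homOfLE (rightVertex_mono hpp))).naturality (homOfLE h1)).symm).trans ?_)
          exact map_homOfLE_comp_assoc (W.obj (rightVertex p)) (leftVertex_mono hpp) h1 _
        · intro y hy
          refine ⟨joinVertex x y, ⟨⟨hq, hy.1, hy.2.le⟩, ?_⟩, le_rfl, ?_, ?_⟩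
          · exact (hle (joinVertex x y) _ hy.2.le).2 ⟨le_rfl, fun e => absurd e hy.2.ne⟩
          · exact fun p hp hpy => le_of_leftVertex_le ((hle p _ hp.1.2.2).1 hp.2).1 hpy
          · have h1 : IsIso ((W.obj y).map (homOfLE (le_refl x))) := by
              rw [map_homOfLE_self]; infer_instance
            have h2 : IsIso ((W ⋙ (evaluation _ _).obj x).map (homOfLE (le_refl y))) := by
              rw [map_homOfLE_self]; infer_instance
            exact @IsIso.comp_isIso _ _ _ _ _ _ _ h1 h2
      exact hK.isColim (hL x)
    -- Over `hi x` the index set has the greatest element `joinVertex x b'`.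
    · have hx : T (joinVertex x b') ∧ m (joinVertex x b') ≤ hi x :=
        ⟨⟨hq, hab, le_rfl⟩, (hle (joinVertex x b') (hi x) le_rfl).2 ⟨le_rfl, fun _ => rfl⟩⟩
      refine isColim_of_top_iso (Y := joinCube W) (T := fun p => T p ∧ m p ≤ hi x) hx
        (fun p hp => le_of_leftVertex_le ((hle p _ hp.1.2.2).1 hp.2).1 hp.1.2.2)
        (fun p p' hp hp' hpp => comp_joinToCyl hc hpp _ _ _ _ _ _ _) ?_
      have h1 : IsIso ((W.obj b').map (homOfLE (le_refl x))) := by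
        rw [map_homOfLE_self]; infer_instance
      have h2 : IsIso ((W.map (homOfLE (le_refl b'))).app x) := by
        rw [map_homOfLE_self]
        exact inferInstanceAs (IsIso (𝟙 _))
      exact @IsIso.comp_isIso _ _ _ _ _ _ _ h1 h2
  · exact fun p hp => le_of_leftVertex_le hp.1 hp.2.1
  · exact fun p hp p' hp' hpp => ⟨leftVertex_mono hp, rightVertex_mono hp,
      (rightVertex_mono hpp).trans hp'.2.2⟩

end join

open Cyl

/-! ### Currying -/

section uncurry

variable {ι κ : Type} {D : WaldCat.{u}}

/-- The values `K (E₂ X) (E₁ X)` of a functor `K` to multiexact functors. -/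
def uncurry₂ {C : ι → WaldCat.{u}} {A B : Type*} [Category* A] [Category* B]
    (E₁ : A ⥤ ∀ i, C i) (E₂ : A ⥤ B) (K : B ⥤ Multiexact C D) : A ⥤ D where
  obj X := (K.obj (E₂.obj X)).obj.obj (E₁.obj X)
  map {X Y} f := (K.obj (E₂.obj X)).obj.map (E₁.map f) ≫ (K.map (E₂.map f)).hom.app (E₁.obj Y)
  map_id X := by simp
  map_comp f g := by
    rw [E₁.map_comp, E₂.map_comp, K.map_comp]
    exact map_comp_app _ _ _ _

variable {C : ι ⊕ κ → WaldCat.{u}}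

/-- The functor of the variables in `ι ⊕ κ` given by a functor from `∏ C (inr k)` to multiexact
functors on `∏ C (inl i)`. -/
def uncurryHom (K : (∀ k, C (Sum.inr k)) ⥤ Multiexact (fun i => C (Sum.inl i)) D) :
    (∀ s, C s) ⥤ D :=
  uncurry₂ (C := fun i => C (Sum.inl i)) (Pi.comap (fun s => (C s).carrier) Sum.inl)
    (Pi.comap (fun s => (C s).carrier) Sum.inr) K

/-- The concatenation of two tuples of objects. -/
def pairObj (X : ∀ i, C (Sum.inl i)) (Y : ∀ k, C (Sum.inr k)) : ∀ s, C s
  | Sum.inl i => X i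
  | Sum.inr k => Y k

/-- The concatenation of two tuples of morphisms. -/
def pairHom {X X' : ∀ i, C (Sum.inl i)} {Y Y' : ∀ k, C (Sum.inr k)} (f : X ⟶ X') (g : Y ⟶ Y') :
    pairObj X Y ⟶ pairObj X' Y' := fun s =>
  match s with
  | Sum.inl i => f i
  | Sum.inr k => g k

theorem pairHom_id (X : ∀ i, C (Sum.inl i)) (Y : ∀ k, C (Sum.inr k)) :
    pairHom (𝟙 X) (𝟙 Y) = 𝟙 (pairObj X Y) := by
  funext s
  rcases s with i | k <;> rfl

theorem pairHom_comp {X X' X'' : ∀ i, C (Sum.inl i)} {Y Y' Y'' : ∀ k, C (Sum.inr k)}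
    (f : X ⟶ X') (g : Y ⟶ Y') (f' : X' ⟶ X'') (g' : Y' ⟶ Y'') :
    pairHom f g ≫ pairHom f' g' = pairHom (f ≫ f') (g ≫ g') := by
  funext s
  rcases s with i | k <;> rfl

variable {K : (∀ k, C (Sum.inr k)) ⥤ Multiexact (fun i => C (Sum.inl i)) D}

theorem uncurryHom_map_pairHom_id (X : ∀ i, C (Sum.inl i)) {Y Y' : ∀ k, C (Sum.inr k)}
    (g : Y ⟶ Y') : (uncurryHom K).map (pairHom (𝟙 X) g) = (K.map g).hom.app X :=
  (congrArg (· ≫ (K.map g).hom.app X) ((K.obj Y).obj.map_id X)).trans (Category.id_comp _)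

/-- A functor to multiexact functors is multiexact if it is multiexact as a functor of all
variables. -/
theorem isMultiexact_of_uncurryHom [Finite ι] [Finite κ]
    (hW : IsWaldhausen (Multiexact (fun i => C (Sum.inl i)) D) homCof homWeq)
    (h : IsMultiexact C D (uncurryHom K)) :
    IsMultiexact (fun k => C (Sum.inr k)) (internalHom (fun i => C (Sum.inl i)) D hW) K where
  zero Y k hY := isZero_of_app fun X => h.zero (pairObj X Y) (Sum.inr k) hY
  pushout k A₀ A₁ A₂ A₃ a b c d sq hc hiso := isPushout_of_app fun X => by
    rw [← uncurryHom_map_pairHom_id, ← uncurryHom_map_pairHom_id, ← uncurryHom_map_pairHom_id,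
      ← uncurryHom_map_pairHom_id]
    refine h.pushout (Sum.inr k) _ _ _ _ ?_ hc ?_
    · rintro (i | k)
      · exact IsPushout.of_id_fst (f := 𝟙 (X i))
      · exact sq k
    · rintro (i | k') hk
      · exact ⟨inferInstanceAs (IsIso (𝟙 (X i))), inferInstanceAs (IsIso (𝟙 (X i)))⟩
      · exact hiso k' (by simpa using hk)
  weq g hg X := by
    rw [← uncurryHom_map_pairHom_id]
    refine h.weq _ ?_
    rintro (i | k)
    · exact (C (Sum.inl i)).isWaldhausen.weq_id (X i)
    · exact hg k
  cof {A B} g hg := (isGood_iff _).2 <| by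
    intro a' b' hab
    induction b' using WellFoundedLT.induction with
    | ind b' ih =>
    -- By induction the latching maps below `b'` are cofibrations of multiexact functors, so the
    -- latching object `L` exists in the category of multiexact functors.
    have hR : Reedy homCof (boxCube g ⋙ K) (fun y => a' ≤ y ∧ y < b') := fun y hy =>
      (ih y hy.2 hy.1).congr fun z hz => ⟨fun h => ⟨h, hz.trans hy.2⟩, And.left⟩
    obtain ⟨L, c, hc⟩ := hR.exists_isColim hW
    obtain ⟨s, hs⟩ := hc.exists_desc _ (fun y hy => (boxCube g ⋙ K).map (homOfLE hy.2.le))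
      fun p q hp hq hpq => map_homOfLE_comp _ _ _
    refine ⟨L, c, hc, s, hs, (homCof_iff s).2 fun {X Y} f hf => ?_⟩
    -- Restriction to the box of `f`. It turns `[g]_K` into a cube of cubes whose joined cube is
    -- that of the uncurried functor; `L` remains a colimit at each vertex because evaluation
    -- preserves Reedy colimits.
    let Φ : Multiexact (fun i => C (Sum.inl i)) D ⥤ Vertex ι ⥤ D :=
      ObjectProperty.ι _ ⋙ (Functor.whiskeringLeft _ _ D.carrier).obj (boxCube f)
    refine cofTrans_of_good_joinCube (W := (boxCube g ⋙ K) ⋙ Φ) (L := boxCube f ⋙ L.obj) (a' := a') (b' := b')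
      (c := fun y hy => Functor.whiskerLeft (boxCube f) (c y hy).hom) D.isWaldhausen ?_ hab ?_ ?_ ?_
    · refine (good_iff_of_iso D.isWaldhausen (NatIso.ofComponents (fun _ => Iso.refl _)
        fun _ => (Category.comp_id _).trans (Category.id_comp _).symm)).1 (h.good (pairHom f g) ?_)
      rintro (i | k)
      · exact hf i
      · exact hg k
    · exact fun y y' hy hy' hyy => Φ.congr_map (hc.w y y' hy hy' hyy)
    · exact fun x => (preservesCof_evalAt ((boxCube f).obj x)).isColim hW hR hc
    · exact fun y hy => Φ.congr_map (hs y hy)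

/-- The functor adding a constant tuple of objects. -/
def pairLeft (A : ∀ k, C (Sum.inr k)) : (∀ i, C (Sum.inl i)) ⥤ ∀ s, C s where
  obj X := pairObj X A
  map f := pairHom f (𝟙 A)
  map_id X := pairHom_id X A
  map_comp f g := by rw [pairHom_comp, Category.comp_id]

/-- The values of the constant functor on the arrow category. -/
def constArrowIso {A : Type*} [Category* A] (X : A) :
    ∀ ε : Fin 2, (ComposableArrows.mk₁ (𝟙 X)).obj ε ≅ X
  | 0 => Iso.refl X
  | 1 => Iso.refl X

theorem constArrowIso_naturality {A : Type*} [Category* A] (X : A) :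
    ∀ (ε ε' : Fin 2) (h : ε ≤ ε'), (ComposableArrows.mk₁ (𝟙 X)).map (homOfLE h) ≫
      (constArrowIso X ε').hom = (constArrowIso X ε).hom
  | 0, 0, _ => Category.comp_id _
  | 0, 1, _ => Category.comp_id _
  | 1, 1, _ => Category.comp_id _
  | 1, 0, h => absurd h (by decide)

variable {F : (∀ s, C s) ⥤ D}

/-- For goodness, adjoin the identities of `A` to `f`: the cube with the variables `A` fixed is the
Kan extension, along `leftVertex`, of the face of the larger good cube on which the coordinates in
`κ` are `0`. -/
theorem IsMultiexact.pairLeft [Finite ι] [Finite κ] (hF : IsMultiexact C D F) (A : ∀ k, C (Sum.inr k)) :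
    IsMultiexact (fun i => C (Sum.inl i)) D (pairLeft A ⋙ F) where
  zero X i hX := hF.zero (pairObj X A) (Sum.inl i) hX
  pushout i _ _ _ _ a b c d sq hc hiso := by
    refine hF.pushout (Sum.inl i) _ _ _ _ ?_ hc ?_
    · rintro (i | k)
      · exact sq i
      · exact IsPushout.of_id_fst (f := 𝟙 (A k))
    · rintro (i' | k) hi
      · exact hiso i' (by simpa using hi)
      · exact ⟨inferInstanceAs (IsIso (𝟙 (A k))), inferInstanceAs (IsIso (𝟙 (A k)))⟩
  weq f hf := by
    refine hF.weq _ ?_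
    rintro (i | k)
    · exact hf i
    · exact (C (Sum.inr k)).isWaldhausen.weq_id (A k)
  cof {X Y} f hf := (isGood_iff _).2 <| by
    intro a
    have h := hF.good (pairHom f (𝟙 A)) (by
      rintro (i | k)
      · exact hf i
      · exact (C (Sum.inr k)).isWaldhausen.cof_id (A k))
    let z : Vertex κ := fun _ => 0
    let η : ∀ p : Vertex (ι ⊕ κ), (boxCube (pairHom f (𝟙 A))).obj p ⟶
        (boxCube f ⋙ Waldhausen.pairLeft A).obj (leftVertex p) := fun p s => match s with
      | Sum.inl i => 𝟙 ((boxCube f).obj (leftVertex p) i)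
      | Sum.inr k => (constArrowIso (A k) (p (Sum.inr k))).hom
    have hη : ∀ p, IsIso (η p) := fun p => isIso_pi _ fun s => by
      rcases s with i | k
      · exact inferInstanceAs (IsIso (𝟙 _))
      · exact inferInstanceAs (IsIso (constArrowIso (A k) (p (Sum.inr k))).hom)
    have hK : IsKan (boxCube (pairHom f (𝟙 A)) ⋙ F) (boxCube f ⋙ Waldhausen.pairLeft A ⋙ F)
        leftVertex (fun p => a ≤ leftVertex p ∧ rightVertex p ≤ z) (a ≤ ·)
        (fun p _ => F.map (η p)) := by
      refine IsKan.of_top (fun p q _ _ h => leftVertex_mono h) (fun p hp => hp.1) ?_ ?_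
      · intro p q _ _ hpq
        refine (F.map_comp _ _).symm.trans (Eq.trans ?_ (F.map_comp _ _))
        refine congrArg F.map (funext fun s => ?_)
        rcases s with i | k
        · exact (Category.comp_id _).trans (Category.id_comp _).symm
        · refine Eq.trans ?_ (Category.comp_id _).symm
          exact constArrowIso_naturality (A k) _ _ (hpq (Sum.inr k))
      · intro x hx
        refine ⟨joinVertex x z, ⟨hx, le_rfl⟩, le_rfl,
          fun p hp hpx => le_of_leftVertex_le hpx hp.2, ?_⟩
        have h1 := hη (joinVertex x z)
        have h2 : IsIso ((boxCube f ⋙ Waldhausen.pairLeft A ⋙ F).map (homOfLE (le_refl x))) := by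
          rw [map_homOfLE_self]; infer_instance
        exact @IsIso.comp_isIso _ _ _ _ _ _ _ (inferInstanceAs (IsIso (F.map _))) h2
    refine hK.reedy D.isWaldhausen ((h (joinVertex a z)).subset ?_ ?_)
    · exact fun p hp => le_of_leftVertex_le hp.1 fun k => Fin.zero_le _
    · exact fun p hp q hq hpq => ⟨leftVertex_mono hp, (rightVertex_mono hpq).trans hq.2⟩

/-- The functor to multiexact functors given by a multiexact functor of all variables. -/
def curryHom [Finite ι] [Finite κ] (hF : IsMultiexact C D F) :
    (∀ k, C (Sum.inr k)) ⥤ Multiexact (fun i => C (Sum.inl i)) D where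
  obj A := ⟨pairLeft A ⋙ F, hF.pairLeft A⟩
  map {A B} g := ObjectProperty.homMk
    { app := fun X => F.map (pairHom (𝟙 X) g)
      naturality := fun X Y f => by
        change F.map (pairHom f (𝟙 A)) ≫ F.map (pairHom (𝟙 Y) g) =
          F.map (pairHom (𝟙 X) g) ≫ F.map (pairHom f (𝟙 B))
        rw [← F.map_comp, ← F.map_comp, pairHom_comp, pairHom_comp]
        simp }
  map_id A := ObjectProperty.hom_ext _ (NatTrans.ext (funext fun X => by
    refine (congrArg F.map (pairHom_id X A)).trans ?_
    exact F.map_id _))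
  map_comp {A B B'} g g' := ObjectProperty.hom_ext _ (NatTrans.ext (funext fun X => by
    change F.map (pairHom (𝟙 X) (g ≫ g')) = F.map (pairHom (𝟙 X) g) ≫ F.map (pairHom (𝟙 X) g')
    rw [← F.map_comp, pairHom_comp, Category.comp_id]))

/-- Splitting a tuple and pairing it again is the identity only after a case distinction on the
index, so this functor `J` is isolated and shown to be `𝟭 _`. -/
theorem uncurryHom_curryHom [Finite ι] [Finite κ] (hF : IsMultiexact C D F) :
    uncurryHom (curryHom hF) = F := by
  let J : (∀ s, C s) ⥤ ∀ s, C s :=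
    { obj := fun X => pairObj (fun i => X (Sum.inl i)) fun k => X (Sum.inr k)
      map := fun f => pairHom (fun i => f (Sum.inl i)) fun k => f (Sum.inr k)
      map_id := fun X => pairHom_id _ _
      map_comp := fun f g => (pairHom_comp _ _ _ _).symm }
  have hJ : J = 𝟭 _ := Functor.pi_ext _ _ fun s => by rcases s with i | k <;> rfl
  have h : uncurryHom (curryHom hF) = J ⋙ F :=
    Functor.hext (fun _ => rfl) fun X Y f => heq_of_eq <| by
      refine (F.map_comp _ _).symm.trans (congrArg F.map ?_)
      refine (pairHom_comp _ _ _ _).trans ?_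
      exact congrArg₂ pairHom (Category.comp_id _) (Category.id_comp _)
  rw [h, hJ]
  rfl

theorem eqToHom_hom_app {ι : Type} {C : ι → WaldCat.{u}} {F G : Multiexact C D} (h : F = G)
    (X : ∀ i, C i) : (eqToHom h).hom.app X = eqToHom (congrArg (fun F => F.obj.obj X) h) := by
  subst h; rfl

theorem curryHom_uncurryHom [Finite ι] [Finite κ] (h : IsMultiexact C D (uncurryHom K)) :
    curryHom h = K := by
  refine CategoryTheory.Functor.ext (fun A => ObjectProperty.FullSubcategory.ext ?_) fun A B g => ?_
  · refine Functor.hext (fun _ => rfl) fun X Y f => heq_of_eq ?_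
    refine (congrArg (fun z => _ ≫ z.hom.app Y) (K.map_id A)).trans ?_
    exact Category.comp_id _
  · refine ObjectProperty.hom_ext _ (NatTrans.ext (funext fun X => ?_))
    refine (uncurryHom_map_pairHom_id X g).trans ?_
    rw [ObjectProperty.FullSubcategory.comp_hom, ObjectProperty.FullSubcategory.comp_hom,
      NatTrans.comp_app, NatTrans.comp_app, eqToHom_hom_app, eqToHom_hom_app]
    refine Eq.trans ?_ (Category.id_comp _).symm
    exact (Category.comp_id _).symm

end uncurry

open Cyl

/-! ### Action on internal homs, composition, and the multicategory laws -/

section closed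

section uncurry

variable {ι κ : Type} {C : ι ⊕ κ → WaldCat.{u}} {D : WaldCat.{u}}

/-- Functors with values in multiexact functors, composed with evaluation. -/
def evComp (hW : IsWaldhausen (Multiexact (fun i => C (Sum.inl i)) D) homCof homWeq)
    (K : (∀ k, C (Sum.inr k)) ⥤ internalHom (fun i => C (Sum.inl i)) D hW) :
    (∀ p, C (evInputsEquiv ι κ p)) ⥤ D :=
  compFunctor (J := EvInputs ι κ) (A := fun p => C (evInputsEquiv ι κ p))
    (evFunctor (fun i => C (Sum.inl i)) D hW) fun s => match s with
      | Sum.inl i => idFunctor (C (Sum.inl i))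
      | Sum.inr _ => K

/-- This definitional equality is how the uncurried functor inherits multiexactness from evaluation
and composition. -/
theorem comap_evComp (hW : IsWaldhausen (Multiexact (fun i => C (Sum.inl i)) D) homCof homWeq)
    (K : (∀ k, C (Sum.inr k)) ⥤ internalHom (fun i => C (Sum.inl i)) D hW) :
    Pi.comap (fun s => (C s).carrier) (evInputsEquiv ι κ) ⋙ evComp hW K = uncurryHom K := rfl

theorem isMultiexact_uncurryHom [Finite ι] [Finite κ]
    (hW : IsWaldhausen (Multiexact (fun i => C (Sum.inl i)) D) homCof homWeq)
    {K : (∀ k, C (Sum.inr k)) ⥤ Multiexact (fun i => C (Sum.inl i)) D}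
    (hK : IsMultiexact (fun k => C (Sum.inr k)) (internalHom (fun i => C (Sum.inl i)) D hW) K) :
    IsMultiexact C D (uncurryHom K) := by
  have : Finite (Σ s, EvInputs ι κ s) := Finite.of_equiv _ (evInputsEquiv ι κ).symm
  rw [← comap_evComp hW K]
  refine IsMultiexact.comap (IsMultiexact.comp (isMultiexact_evFunctor hW) fun s => ?_)
  rcases s with i | ⟨⟩
  · exact isMultiexact_idFunctor (C (Sum.inl i))
  · exact hK

end uncurry

section homAct

variable {ι ι' : Type} [Finite ι] [Finite ι'] (C : ι → WaldCat.{u}) (D : WaldCat.{u})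

/-- The uncurried functor becomes evaluation once its object variables are reindexed along `e`, so
multiexactness descends through `isMultiexact_of_uncurryHom`. -/
theorem isMultiexact_homActFunctor (h : MultiexactStable.{u})
    (hW : IsWaldhausen (Multiexact C D) homCof homWeq) (e : ι' ≃ ι)
    (hW' : IsWaldhausen (Multiexact (fun j => C (e j)) D) homCof homWeq) :
    IsMultiexact (fun _ : Unit => internalHom C D hW) (internalHom (fun j => C (e j)) D hW')
      (homActFunctor h C D e) := by
  let C' : ι ⊕ Unit → WaldCat.{u} := Sum.elim C fun _ => internalHom C D hW
  have key : Pi.comap (fun s => (C' s).carrier) (Equiv.sumCongr e (Equiv.refl Unit)) ⋙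
      uncurryHom (C := fun s => C' (Equiv.sumCongr e (Equiv.refl Unit) s))
        (homActFunctor h C D e) = evFunctor C D hW :=
    congrArg (fun E => uncurry₂ (C := C) (Pi.comap (fun s => (C' s).carrier) Sum.inl ⋙ E)
      (Pi.eval (fun s => (C' s).carrier) (Sum.inr ())) (𝟭 (Multiexact C D))) (comap_permute C e)
  refine isMultiexact_of_uncurryHom
    (C := fun s => C' (Equiv.sumCongr e (Equiv.refl Unit) s)) hW' (IsMultiexact.of_comap ?_)
  rw [key]
  exact isMultiexact_evFunctor hW

end homAct

section composition

variable {ι : Type} [Finite ι] {J : ι → Type} [∀ i, Finite (J i)]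

/-- The inputs of `ev ∘ (ev, …, ev, 1)`. -/
def CompInputs (J : ι → Type) : ι ⊕ Unit → Type
  | Sum.inl i => J i ⊕ Unit
  | Sum.inr _ => Unit

instance : ∀ s, Finite (CompInputs J s)
  | Sum.inl i => inferInstanceAs (Finite (J i ⊕ Unit))
  | Sum.inr _ => inferInstanceAs (Finite Unit)

/-- The inputs of `ev ∘ (ev, …, ev, 1)`, separated into objects and functors. -/
def compInputsEquiv (J : ι → Type) : (Σ s, CompInputs J s) ≃ (Σ i, J i) ⊕ (Unit ⊕ ι) where
  toFun
    | ⟨Sum.inl i, Sum.inl j⟩ => Sum.inl ⟨i, j⟩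
    | ⟨Sum.inl i, Sum.inr _⟩ => Sum.inr (Sum.inr i)
    | ⟨Sum.inr _, _⟩ => Sum.inr (Sum.inl ())
  invFun
    | Sum.inl p => ⟨Sum.inl p.1, Sum.inl p.2⟩
    | Sum.inr (Sum.inr i) => ⟨Sum.inl i, Sum.inr ()⟩
    | Sum.inr (Sum.inl _) => ⟨Sum.inr (), ()⟩
  left_inv := by rintro ⟨_ | _, _ | _⟩ <;> rfl
  right_inv := by rintro (_ | _ | _) <;> rfl

/-- Uncurried, `(F, G, X) ↦ F (G 1 (X 1), …)` is `ev ∘ (ev, …, ev, 1)` with its inputs regrouped. -/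
theorem isMultiexact_compositionFunctor (h : MultiexactStable.{u})
    (hW : ∀ {ι : Type} [Finite ι] (C : ι → WaldCat.{u}) (D : WaldCat.{u}),
      IsWaldhausen (Multiexact C D) homCof homWeq)
    (A : (Σ i, J i) → WaldCat.{u}) (B : ι → WaldCat.{u}) (D : WaldCat.{u}) :
    IsMultiexact (Sum.elim (fun _ : Unit => internalHom B D (hW B D))
        (fun i => internalHom (fun j => A ⟨i, j⟩) (B i) (hW _ (B i))))
      (internalHom A D (hW A D)) (compositionFunctor h hW A B D) := by
  let C : (Σ i, J i) ⊕ (Unit ⊕ ι) → WaldCat.{u} :=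
    Sum.elim A (Sum.elim (fun _ : Unit => internalHom B D (hW B D))
        (fun i => internalHom (fun j => A ⟨i, j⟩) (B i) (hW _ (B i))))
  let C' : (Σ s, CompInputs J s) → WaldCat.{u} := fun p => C (compInputsEquiv J p)
  let G : ∀ s : ι ⊕ Unit, (∀ j, C' ⟨s, j⟩) ⥤
      (Sum.elim B (fun _ : Unit => internalHom B D (hW B D)) s : WaldCat.{u}) := fun s =>
    match s with
    -- Inner evaluation, written as the uncurried identity so that its inputs are indexed directly
    -- by `J i ⊕ Unit`.
    | Sum.inl i => uncurryHom (ι := J i) (κ := Unit) (C := fun j => C' ⟨Sum.inl i, j⟩) (D := B i)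
        (idFunctor (internalHom (fun j => A ⟨i, j⟩) (B i) (hW _ (B i))))
    | Sum.inr _ => idFunctor (internalHom B D (hW B D))
  have hG : ∀ s, IsMultiexact (fun j => C' ⟨s, j⟩) _ (G s) := by
    rintro (i | ⟨⟩)
    · exact isMultiexact_uncurryHom (ι := J i) (κ := Unit) (C := fun j => C' ⟨Sum.inl i, j⟩)
        (hW _ _) (isMultiexact_idFunctor _)
    · exact isMultiexact_idFunctor _
  have key : uncurryHom (C := C) (compositionFunctor h hW A B D) =
      Pi.comap (fun s => (C s).carrier) (compInputsEquiv J) ⋙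
        compFunctor (A := C') (evFunctor B D (hW B D)) G :=
    Functor.hext (fun _ => rfl) fun X Y f => heq_of_eq <| by
      let F : Multiexact B D := X (Sum.inr (Sum.inl ()))
      let F' : Multiexact B D := Y (Sum.inr (Sum.inl ()))
      let α : F ⟶ F' := f (Sum.inr (Sum.inl ()))
      -- The horizontal composite applies `α` before the image of the inner transformations,
      -- evaluation applies it last; naturality of `α` exchanges them.
      refine Eq.trans (congrArg (F.obj.map _ ≫ ·) (α.hom.naturality _).symm) ?_
      refine (Category.assoc _ _ _).symm.trans (congrArg (· ≫ α.hom.app _) ?_)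
      exact (F.obj.map_comp _ _).symm
  have : Finite (Σ s, CompInputs J s) := inferInstance
  refine isMultiexact_of_uncurryHom (C := C) (hW A D) ?_
  rw [key]
  exact IsMultiexact.comap (IsMultiexact.comp (isMultiexact_evFunctor (hW B D)) hG)

end composition

section symmetric

variable {ι : Type} {D : WaldCat.{u}}

theorem actFunctor_actFunctor {ι' ι'' : Type} {C : ι → WaldCat.{u}} (e : ι' ≃ ι) (e' : ι'' ≃ ι')
    (F : (∀ i, C i) ⥤ D) : actFunctor e' (actFunctor e F) = actFunctor (e'.trans e) F :=
  eq_actFunctor (e := e'.trans e) <| by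
    change Pi.comap (fun i => (C i).carrier) e ⋙ Pi.comap (fun j => (C (e j)).carrier) e' ⋙
      actFunctor e' (actFunctor e F) = F
    rw [comap_actFunctor, comap_actFunctor]

theorem compFunctor_actFunctor_left {ι' : Type} {J : ι → Type} {A : (Σ i, J i) → WaldCat.{u}}
    {B : ι → WaldCat.{u}} (e : ι' ≃ ι) (F : (∀ i, B i) ⥤ D)
    (G : ∀ i, (∀ j, A ⟨i, j⟩) ⥤ B i) :
    compFunctor (A := fun p : (Σ i', J (e i')) => A ⟨e p.1, p.2⟩) (actFunctor e F)
      (fun i' => G (e i')) = actFunctor (Equiv.sigmaCongrLeft e) (compFunctor F G) :=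
  eq_actFunctor (e := Equiv.sigmaCongrLeft e) <| by
    change Functor.pi' (fun i => Pi.comap (fun p => (A p).carrier) (Sigma.mk i) ⋙ G i) ⋙
      Pi.comap (fun i => (B i).carrier) e ⋙ actFunctor e F = _
    rw [comap_actFunctor]
    rfl

theorem compFunctor_actFunctor_right {J J' : ι → Type} {A : (Σ i, J i) → WaldCat.{u}}
    {B : ι → WaldCat.{u}} (e : ∀ i, J' i ≃ J i) (F : (∀ i, B i) ⥤ D)
    (G : ∀ i, (∀ j, A ⟨i, j⟩) ⥤ B i) :
    compFunctor (A := fun p : (Σ i, J' i) => A ⟨p.1, e p.1 p.2⟩) F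
      (fun i => actFunctor (C := fun j => A ⟨i, j⟩) (e i) (G i)) =
      actFunctor (Equiv.sigmaCongrRight e) (compFunctor F G) :=
  eq_actFunctor (e := Equiv.sigmaCongrRight e) <| by
    have key : (fun i => Pi.comap (fun p => (A p).carrier) (Sigma.mk i) ⋙
      Pi.comap (fun j => (A ⟨i, j⟩).carrier) (e i) ⋙
        actFunctor (C := fun j => A ⟨i, j⟩) (e i) (G i)) =
      fun i => Pi.comap (fun p => (A p).carrier) (Sigma.mk i) ⋙ G i := funext fun i => by
        rw [comap_actFunctor]
    exact congrArg (fun H => Functor.pi' H ⋙ F) key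

variable (h : MultiexactStable.{u})

theorem multiexact_ext {C : ι → WaldCat.{u}} {F G : Multiexact C D} (e : F.obj = G.obj) : F = G :=
  ObjectProperty.FullSubcategory.ext e

/-- Waldhausen categories and multiexact functors form a symmetric multicategory. -/
theorem isSymmetricMulticategory_waldMulti : IsSymmetricMulticategory (waldMulti h) where
  act_refl _ := multiexact_ext (eq_actFunctor (e := Equiv.refl _) rfl).symm
  act_act e e' f := multiexact_ext (actFunctor_actFunctor e e' f.obj)
  one_comp _ := multiexact_ext (eq_actFunctor (e := unitSigma _) rfl)
  comp_one _ := multiexact_ext (eq_actFunctor (e := sigmaUnit _) rfl)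
  assoc _ _ _ := multiexact_ext (eq_actFunctor (e := Equiv.sigmaAssoc _) rfl)
  act_comp e f g := multiexact_ext (compFunctor_actFunctor_left e f.obj fun i => (g i).obj)
  comp_act e f g := multiexact_ext (compFunctor_actFunctor_right e f.obj fun i => (g i).obj)

end symmetric

end closed

open Cyl

/-! ### Closedness -/

section closedMulticategory

variable {ι : Type} {D : WaldCat.{u}}

theorem permute_refl (C : ι → WaldCat.{u}) : permute C (Equiv.refl ι) = 𝟭 _ :=
  comap_permute C (Equiv.refl ι)

/-- Both sides are inverse to reindexing along `e'.trans e`. -/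
theorem permute_permute {ι' ι'' : Type} (C : ι → WaldCat.{u}) (e : ι' ≃ ι) (e' : ι'' ≃ ι') :
    permute (fun j => C (e j)) e' ⋙ permute C e = permute C (e'.trans e) := by
  have h := permute_comap C (e'.trans e)
  have h1 : Pi.comap (fun i => (C i).carrier) (e'.trans e) ⋙ permute (fun j => C (e j)) e' ⋙
      permute C e = 𝟭 _ := by
    change Pi.comap (fun i => (C i).carrier) e ⋙ (Pi.comap (fun j => (C (e j)).carrier) e' ⋙
      permute (fun j => C (e j)) e') ⋙ permute C e = 𝟭 _
    rw [comap_permute]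
    exact comap_permute C e
  exact (congrArg (· ⋙ permute (fun j => C (e j)) e' ⋙ permute C e) h).symm.trans
    (congrArg (permute C (e'.trans e) ⋙ ·) h1)

/-- Precomposition of multiexact functors. -/
def precompFunctor {ι' : Type} {C : ι → WaldCat.{u}} {C' : ι' → WaldCat.{u}}
    (E : (∀ j, C' j) ⥤ (∀ i, C i))
    (hE : ∀ F : (∀ i, C i) ⥤ D, IsMultiexact C D F → IsMultiexact C' D (E ⋙ F)) :
    (∀ _ : Unit, Multiexact C D) ⥤ Multiexact C' D where
  obj F := ⟨E ⋙ (F ()).obj, hE _ (F ()).property⟩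
  map α := ObjectProperty.homMk (Functor.whiskerLeft E (α ()).hom)

/-- Substituting one equality of functors settles objects and morphisms together, with no comparison
of transported transformations. `homActFunctor` is an instance of `precompFunctor`. -/
theorem precompFunctor_congr {ι' : Type} {C : ι → WaldCat.{u}} {C' : ι' → WaldCat.{u}}
    {E E' : (∀ j, C' j) ⥤ (∀ i, C i)} (e : E = E')
    (hE : ∀ F : (∀ i, C i) ⥤ D, IsMultiexact C D F → IsMultiexact C' D (E ⋙ F))
    (hE' : ∀ F : (∀ i, C i) ⥤ D, IsMultiexact C D F → IsMultiexact C' D (E' ⋙ F)) :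
    precompFunctor E hE = precompFunctor E' hE' := by
  subst e; rfl

variable [Finite ι] (h : MultiexactStable.{u})

theorem homActFunctor_refl (C : ι → WaldCat.{u})
    (hW : IsWaldhausen (Multiexact C D) homCof homWeq) :
    homActFunctor h C D (Equiv.refl ι) = idFunctor (internalHom C D hW) :=
  precompFunctor_congr (permute_refl C) (h.act (Equiv.refl ι)) fun _ hF => hF

theorem comap_homActFunctor_trans {ι' ι'' : Type} [Finite ι'] [Finite ι''] (C : ι → WaldCat.{u})
    (e : ι' ≃ ι) (e' : ι'' ≃ ι') :
    Functor.pi' (fun _ : Unit => homActFunctor h C D e) ⋙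
      homActFunctor h (fun j => C (e j)) D e' = homActFunctor h C D (e'.trans e) :=
  precompFunctor_congr (permute_permute C e e')
    (fun F hF => h.act e' _ (h.act e F hF)) (h.act (e'.trans e))

variable {κ : Type} {C : ι ⊕ κ → WaldCat.{u}}

/-- The equivariance law on its transport-free side: both functors are instances of `uncurry₂`, and
reindexing cancels each of the two permutations. -/
theorem comap_uncurryHom_homActFunctor {ι' κ' : Type} [Finite ι'] [Finite κ'] (e : ι' ≃ ι)
    (t : κ' ≃ κ) (K : (∀ k, C (Sum.inr k)) ⥤ Multiexact (fun i => C (Sum.inl i)) D) :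
    Pi.comap (fun s => (C s).carrier) (Equiv.sumCongr e t) ⋙
      uncurryHom (C := fun s => C (Equiv.sumCongr e t s))
        (Functor.pi' (fun _ : Unit => permute (fun k => C (Sum.inr k)) t ⋙ K) ⋙
          homActFunctor h (fun i => C (Sum.inl i)) D e) = uncurryHom K :=
  congrArg₂ (fun E₁ E₂ => uncurry₂ (C := fun i => C (Sum.inl i))
      (Pi.comap (fun s => (C s).carrier) Sum.inl ⋙ E₁)
      (Pi.comap (fun s => (C s).carrier) Sum.inr ⋙ E₂) K)
    (comap_permute (fun i => C (Sum.inl i)) e) (comap_permute (fun k => C (Sum.inr k)) t)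

/-- Currying of multiexact functors. -/
def curryEquiv [Finite κ] (hW : IsWaldhausen (Multiexact (fun i => C (Sum.inl i)) D) homCof homWeq) :
    Multiexact (fun k => C (Sum.inr k)) (internalHom (fun i => C (Sum.inl i)) D hW) ≃
      Multiexact C D where
  toFun K := ⟨uncurryHom K.obj, isMultiexact_uncurryHom hW K.property⟩
  invFun F := ⟨curryHom F.property, isMultiexact_of_uncurryHom hW (by
    rw [uncurryHom_curryHom]
    exact F.property)⟩
  left_inv K := multiexact_ext (curryHom_uncurryHom (isMultiexact_uncurryHom hW K.property))
  right_inv F := multiexact_ext (uncurryHom_curryHom F.property)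

/-- Exhibits the composite without the auxiliary index type `Σ _ : Unit, ι` that enters the
definition of `postcomp`. -/
theorem postcomp_obj {B B' : WaldCat.{u}} {A : ι → WaldCat.{u}}
    (u : Multiexact (fun _ : Unit => B) B') (f : Multiexact A B) :
    ((waldMulti h).postcomp (A := A) (B := B) (B' := B') u f : Multiexact A B').obj =
      Functor.pi' (fun _ : Unit => f.obj) ⋙ u.obj :=
  (eq_actFunctor (C := fun p : (Σ _ : Unit, ι) => A p.2) (e := (unitSigma ι).symm)
    (F := compFunctor (A := fun p : (Σ _ : Unit, ι) => A p.2) u.obj fun _ => f.obj)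
    (H := Functor.pi' (fun _ : Unit => f.obj) ⋙ u.obj) rfl).symm

/-- Waldhausen categories and multiexact functors form a closed symmetric multicategory. -/
theorem isClosedMulticategory_waldMulti
    (hW : ∀ {ι : Type} [Finite ι] (C : ι → WaldCat.{u}) (D : WaldCat.{u}),
      IsWaldhausen (Multiexact C D) homCof homWeq)
    (hev : ∀ {ι : Type} [Finite ι] (C : ι → WaldCat.{u}) (D : WaldCat.{u}),
      IsMultiexact _ D (evFunctor C D (hW C D)))
    (hact : ∀ {ι ι' : Type} [Finite ι] [Finite ι'] (C : ι → WaldCat.{u}) (D : WaldCat.{u})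
      (e : ι' ≃ ι), IsMultiexact (fun _ : Unit => internalHom C D (hW C D))
        (internalHom (fun j => C (e j)) D (hW _ D)) (homActFunctor h C D e)) :
    IsClosedMulticategory (waldMulti h) (waldHom h hW hev hact) where
  symmetric := isSymmetricMulticategory_waldMulti h
  homAct_refl A B := multiexact_ext (homActFunctor_refl h A (hW A B))
  homAct_homAct A B e e' := multiexact_ext <|
    (postcomp_obj h _ _).trans (comap_homActFunctor_trans h A e e')
  closed := by
    refine ⟨fun {ι κ} _ _ X B => curryEquiv (C := X) (D := B) (hW _ B), ?_, ?_⟩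
    · intro ι κ _ _ X B f
      exact multiexact_ext (eq_actFunctor (C := X) (D := B) (e := evInputsEquiv ι κ)
        (F := uncurryHom f.obj)
        (H := ((waldHom h hW hev hact).evComp X B f : Multiexact _ _).obj) rfl).symm
    · intro ι ι' κ κ' _ _ _ _ (X : ι ⊕ κ → WaldCat.{u}) B e t f
      let g := (waldMulti h).postcomp ((waldHom h hW hev hact).homAct (fun i => X (Sum.inl i)) B e)
        ((waldMulti h).act t f)
      have hg := postcomp_obj h ⟨_, hact (fun i => X (Sum.inl i)) B e⟩ ((waldMulti h).act t f)
      refine multiexact_ext (eq_actFunctor (C := X) (D := B) (e := Equiv.sumCongr e t)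
        (F := uncurryHom f.obj)
        (H := uncurryHom (C := fun s => X (Equiv.sumCongr e t s)) g.obj) ?_)
      refine Eq.trans ?_ (comap_uncurryHom_homActFunctor h e t f.obj)
      exact congrArg (fun K => Pi.comap (fun s => (X s).carrier) (Equiv.sumCongr e t) ⋙
        uncurryHom (C := fun s => X (Equiv.sumCongr e t s)) K) hg

end closedMulticategory

end Waldhausen

end

open Waldhausen

theorem mainTheorem1 :
    ∃ (h : MultiexactStable.{u})
      (hW : ∀ {ι : Type} [Finite ι] (C : ι → WaldCat.{u}) (D : WaldCat.{u}),
        IsWaldhausen (Multiexact C D) homCof homWeq)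
      (hev : ∀ {ι : Type} [Finite ι] (C : ι → WaldCat.{u}) (D : WaldCat.{u}),
        IsMultiexact (Sum.elim C (fun _ : Unit => internalHom C D (hW C D))) D (evFunctor C D (hW C D)))
      (hact : ∀ {ι ι' : Type} [Finite ι] [Finite ι'] (C : ι → WaldCat.{u}) (D : WaldCat.{u})
        (e : ι' ≃ ι),
        IsMultiexact (fun _ : Unit => internalHom C D (hW C D)) (internalHom (fun j => C (e j)) D (hW _ D))
          (homActFunctor h C D e)),
      IsClosedMulticategory (waldMulti h) (waldHom h hW hev hact) ∧
      ∀ {ι : Type} [Finite ι] {J : ι → Type} [∀ i, Finite (J i)]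
        (A : (Σ i, J i) → WaldCat.{u}) (B : ι → WaldCat.{u}) (D : WaldCat.{u}),
        IsMultiexact
          (Sum.elim (fun _ : Unit => internalHom B D (hW B D))
            (fun i => internalHom (fun j => A ⟨i, j⟩) (B i) (hW _ (B i))))
          (internalHom A D (hW A D)) (compositionFunctor h hW A B D) :=
  ⟨multiexactStable, fun _ _ => isWaldhausen_multiexact, fun _ _ => isMultiexact_evFunctor _,
    fun _ _ _ => isMultiexact_homActFunctor _ _ _ _ _ _,
    isClosedMulticategory_waldMulti _ _ _ _,
    fun A B D => isMultiexact_compositionFunctor multiexactStable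
      (fun _ _ => isWaldhausen_multiexact) A B D⟩
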